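/- Let $A$ be a left noetherian ring (associative, with $1$) and let $\omega\in A$ be regular ($a\omega=0$ or $\omega a=0$ implies $a=0$) and normal ($A\omega=\omega A$). Let $\sigma:A\to A$ be the unique ring automorphism with $\omega a=\sigma(a)\omega$ for all $a\in A$, and put $\bar A=A/(\omega)$. All modules are left modules. For an $A$-module $M$ let ${}^\sigma(M)$ be the twisted module with the same elements and action $a\cdot{}^\sigma(x)={}^\sigma(\sigma(a)x)$, and let $\omega_M:M\to{}^\sigma(M)$ be the $A$-linear map $x\mapsto{}^\sigma(\omega x)$. Let $n\ge 1$. An $n$-fold module factorization $X$ of $\omega$ is a sequence of $A$-linear maps $$X^0\xrightarrow{d^0}X^1\xrightarrow{d^1}\cdots\xrightarrow{d^{n-2}}X^{n-1}\xrightarrow{d^{n-1}}{}^\sigma(X^0)$$ such that for every $0\le i\le n-1$ the $n$-fold composition $X^i\to\cdots\to X^{n-1}\to{}^\sigma(X^0)\to\cdots\to{}^\sigma(X^i)$ equals $\omega_{X^i}$. A morphism $X\to Y$ is a sequence $(f^0,\dots,f^{n-1})$ of $A$-linear maps $f^i:X^i\to Y^i$ commuting with all the maps $d^i$ (with ${}^\sigma(f^0)$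 on ${}^\sigma(X^0)$). Denote the resulting category by $\mathsf F_n(A;\omega)$. For an $A$-module $M$ let $\theta^0(M)$ be the factorization $M\xrightarrow{\mathrm{id}}M\xrightarrow{\mathrm{id}}\cdots\xrightarrow{\mathrm{id}}M\xrightarrow{\omega_M}{}^\sigma(M)$. A module $G$ over a ring $R$ is Gorenstein projective if $G\cong\operatorname{Ker}(d_P^0)$ for some exact complex $P^\bullet$ of projective $R$-modules such that $\operatorname{Hom}_R(P^\bullet,Q)$ is exact for every projective $R$-module $Q$. Let $\mathsf G^0\mathsf F_n(A;\omega)$ be the full subcategory of $\mathsf F_n(A;\omega)$ of those $X$ such that all $X^i$ are Gorenstein projective $A$-modules and $X^{n-1}$ is a projective $A$-module. Let $\Lambda_{n-1}$ be the ring of upper triangular $(n-1)\times(n-1)$ matrices over $\bar A$ (the zero ring if $n=1$), and let $\Lambda_{n-1}\mathrm{GProj}$ be the full subcategory of $\Lambda_{n-1}$-modules consisting of the Gorenstein projective ones. Write $d^{0,i}=d^i\cdots d^0:X^0\to X^{i+1}$ for $0\le i\le n-2$. The modules $\operatorname{Cok}(d^{0,i})$ are annihilated by $\omega$, hence are $\bar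 A$-modules, and the maps $d^{i+1}$ induce maps $\operatorname{Cok}(d^{0,i})\to\operatorname{Cok}(d^{0,i+1})$. The zeroth cokernel functor is $$\mathrm{Cok}^0:\mathsf F_n(A;\omega)\to\Lambda_{n-1}\text{-Mod},\qquad X\mapsto\begin{pmatrix}\operatorname{Cok}(d^{0,n-2})\\ \vdots\\ \operatorname{Cok}(d^{0,1})\\ \operatorname{Cok}(d^{0,0})\end{pmatrix},$$ where matrices act on columns by matrix multiplication through the induced maps. Let $\mathcal I$ be the ideal of morphisms of $\mathsf F_n(A;\omega)$ that factor through $\theta^0(P)$ for some projective $A$-module $P$, and let $\mathsf G^0\mathsf F_n(A;\omega)/\mathcal I$ be the factor category of $\mathsf G^0\mathsf F_n(A;\omega)$ in which two parallel morphisms are identified when their difference lies in $\mathcal I$. Then $\mathrm{Cok}^0$ sends every object of $\mathsf G^0\mathsf F_n(A;\omega)$ to a Gorenstein projective $\Lambda_{n-1}$-module, and the induced functor $$\mathrm{Cok}^0:\mathsf G^0\mathsf F_n(A;\omega)/\mathcal I\longrightarrow\Lambda_{n-1}\mathrm{GProj}$$ is an additive equivalence of categories. -/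

import Mathlib

open CategoryTheory

universe u

noncomputable section

namespace ModFact

/-! ### The ring-theoretic setting -/

section Setting

variable {A : Type u} [Ring A]

/-- `ω` is regular (`a ω = 0` or `ω a = 0` implies `a = 0`) and normal (`A ω = ω A`). -/
class RegularNormal (ω : A) : Prop where
  regular : ∀ a : A, a * ω = 0 ∨ ω * a = 0 → a = 0
  normal : Set.range (fun a : A => a * ω) = Set.range (fun a : A => ω * a)

variable (ω : A) [RegularNormal ω]

theorem exists_twist (a : A) : ∃ b : A, ω * a = b * ω := by
  have h : ω * a ∈ Set.range (fun a : A => a * ω) := by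
    rw [RegularNormal.normal]; exact ⟨a, rfl⟩
  obtain ⟨b, hb⟩ := h
  exact ⟨b, hb.symm⟩

theorem right_cancel {a b : A} (h : a * ω = b * ω) : a = b :=
  sub_eq_zero.1 (RegularNormal.regular (ω := ω) _ (Or.inl (by rw [sub_mul, h, sub_self])))

theorem left_cancel {a b : A} (h : ω * a = ω * b) : a = b :=
  sub_eq_zero.1 (RegularNormal.regular (ω := ω) _ (Or.inr (by rw [mul_sub, h, sub_self])))

/-- The underlying function of the automorphism `σ`. -/
def sigmaFun (a : A) : A := (exists_twist ω a).choose

theorem sigmaFun_spec (a : A) : ω * a = sigmaFun ω a * ω := (exists_twist ω a).choose_spec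

/-- The ring endomorphism underlying `σ`. -/
def sigmaHom : A →+* A where
  toFun := sigmaFun ω
  map_one' := right_cancel ω (by rw [← sigmaFun_spec, mul_one, one_mul])
  map_zero' := right_cancel ω (by rw [← sigmaFun_spec, mul_zero, zero_mul])
  map_mul' a b := right_cancel ω (by
    rw [← sigmaFun_spec ω (a * b), mul_assoc, ← sigmaFun_spec ω b, ← mul_assoc,
      sigmaFun_spec ω a, mul_assoc])
  map_add' a b := right_cancel ω (by
    rw [← sigmaFun_spec, mul_add, add_mul, sigmaFun_spec, sigmaFun_spec ω b])

/-- The unique ring automorphism `σ` of `A` with `ω a = σ(a) ω` for all `a`. -/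
def sigma : A ≃+* A :=
  RingEquiv.ofBijective (sigmaHom ω) ⟨fun a b h => left_cancel ω (by
      rw [sigmaFun_spec, sigmaFun_spec ω b]; exact congrArg (· * ω) h), fun b => by
      have h : b * ω ∈ Set.range (fun a : A => ω * a) := by
        rw [← RegularNormal.normal]; exact ⟨b, rfl⟩
      obtain ⟨a, ha⟩ := h
      exact ⟨a, right_cancel ω ((sigmaFun_spec ω a).symm.trans ha)⟩⟩

theorem sigma_spec (a : A) : ω * a = sigma ω a * ω := sigmaFun_spec ω a

/-- The ideal `A ω` is two-sided, so it is the ideal `(ω)`. -/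
instance isTwoSided_span : (Ideal.span {ω} : Ideal A).IsTwoSided where
  mul_mem_of_left {a} b ha := by
    obtain ⟨c, rfl⟩ := Ideal.mem_span_singleton'.1 ha
    refine Ideal.mem_span_singleton'.2 ⟨c * sigma ω b, ?_⟩
    rw [mul_assoc, ← sigma_spec, mul_assoc]

/-- The quotient ring `Ā = A / (ω)`. -/
abbrev Abar : Type u := A ⧸ (Ideal.span {ω} : Ideal A)

end Setting

/-! ### Gorenstein projective modules -/

section Gorenstein

variable {R : Type u} [Ring R]

/-- A totally acyclic complex of projective modules: an exact complex of projective modules `P`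
such that `Hom(P, Q)` is exact for every projective module `Q`. -/
structure IsTotallyAcyclic (P : CochainComplex (ModuleCat.{u} R) ℤ) : Prop where
  projective : ∀ i, Module.Projective R (P.X i)
  exact : ∀ i, Function.Exact (P.d (i - 1) i).hom (P.d i (i + 1)).hom
  hom_exact : ∀ Q : ModuleCat.{u} R, Module.Projective R Q → ∀ (i : ℤ) (f : P.X i ⟶ Q),
    P.d (i - 1) i ≫ f = 0 → ∃ g : P.X (i + 1) ⟶ Q, P.d i (i + 1) ≫ g = f

/-- Gorenstein projective modules: `G ≅ Ker (d⁰)` for a totally acyclic complex. -/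
def IsGorensteinProjective : ObjectProperty (ModuleCat.{u} R) := fun G =>
  ∃ P : CochainComplex (ModuleCat.{u} R) ℤ, IsTotallyAcyclic P ∧
    Nonempty (ModuleCat.of R (LinearMap.ker (P.d 0 1).hom) ≅ G)

variable (R) in
/-- The category `R-GProj` of Gorenstein projective `R`-modules. -/
abbrev GProj : Type (u + 1) := (IsGorensteinProjective (R := R)).FullSubcategory

end Gorenstein

/-! ### Upper triangular matrix rings and their modules -/

section Triangular

variable (R : Type u) [Ring R] (m : ℕ)

/-- The ring of upper triangular `m × m` matrices over `R`. -/
def upperTriangular : Subring (Matrix (Fin m) (Fin m) R) where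
  carrier := {M | M.IsUpperTriangular}
  zero_mem' := Matrix.blockTriangular_zero
  one_mem' := Matrix.blockTriangular_one
  mul_mem' := Matrix.BlockTriangular.mul
  add_mem' := Matrix.BlockTriangular.add
  neg_mem' := Matrix.BlockTriangular.neg

variable {R m}

/-- The columns `(M_{m-1}, …, M_1, M_0)ᵀ` attached to a sequence
`M_0 ⟶ M_1 ⟶ ⋯ ⟶ M_{m-1}` of `R`-modules: the entry of index `a` lies in `M_{m-1-a}`. -/
def Column (M : Fin m ⥤ ModuleCat.{u} R) : Type u := (a : Fin m) → M.obj a.rev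

namespace Column

variable (M : Fin m ⥤ ModuleCat.{u} R)

instance : AddCommGroup (Column M) :=
  inferInstanceAs (AddCommGroup ((a : Fin m) → M.obj a.rev))

/-- For `a ≤ b`, the transition map from the entry of index `b` to the entry of index `a`. -/
def trans {a b : Fin m} (h : a ≤ b) : M.obj b.rev →ₗ[R] M.obj a.rev :=
  (M.map (homOfLE (Fin.rev_le_rev.2 h))).hom

theorem trans_self (a : Fin m) (x : M.obj a.rev) : trans M (le_refl a) x = x := by
  simp [trans]

theorem trans_trans {a b c : Fin m} (h : a ≤ b) (h' : b ≤ c) (x : M.obj c.rev) :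
    trans M h (trans M h' x) = trans M (h.trans h') x := by
  have : homOfLE (Fin.rev_le_rev.2 (h.trans h')) =
      homOfLE (Fin.rev_le_rev.2 h') ≫ homOfLE (Fin.rev_le_rev.2 h) := rfl
  rw [trans, trans, trans, this, Functor.map_comp]
  rfl

/-- The entry `(l, x) ↦ l · φ_{ba}(x)` of matrix multiplication (`0` unless `a ≤ b`). -/
def entry (a b : Fin m) : R →+ M.obj b.rev →+ M.obj a.rev :=
  if h : a ≤ b then
    { toFun := fun l => (AddMonoidHom.mk' (fun y : M.obj a.rev => l • y)
          (fun x y => smul_add l x y)).comp (trans M h).toAddMonoidHom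
      map_zero' := by ext x; simp
      map_add' := fun l l' => by ext x; simp [add_smul] }
  else 0

theorem entry_of_le {a b : Fin m} (h : a ≤ b) (l : R) (x : M.obj b.rev) :
    entry M a b l x = l • trans M h x := by
  simp [entry, h]

theorem entry_of_not_le {a b : Fin m} (h : ¬ a ≤ b) (l : R) (x : M.obj b.rev) :
    entry M a b l x = 0 := by
  simp [entry, h]

/-- Matrix multiplication of an upper triangular matrix with a column:
`(l x)_a = ∑_{a ≤ b} l_{ab} φ_{ba}(x_b)`. -/
instance : SMul (upperTriangular R m) (Column M) where
  smul l x := fun a => ∑ b, entry M a b (l.1 a b) (x b)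

theorem smul_apply (l : upperTriangular R m) (x : Column M) (a : Fin m) :
    (l • x) a = ∑ b, entry M a b (l.1 a b) (x b) := rfl

theorem add_apply (x y : Column M) (a : Fin m) : (x + y) a = x a + y a := rfl

theorem zero_apply (a : Fin m) : (0 : Column M) a = 0 := rfl

theorem entry_entry (l k : upperTriangular R m) (a b c : Fin m) (x : M.obj c.rev) :
    entry M a b (l.1 a b) (entry M b c (k.1 b c) x) =
      entry M a c (l.1 a b * k.1 b c) x := by
  by_cases h : a ≤ b
  · by_cases h' : b ≤ c
    · rw [entry_of_le M h, entry_of_le M h', entry_of_le M (h.trans h'), map_smul, trans_trans,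
        mul_smul]
    · rw [entry_of_not_le M h', k.2 (lt_of_not_ge h')]
      simp
  · rw [l.2 (lt_of_not_ge h)]
    simp

instance : Module (upperTriangular R m) (Column M) where
  one_smul x := by
    funext a
    rw [smul_apply, Finset.sum_eq_single a]
    · rw [entry_of_le M (le_refl a), trans_self]
      simp
    · intro b _ hb
      have : (1 : upperTriangular R m).1 a b = 0 := Matrix.one_apply_ne hb.symm
      rw [this]; simp
    · simp
  mul_smul l k x := by
    funext a
    rw [smul_apply, smul_apply]
    have : ∀ c, (l * k).1 a c = ∑ b, l.1 a b * k.1 b c := fun c => Matrix.mul_apply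
    simp only [this, smul_apply, map_sum, entry_entry, AddMonoidHom.finsetSum_apply]
    exact Finset.sum_comm
  smul_zero l := by
    funext a
    simp [smul_apply, zero_apply]
  smul_add l x y := by
    funext a
    simp [smul_apply, add_apply, Finset.sum_add_distrib]
  add_smul l k x := by
    funext a
    have : ∀ b, (l + k).1 a b = l.1 a b + k.1 a b := fun b => rfl
    simp [smul_apply, add_apply, this, Finset.sum_add_distrib]
  zero_smul x := by
    funext a
    have : ∀ b, (0 : upperTriangular R m).1 a b = 0 := fun b => rfl
    simp [smul_apply, zero_apply, this]

theorem entry_naturality {M N : Fin m ⥤ ModuleCat.{u} R} (f : M ⟶ N) (a b : Fin m) (l : R)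
    (x : M.obj b.rev) :
    (f.app a.rev).hom (entry M a b l x) = entry N a b l ((f.app b.rev).hom x) := by
  by_cases h : a ≤ b
  · rw [entry_of_le M h, entry_of_le N h, map_smul]
    congr 1
    exact (NatTrans.naturality_apply f (homOfLE (Fin.rev_le_rev.2 h)) x)
  · rw [entry_of_not_le M h, entry_of_not_le N h, map_zero]

/-- The linear map on columns induced by a morphism of sequences, entry by entry. -/
def map {M N : Fin m ⥤ ModuleCat.{u} R} (f : M ⟶ N) :
    Column M →ₗ[upperTriangular R m] Column N where
  toFun x := fun a => (f.app a.rev).hom (x a)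
  map_add' x y := by
    funext a
    exact map_add _ _ _
  map_smul' l x := by
    funext a
    change (f.app a.rev).hom (∑ b, entry M a b (l.1 a b) (x b)) =
      ∑ b, entry N a b (l.1 a b) ((f.app b.rev).hom (x b))
    simp only [map_sum, entry_naturality]

end Column

variable (R m) in
/-- The functor from sequences of `R`-modules to modules over the ring of upper triangular
matrices. -/
def columnFunctor : (Fin m ⥤ ModuleCat.{u} R) ⥤ ModuleCat.{u} (upperTriangular R m) where
  obj M := ModuleCat.of _ (Column M)
  map f := ModuleCat.ofHom (Column.map f)

end Triangular

/-! ### Module factorizations -/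

section Factorizations

variable {A : Type u} [Ring A] (ω : A) [RegularNormal ω] (m : ℕ)

/-- An `n`-fold module factorization of `ω`, where `n = m + 1`: a sequence
`X⁰ ⟶ X¹ ⟶ ⋯ ⟶ X^m` of `m` morphisms of `A`-modules (a functor on the poset `Fin (m + 1)`),
together with a morphism `d^m : X^m ⟶ ^σ(X⁰)`, such that every `n`-fold composition
`X^i ⟶ X^m ⟶ ^σ(X⁰) ⟶ ^σ(X^i)` is `x ↦ ω x`.  A morphism of `A`-modules `M ⟶ ^σ(N)` into the
twisted module (`a · ^σ(y) = ^σ(σ(a) y)`) is the same as a `σ`-semilinear map `M → N`. -/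
structure ModuleFactorization where
  seq : Fin (m + 1) ⥤ ModuleCat.{u} A
  last : seq.obj (Fin.last m) →ₛₗ[(sigma ω : A →+* A)] seq.obj 0
  comp_eq : ∀ (i : Fin (m + 1)) (x : seq.obj i),
    (seq.map (homOfLE (Fin.zero_le i))).hom
      (last ((seq.map (homOfLE (Fin.le_last i))).hom x)) = ω • x

namespace ModuleFactorization

variable {ω m}

/-- The additive group of morphisms: sequences `(f⁰, …, f^m)` commuting with all the structure
maps. -/
def homs (X Y : ModuleFactorization ω m) : AddSubgroup (X.seq ⟶ Y.seq) where
  carrier := {f | ∀ x : X.seq.obj (Fin.last m),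
    (f.app 0).hom (X.last x) = Y.last ((f.app (Fin.last m)).hom x)}
  zero_mem' x := by simp
  add_mem' {f g} hf hg x := by
    simp only [NatTrans.app_add, ModuleCat.hom_add, LinearMap.add_apply, map_add, hf x, hg x]
  neg_mem' {f} hf x := by
    simp only [NatTrans.app_neg, ModuleCat.hom_neg, LinearMap.neg_apply, map_neg, hf x]

/-- The category `F_n(A; ω)`, `n = m + 1`. -/
instance : Category (ModuleFactorization ω m) where
  Hom X Y := homs X Y
  id X := ⟨𝟙 X.seq, fun x => rfl⟩
  comp {X Y Z} f g := ⟨f.1 ≫ g.1, fun x => by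
    have hf := f.2 x
    have hg := g.2 ((f.1.app (Fin.last m)).hom x)
    simp only [NatTrans.comp_app, ModuleCat.hom_comp, LinearMap.comp_apply, hf, hg]⟩
  id_comp f := Subtype.ext (Category.id_comp f.1)
  comp_id f := Subtype.ext (Category.comp_id f.1)
  assoc f g h := Subtype.ext (Category.assoc f.1 g.1 h.1)

instance : Preadditive (ModuleFactorization ω m) where
  homGroup X Y := inferInstanceAs (AddCommGroup (homs X Y))
  add_comp _ _ _ f g h := Subtype.ext (Preadditive.add_comp _ _ _ f.1 g.1 h.1)
  comp_add _ _ _ f g h := Subtype.ext (Preadditive.comp_add _ _ _ f.1 g.1 h.1)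

/-- The underlying morphism of sequences. -/
def natTrans {X Y : ModuleFactorization ω m} (f : X ⟶ Y) : X.seq ⟶ Y.seq := f.1

/-- The `i`-th component of a morphism of module factorizations. -/
def component {X Y : ModuleFactorization ω m} (f : X ⟶ Y) (i : Fin (m + 1)) :
    X.seq.obj i →ₗ[A] Y.seq.obj i := ((natTrans f).app i).hom

variable (ω m) in
/-- The trivial module factorization
`θ⁰(M) : M ⟶ M ⟶ ⋯ ⟶ M ⟶ ^σ(M)` with maps `id, …, id, ω`. -/
def theta0 : ModuleCat.{u} A ⥤ ModuleFactorization ω m where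
  obj M :=
    { seq := (Functor.const (Fin (m + 1))).obj M
      last :=
        { toFun := fun x : M => ω • x
          map_add' := fun x y => smul_add ω x y
          map_smul' := fun a x => by
            change ω • a • (x : M) = sigma ω a • ω • (x : M)
            rw [← mul_smul, ← mul_smul, sigma_spec] }
      comp_eq := fun i x => rfl }
  map f := ⟨(Functor.const (Fin (m + 1))).map f, fun x => map_smul f.hom ω x⟩

/-! #### The zeroth cokernel functor -/

/-- The map `d^{0, i} : X⁰ ⟶ X^{i+1}`. -/
def fromZero (X : ModuleFactorization ω m) (i : Fin m) :
    X.seq.obj 0 →ₗ[A] X.seq.obj i.succ :=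
  (X.seq.map (homOfLE (Fin.zero_le i.succ))).hom

/-- The cokernel of `d^{0, i} : X⁰ ⟶ X^{i+1}`. -/
abbrev Cok (X : ModuleFactorization ω m) (i : Fin m) : Type u :=
  X.seq.obj i.succ ⧸ LinearMap.range (fromZero X i)

theorem cok_torsion (X : ModuleFactorization ω m) (i : Fin m) :
    Module.IsTorsionBySet A (Cok X i) (Ideal.span {ω} : Ideal A) := by
  rintro x ⟨a, ha⟩
  obtain ⟨b, rfl⟩ := Ideal.mem_span_singleton'.1 ha
  obtain ⟨x, rfl⟩ := Submodule.mkQ_surjective _ x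
  have h : ω • x ∈ LinearMap.range (fromZero X i) := ⟨_, X.comp_eq i.succ x⟩
  change (b * ω) • Submodule.mkQ (LinearMap.range (fromZero X i)) x = 0
  rw [mul_smul, ← map_smul, Submodule.mkQ_apply, (Submodule.Quotient.mk_eq_zero _).2 h, smul_zero]

/-- The cokernels are annihilated by `ω`, hence are modules over `Ā = A / (ω)`. -/
instance (X : ModuleFactorization ω m) (i : Fin m) : Module (Abar ω) (Cok X i) :=
  (cok_torsion X i).module

/-- The class of an element of `X^{i+1}` in the cokernel. -/
def toCok (X : ModuleFactorization ω m) (i : Fin m) : X.seq.obj i.succ →ₗ[A] Cok X i :=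
  Submodule.mkQ _

theorem toCok_surjective (X : ModuleFactorization ω m) (i : Fin m) :
    Function.Surjective (toCok X i) := Submodule.mkQ_surjective _

theorem toCok_eq_zero (X : ModuleFactorization ω m) (i : Fin m) (x : X.seq.obj 0) :
    toCok X i (fromZero X i x) = 0 :=
  (Submodule.Quotient.mk_eq_zero _).2 ⟨x, rfl⟩

/-- The map between cokernels induced by an `A`-linear map `g`; it is `Ā`-linear. -/
def cokMap {X Y : ModuleFactorization ω m} {i j : Fin m}
    (g : X.seq.obj i.succ →ₗ[A] Y.seq.obj j.succ)
    (hg : LinearMap.range (fromZero X i) ≤ (LinearMap.range (fromZero Y j)).comap g) :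
    Cok X i →ₗ[Abar ω] Cok Y j where
  toFun := Submodule.mapQ _ _ g hg
  map_add' := map_add (Submodule.mapQ _ _ g hg)
  map_smul' a x := by
    obtain ⟨a, rfl⟩ := Ideal.Quotient.mk_surjective a
    exact map_smul (Submodule.mapQ _ _ g hg) a x

theorem cokMap_toCok {X Y : ModuleFactorization ω m} {i j : Fin m}
    (g : X.seq.obj i.succ →ₗ[A] Y.seq.obj j.succ)
    (hg : LinearMap.range (fromZero X i) ≤ (LinearMap.range (fromZero Y j)).comap g)
    (x : X.seq.obj i.succ) : cokMap g hg (toCok X i x) = toCok Y j (g x) := rfl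

/-- The map `d : X^{i+1} ⟶ X^{j+1}` for `i ≤ j`. -/
def succMap (X : ModuleFactorization ω m) {i j : Fin m} (h : i ≤ j) :
    X.seq.obj i.succ →ₗ[A] X.seq.obj j.succ :=
  (X.seq.map (homOfLE (Fin.succ_le_succ_iff.2 h))).hom

theorem succMap_self (X : ModuleFactorization ω m) {i : Fin m} (x : X.seq.obj i.succ) :
    succMap X (le_refl i) x = x := by
  simp [succMap]

theorem succMap_succMap (X : ModuleFactorization ω m) {i j k : Fin m} (h : i ≤ j) (h' : j ≤ k)
    (x : X.seq.obj i.succ) : succMap X h' (succMap X h x) = succMap X (h.trans h') x := by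
  have : homOfLE (Fin.succ_le_succ_iff.2 (h.trans h')) =
      homOfLE (Fin.succ_le_succ_iff.2 h) ≫ homOfLE (Fin.succ_le_succ_iff.2 h') := rfl
  rw [succMap, succMap, succMap, this, Functor.map_comp]
  rfl

theorem succMap_fromZero (X : ModuleFactorization ω m) {i j : Fin m} (h : i ≤ j)
    (x : X.seq.obj 0) : succMap X h (fromZero X i x) = fromZero X j x := by
  have : homOfLE (Fin.zero_le j.succ) =
      homOfLE (Fin.zero_le i.succ) ≫ homOfLE (Fin.succ_le_succ_iff.2 h) := rfl
  rw [succMap, fromZero, fromZero, this, Functor.map_comp]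
  rfl

theorem component_fromZero {X Y : ModuleFactorization ω m} (f : X ⟶ Y) (i : Fin m)
    (x : X.seq.obj 0) :
    component f i.succ (fromZero X i x) = fromZero Y i (component f 0 x) :=
  NatTrans.naturality_apply (natTrans f) (homOfLE (Fin.zero_le i.succ)) x

theorem component_succMap {X Y : ModuleFactorization ω m} (f : X ⟶ Y) {i j : Fin m} (h : i ≤ j)
    (x : X.seq.obj i.succ) :
    component f j.succ (succMap X h x) = succMap Y h (component f i.succ x) :=
  NatTrans.naturality_apply (natTrans f) (homOfLE (Fin.succ_le_succ_iff.2 h)) x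

/-- The map `Cok(d^{0,i}) ⟶ Cok(d^{0,j})` induced by `d : X^{i+1} ⟶ X^{j+1}`, for `i ≤ j`. -/
def cokTrans (X : ModuleFactorization ω m) {i j : Fin m} (h : i ≤ j) :
    Cok X i →ₗ[Abar ω] Cok X j :=
  cokMap (succMap X h) (by rintro _ ⟨x, rfl⟩; exact ⟨x, (succMap_fromZero X h x).symm⟩)

/-- The map on cokernels induced by a morphism of module factorizations. -/
def cokComponent {X Y : ModuleFactorization ω m} (f : X ⟶ Y) (i : Fin m) :
    Cok X i →ₗ[Abar ω] Cok Y i :=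
  cokMap (component f i.succ)
    (by rintro _ ⟨x, rfl⟩; exact ⟨_, (component_fromZero f i x).symm⟩)

/-- The sequence `Cok(d^{0,0}) ⟶ Cok(d^{0,1}) ⟶ ⋯ ⟶ Cok(d^{0,m-1})` of `Ā`-modules, with maps
induced by the structure maps of `X`. -/
def cokSeqObj (X : ModuleFactorization ω m) : Fin m ⥤ ModuleCat.{u} (Abar ω) where
  obj i := ModuleCat.of _ (Cok X i)
  map {i j} h := ModuleCat.ofHom (cokTrans X (leOfHom h))
  map_id i := ModuleCat.hom_ext (LinearMap.ext fun x => by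
    obtain ⟨x, rfl⟩ := toCok_surjective X i x
    exact congrArg (toCok X i) (succMap_self X x))
  map_comp {i j k} h h' := ModuleCat.hom_ext (LinearMap.ext fun x => by
    obtain ⟨x, rfl⟩ := toCok_surjective X i x
    exact congrArg (toCok X k) (succMap_succMap X (leOfHom h) (leOfHom h') x).symm)

variable (ω m) in
/-- The functor sending `X` to the sequence of the cokernels of `X⁰ ⟶ X^{i+1}`. -/
def cokSeq : ModuleFactorization ω m ⥤ (Fin m ⥤ ModuleCat.{u} (Abar ω)) where
  obj X := cokSeqObj X
  map {X Y} f :=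
    { app := fun i => ModuleCat.ofHom (cokComponent f i)
      naturality := fun i j h => ModuleCat.hom_ext (LinearMap.ext fun x => by
        obtain ⟨x, rfl⟩ := toCok_surjective X i x
        exact congrArg (toCok Y j) (component_succMap f (leOfHom h) x)) }
  map_id X := NatTrans.ext (funext fun i => ModuleCat.hom_ext (LinearMap.ext fun x => by
    obtain ⟨x, rfl⟩ := toCok_surjective X i x
    rfl))
  map_comp {X Y Z} f g := NatTrans.ext (funext fun i =>
    ModuleCat.hom_ext (LinearMap.ext fun x => by
      obtain ⟨x, rfl⟩ := toCok_surjective X i x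
      rfl))

variable (ω m) in
/-- The ring `Λ_{n-1} = Λ_m` of upper triangular `m × m` matrices over `Ā`. -/
abbrev Lambda : Type u := upperTriangular (Abar ω) m

variable (ω m) in
/-- The zeroth cokernel functor `Cok⁰ : F_n(A; ω) ⥤ Λ_{n-1}-Mod`,
`X ↦ (Cok(d^{0,n-2}), …, Cok(d^{0,1}), Cok(d^{0,0}))ᵀ`, with `n = m + 1`. -/
def cok0 : ModuleFactorization ω m ⥤ ModuleCat.{u} (Lambda ω m) :=
  cokSeq ω m ⋙ columnFunctor (Abar ω) m

/-! #### The category `G⁰F_n(A; ω)` and its factor category -/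

variable (ω m) in
/-- All components are Gorenstein projective, and the last one `X^{n-1}` is projective. -/
def isG0F : ObjectProperty (ModuleFactorization ω m) := fun X =>
  (∀ i, IsGorensteinProjective (X.seq.obj i)) ∧ Module.Projective A (X.seq.obj (Fin.last m))

variable (ω m) in
/-- The category `G⁰F_n(A; ω)`, `n = m + 1`. -/
abbrev G0F : Type (u + 1) := (isG0F ω m).FullSubcategory

/-- The ideal `I` of `F_n(A; ω)`: the morphisms that factor through `θ⁰(P)` for a projective
`A`-module `P`. -/
def InIdeal {X Y : ModuleFactorization ω m} (f : X ⟶ Y) : Prop :=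
  ∃ P : ModuleCat.{u} A, Module.Projective A P ∧
    ∃ (g : X ⟶ (theta0 ω m).obj P) (h : (theta0 ω m).obj P ⟶ Y), g ≫ h = f

theorem inIdeal_zero (X Y : ModuleFactorization ω m) : InIdeal (0 : X ⟶ Y) :=
  ⟨ModuleCat.of A PUnit, inferInstance, 0, 0, by simp⟩

theorem InIdeal.neg {X Y : ModuleFactorization ω m} {f : X ⟶ Y} (hf : InIdeal f) :
    InIdeal (-f) := by
  obtain ⟨P, hP, g, h, rfl⟩ := hf
  exact ⟨P, hP, g, -h, by simp⟩

theorem InIdeal.add {X Y : ModuleFactorization ω m} {f f' : X ⟶ Y} (hf : InIdeal f)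
    (hf' : InIdeal f') : InIdeal (f + f') := by
  obtain ⟨P, hP, g, h, rfl⟩ := hf
  obtain ⟨P', hP', g', h', rfl⟩ := hf'
  let i : P ⟶ ModuleCat.of A (P × P') := ModuleCat.ofHom (LinearMap.inl A P P')
  let i' : P' ⟶ ModuleCat.of A (P × P') := ModuleCat.ofHom (LinearMap.inr A P P')
  let p : ModuleCat.of A (P × P') ⟶ P := ModuleCat.ofHom (LinearMap.fst A P P')
  let p' : ModuleCat.of A (P × P') ⟶ P' := ModuleCat.ofHom (LinearMap.snd A P P')
  have h1 : (theta0 ω m).map i ≫ (theta0 ω m).map p = 𝟙 _ := by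
    rw [← Functor.map_comp]; rfl
  have h2 : (theta0 ω m).map i' ≫ (theta0 ω m).map p' = 𝟙 _ := by
    rw [← Functor.map_comp]; rfl
  have h3 : (theta0 ω m).map i ≫ (theta0 ω m).map p' = 0 := by
    rw [← Functor.map_comp]; rfl
  have h4 : (theta0 ω m).map i' ≫ (theta0 ω m).map p = 0 := by
    rw [← Functor.map_comp]; rfl
  refine ⟨ModuleCat.of A (P × P'), inferInstanceAs (Module.Projective A (P × P')),
    g ≫ (theta0 ω m).map i + g' ≫ (theta0 ω m).map i',
    (theta0 ω m).map p ≫ h + (theta0 ω m).map p' ≫ h', ?_⟩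
  simp only [Preadditive.add_comp, Preadditive.comp_add, Category.assoc, reassoc_of% h1,
    reassoc_of% h2, reassoc_of% h3, reassoc_of% h4]
  simp

theorem InIdeal.comp_left {X Y Z : ModuleFactorization ω m} (e : X ⟶ Y) {f : Y ⟶ Z}
    (hf : InIdeal f) : InIdeal (e ≫ f) := by
  obtain ⟨P, hP, g, h, rfl⟩ := hf
  exact ⟨P, hP, e ≫ g, h, by simp⟩

theorem InIdeal.comp_right {X Y Z : ModuleFactorization ω m} {f : X ⟶ Y} (hf : InIdeal f)
    (e : Y ⟶ Z) : InIdeal (f ≫ e) := by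
  obtain ⟨P, hP, g, h, rfl⟩ := hf
  exact ⟨P, hP, g, h ≫ e, by simp⟩

variable (ω m) in
/-- Two parallel morphisms of `G⁰F_n(A; ω)` are identified if their difference is in `I`. -/
def idealRel : HomRel (G0F ω m) := fun _ _ f g => InIdeal (f.hom - g.hom)

instance : Congruence (idealRel ω m) where
  equivalence :=
    { refl := fun f => by simpa [idealRel] using inIdeal_zero _ _
      symm := fun {f g} h => by simpa [idealRel] using InIdeal.neg h
      trans := fun {f g k} h h' => by simpa [idealRel] using InIdeal.add h h' }
  comp_left f g g' h := by
    simpa [idealRel, Preadditive.comp_sub] using InIdeal.comp_left f.hom h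
  comp_right g h := by
    simpa [idealRel, Preadditive.sub_comp] using InIdeal.comp_right h g.hom

variable (ω m) in
/-- The factor category `G⁰F_n(A; ω) / I`, `n = m + 1`. -/
abbrev FactorCategory : Type (u + 1) := CategoryTheory.Quotient (idealRel ω m)

/-- The additive structure of the factor category, inherited from `F_n(A; ω)`. -/
instance : Preadditive (FactorCategory ω m) :=
  Quotient.preadditive (idealRel ω m) fun X Y f₁ f₂ g₁ g₂ hf hg => by
    have h := InIdeal.add hf hg
    have e : f₁.hom - f₂.hom + (g₁.hom - g₂.hom) = (f₁ + g₁).hom - (f₂ + g₂).hom := by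
      change _ = f₁.hom + g₁.hom - (f₂.hom + g₂.hom)
      abel
    rwa [e] at h

theorem cok0_map_sub {X Y : ModuleFactorization ω m} (f g : X ⟶ Y) :
    (cok0 ω m).map (f - g) = (cok0 ω m).map f - (cok0 ω m).map g :=
  ModuleCat.hom_ext (LinearMap.ext fun (x : (a : Fin m) → Cok X a.rev) => by
    funext a
    change cokComponent (f - g) a.rev (x a) =
      cokComponent f a.rev (x a) - cokComponent g a.rev (x a)
    obtain ⟨y, hy⟩ := toCok_surjective X a.rev (x a)
    rw [← hy]
    rfl)

/-- `Cok⁰` annihilates the ideal `I`. -/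
theorem cok0_map_eq_zero {X Y : ModuleFactorization ω m} {f : X ⟶ Y} (hf : InIdeal f) :
    (cok0 ω m).map f = 0 := by
  obtain ⟨P, hP, g, h, rfl⟩ := hf
  have key : ∀ z : (cok0 ω m).obj ((theta0 ω m).obj P), z = 0 := fun z => by
    funext a
    obtain ⟨y, hy⟩ := toCok_surjective ((theta0 ω m).obj P) a.rev (z a)
    exact hy.symm.trans (toCok_eq_zero ((theta0 ω m).obj P) a.rev y)
  rw [Functor.map_comp]
  ext x
  change ((cok0 ω m).map h).hom (((cok0 ω m).map g).hom x) = 0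
  rw [key (((cok0 ω m).map g).hom x), map_zero]

variable (ω m) in
/-- The functor `G⁰F_n(A; ω) / I ⥤ Λ_{n-1}-GProj` induced by `Cok⁰`, given that `Cok⁰` sends the
objects of `G⁰F_n(A; ω)` to Gorenstein projective modules. -/
def cok0Induced
    (hG : ∀ X : G0F ω m, IsGorensteinProjective ((cok0 ω m).obj X.obj)) :
    FactorCategory ω m ⥤ GProj (Lambda ω m) :=
  CategoryTheory.Quotient.lift (idealRel ω m)
    (IsGorensteinProjective.lift ((isG0F ω m).ι ⋙ cok0 ω m) hG)
    fun X Y f g h => by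
      apply ObjectProperty.hom_ext
      change (cok0 ω m).map f.hom = (cok0 ω m).map g.hom
      rw [← sub_eq_zero, ← cok0_map_sub]
      exact cok0_map_eq_zero h

end ModuleFactorization

end Factorizations

end ModFact

end

/-! Multiplication by `ω` is injective on projective `A`-modules, hence on Gorenstein projective
ones, which embed in projectives. Since the `n`-fold composites are multiplication by `ω`, all maps
`X^i → X^{n-1}` of an object of `G⁰F_n` are injective. Such an object is a chain `ωP ⊆ X⁰ ⊆ X¹ ⊆ ⋯ ⊆
X^{n-1} = P` of Gorenstein projective submodules of a projective module, and its cokernels form the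
chain `X¹/X⁰ ⊆ ⋯ ⊆ P/X⁰` of `Ā`-modules.

Conversely, a chain of `Ā`-modules is recovered by covering its last term by a projective `A`-module
`P` and taking preimages. A morphism of cokernel chains lifts because `P` is projective
(`exists_cokSeq_map_eq`). A morphism that vanishes on cokernels sends `X^{n-1}` into `Y⁰`, hence
factors through `θ⁰(X^{n-1})` (`inIdeal_of_factor`).

It remains to match the Gorenstein conditions. Modules over the triangular ring are sequences of
`Ā`-modules, and a nonempty sequence is Gorenstein projective exactly when its maps are injective
and the quotients of its last term by zero and by the earlier terms are Gorenstein projective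
(`Chain.isGP_iff`); here these quotients are the `P/X^i` with `i < n - 1`. Moreover, if a projective
`A`-module `P` maps onto an `Ā`-module `N` with kernel `K`, then `N` is Gorenstein projective over
`Ā` if and only if `K` is so over `A` (`IsGPMod.ker_cover`, `HasGPCover.isGPMod`). The bridge is
division by `ω`: if `L` is projective, a map `f : K → ωL` extends uniquely to `g : P → L` by `ω g(x)
= f(ω x)`, and `g` induces a map `N → L/ωL`.

Gorenstein projectivity is used in coinductive form (`IsGP`): the largest class whose members are
both left and right ends of special sequences with other end in the class. Each closure property
then needs one syzygy step, and total acyclicity is handled once, by splicing. -/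

namespace ModFact

/-! ### Gorenstein projective objects, coinductively -/

section Coinductive

universe v w v' w'

variable {C : Type w} [Category.{v} C] [Abelian C]

/-- A short exact sequence `0 ⟶ X ⟶ P ⟶ Y ⟶ 0` with `P` projective along which all morphisms from
`X` to projective objects extend. -/
structure Special {X P Y : C} (i : X ⟶ P) (p : P ⟶ Y) : Prop where
  w : i ≫ p = 0
  shortExact : (ShortComplex.mk i p w).ShortExact
  projective : Projective P
  extend : ∀ Q : C, Projective Q → ∀ f : X ⟶ Q, ∃ g : P ⟶ Q, i ≫ g = f

/-- `X` is the left end of a special sequence whose right end satisfies `S`. -/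
def EmbedsIn (S : C → Prop) (X : C) : Prop :=
  ∃ (P Y : C) (i : X ⟶ P) (p : P ⟶ Y), Special i p ∧ S Y

/-- `X` is the right end of a special sequence whose left end satisfies `S`. -/
def CoveredBy (S : C → Prop) (X : C) : Prop :=
  ∃ (P Y : C) (i : Y ⟶ P) (p : P ⟶ X), Special i p ∧ S Y

/-- The largest class of objects closed under special embeddings and special covers. -/
def IsGP (X : C) : Prop :=
  ∃ S : C → Prop, S X ∧ ∀ Y, S Y → EmbedsIn S Y ∧ CoveredBy S Y

theorem EmbedsIn.mono {S T : C → Prop} (h : ∀ X, S X → T X) {X : C} :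
    EmbedsIn S X → EmbedsIn T X :=
  fun ⟨P, Y, i, p, hs, hY⟩ => ⟨P, Y, i, p, hs, h _ hY⟩

theorem CoveredBy.mono {S T : C → Prop} (h : ∀ X, S X → T X) {X : C} :
    CoveredBy S X → CoveredBy T X :=
  fun ⟨P, Y, i, p, hs, hY⟩ => ⟨P, Y, i, p, hs, h _ hY⟩

theorem IsGP.embedsIn {X : C} (h : IsGP X) : EmbedsIn IsGP X := by
  obtain ⟨S, hX, hS⟩ := h
  exact (hS X hX).1.mono fun Y hY => ⟨S, hY, hS⟩

theorem IsGP.coveredBy {X : C} (h : IsGP X) : CoveredBy IsGP X := by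
  obtain ⟨S, hX, hS⟩ := h
  exact (hS X hX).2.mono fun Y hY => ⟨S, hY, hS⟩

/-- Coinduction up to objects already known to be Gorenstein projective. -/
theorem isGP_of_coinduct (S : C → Prop)
    (hS : ∀ Y, S Y → EmbedsIn (fun Z => S Z ∨ IsGP Z) Y ∧ CoveredBy (fun Z => S Z ∨ IsGP Z) Y)
    {X : C} (hX : S X) : IsGP X := by
  refine ⟨fun Z => S Z ∨ IsGP Z, Or.inl hX, ?_⟩
  rintro Y (hY | hY)
  · exact hS Y hY
  · exact ⟨hY.embedsIn.mono fun _ => Or.inr, hY.coveredBy.mono fun _ => Or.inr⟩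

theorem Special.iso_left {X X' P Y : C} {i : X ⟶ P} {p : P ⟶ Y} (h : Special i p) (e : X' ≅ X) :
    Special (e.hom ≫ i) p where
  w := by rw [Category.assoc, h.w, Limits.comp_zero]
  shortExact := ShortComplex.shortExact_of_iso
    (S₁ := ShortComplex.mk i p h.w)
    (ShortComplex.isoMk e.symm (Iso.refl _) (Iso.refl _) (by simp) (by simp)) h.shortExact
  projective := h.projective
  extend Q hQ f := by
    obtain ⟨g, hg⟩ := h.extend Q hQ (e.inv ≫ f)
    exact ⟨g, by rw [Category.assoc, hg, Iso.hom_inv_id_assoc]⟩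

theorem Special.iso_right {X P Y Y' : C} {i : X ⟶ P} {p : P ⟶ Y} (h : Special i p) (e : Y ≅ Y') :
    Special i (p ≫ e.hom) where
  w := by rw [reassoc_of% h.w, Limits.zero_comp]
  shortExact := ShortComplex.shortExact_of_iso
    (S₁ := ShortComplex.mk i p h.w)
    (ShortComplex.isoMk (Iso.refl _) (Iso.refl _) e (by simp) (by simp)) h.shortExact
  projective := h.projective
  extend := h.extend

theorem IsGP.of_iso {X Y : C} (e : X ≅ Y) (h : IsGP X) : IsGP Y := by
  refine isGP_of_coinduct (fun Z => ∃ X, IsGP X ∧ Nonempty (X ≅ Z)) ?_ ⟨X, h, ⟨e⟩⟩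
  rintro Y ⟨X, h, ⟨e⟩⟩
  obtain ⟨P, Z, i, p, hs, hZ⟩ := h.embedsIn
  obtain ⟨P', Z', i', p', hs', hZ'⟩ := h.coveredBy
  exact ⟨⟨P, Z, _, p, hs.iso_left e.symm, Or.inr hZ⟩, ⟨P', Z', i', _, hs'.iso_right e, Or.inr hZ'⟩⟩

theorem special_id_zero {P Z : C} (hP : Projective P) (hZ : Limits.IsZero Z) :
    Special (𝟙 P) (0 : P ⟶ Z) where
  w := by simp
  shortExact :=
    { exact := (ShortComplex.exact_iff_epi _ rfl).2 (instEpiId P)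
      mono_f := instMonoId P
      epi_g := ⟨fun _ _ _ => hZ.eq_of_src _ _⟩ }
  projective := hP
  extend Q _ f := ⟨f, by simp⟩

theorem special_zero_id {P Z : C} (hP : Projective P) (hZ : Limits.IsZero Z) :
    Special (0 : Z ⟶ P) (𝟙 P) where
  w := by simp
  shortExact :=
    { exact := (ShortComplex.exact_iff_mono _ rfl).2 (instMonoId P)
      mono_f := ⟨fun _ _ _ => hZ.eq_of_tgt _ _⟩
      epi_g := instEpiId P }
  projective := hP
  extend Q _ f := ⟨0, hZ.eq_of_src _ _⟩

open Limits ZeroObject in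
theorem isGP_of_projective {P : C} (hP : Projective P) : IsGP P := by
  refine ⟨Projective, hP, fun Q hQ => ?_⟩
  exact ⟨⟨Q, 0, 𝟙 Q, 0, special_id_zero hQ (Limits.isZero_zero C), inferInstance⟩,
    ⟨Q, 0, 0, 𝟙 Q, special_zero_id hQ (Limits.isZero_zero C), inferInstance⟩⟩

variable {D : Type w'} [Category.{v'} D] [Abelian D]

/-- Extension problems transpose across the equivalence, since both functors preserve projectives.
This moves Gorenstein projectivity between sequences and modules over the triangular ring. -/
theorem Special.map (F : C ≌ D) {X P Y : C} {i : X ⟶ P} {p : P ⟶ Y} (h : Special i p) :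
    Special (F.functor.map i) (F.functor.map p) where
  w := by rw [← F.functor.map_comp, h.w, F.functor.map_zero]
  shortExact := h.shortExact.map_of_exact F.functor
  projective := (F.map_projective_iff P).2 h.projective
  extend Q hQ f := by
    have hQ' : Projective (F.inverse.obj Q) := (F.symm.map_projective_iff Q).2 hQ
    obtain ⟨g, hg⟩ := h.extend _ hQ' (F.unitIso.hom.app X ≫ F.inverse.map f)
    refine ⟨F.functor.map g ≫ F.counitIso.hom.app Q, ?_⟩
    rw [← F.functor.map_comp_assoc, hg]
    simp

theorem IsGP.map (F : C ≌ D) {X : C} (h : IsGP X) : IsGP (F.functor.obj X) := by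
  refine isGP_of_coinduct (fun Z => ∃ X, IsGP X ∧ F.functor.obj X = Z) ?_ ⟨X, h, rfl⟩
  rintro _ ⟨X, h, rfl⟩
  obtain ⟨P, Z, i, p, hs, hZ⟩ := h.embedsIn
  obtain ⟨P', Z', i', p', hs', hZ'⟩ := h.coveredBy
  exact ⟨⟨_, _, _, _, hs.map F, Or.inl ⟨Z, hZ, rfl⟩⟩, ⟨_, _, _, _, hs'.map F, Or.inl ⟨Z', hZ', rfl⟩⟩⟩

theorem isGP_map_iff (F : C ≌ D) {X : C} : IsGP (F.functor.obj X) ↔ IsGP X :=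
  ⟨fun h => (h.map F.symm).of_iso (F.unitIso.app X).symm, fun h => h.map F⟩

end Coinductive

/-! ### Comparison with totally acyclic complexes -/

section Modules

variable {R : Type u} [Ring R]

/-- Special sequences of modules, in terms of linear maps. -/
structure LSpecial {X P Y : Type u} [AddCommGroup X] [Module R X] [AddCommGroup P] [Module R P]
    [AddCommGroup Y] [Module R Y] (i : X →ₗ[R] P) (p : P →ₗ[R] Y) : Prop where
  inj : Function.Injective i
  exact : Function.Exact i p
  surj : Function.Surjective p
  projective : Module.Projective R P
  extend : ∀ (Q : Type u) [AddCommGroup Q] [Module R Q], Module.Projective R Q →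
    ∀ f : X →ₗ[R] Q, ∃ g : P →ₗ[R] Q, ∀ x, g (i x) = f x

theorem LSpecial.special {X P Y : ModuleCat.{u} R} {i : X →ₗ[R] P} {p : P →ₗ[R] Y}
    (h : LSpecial i p) : Special (ModuleCat.ofHom i) (ModuleCat.ofHom p) where
  w := by ext x; exact h.exact.apply_apply_eq_zero x
  shortExact :=
    { exact := (ShortComplex.ShortExact.moduleCat_exact_iff_function_exact _).2 h.exact
      mono_f := (ModuleCat.mono_iff_injective _).2 h.inj
      epi_g := (ModuleCat.epi_iff_surjective _).2 h.surj }
  projective := (IsProjective.iff_projective P).1 h.projective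
  extend Q hQ f := by
    obtain ⟨g, hg⟩ := h.extend Q ((IsProjective.iff_projective Q).2 hQ) f.hom
    exact ⟨ModuleCat.ofHom g, by ext x; exact hg x⟩

theorem Special.lspecial {X P Y : ModuleCat.{u} R} {i : X ⟶ P} {p : P ⟶ Y}
    (h : Special i p) : LSpecial i.hom p.hom where
  inj := (ModuleCat.mono_iff_injective _).1 h.shortExact.mono_f
  exact := (ShortComplex.ShortExact.moduleCat_exact_iff_function_exact _).1 h.shortExact.exact
  surj := (ModuleCat.epi_iff_surjective _).1 h.shortExact.epi_g
  projective := (IsProjective.iff_projective P).2 h.projective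
  extend Q _ _ hQ f := by
    obtain ⟨g, hg⟩ := h.extend (ModuleCat.of R Q) ((IsProjective.iff_projective Q).1 hQ)
      (ModuleCat.ofHom f)
    exact ⟨g.hom, fun x => congrArg (fun k => k.hom x) hg⟩

/-- The kernel of the `n`-th differential of a complex of modules. -/
abbrev cycles (P : CochainComplex (ModuleCat.{u} R) ℤ) (n : ℤ) : ModuleCat.{u} R :=
  ModuleCat.of R (LinearMap.ker (P.d n (n + 1)).hom)

/-- The corestriction of the differential to the next cycles. -/
noncomputable def toCyclesSucc (P : CochainComplex (ModuleCat.{u} R) ℤ) (n : ℤ) :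
    P.X n →ₗ[R] cycles P (n + 1) :=
  (P.d n (n + 1)).hom.codRestrict _ fun x => by
    have := P.d_comp_d n (n + 1) (n + 1 + 1)
    exact congrArg (fun k => k.hom x) this

theorem IsTotallyAcyclic.exact' {P : CochainComplex (ModuleCat.{u} R) ℤ}
    (hP : IsTotallyAcyclic P) {i j k : ℤ} (hj : i + 1 = j) (hk : j + 1 = k) :
    Function.Exact (P.d i j).hom (P.d j k).hom := by
  obtain rfl : i = j - 1 := by omega
  subst hk
  exact hP.exact j

theorem IsTotallyAcyclic.hom_exact' {P : CochainComplex (ModuleCat.{u} R) ℤ}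
    (hP : IsTotallyAcyclic P) {i j k : ℤ} (hj : i + 1 = j) (hk : j + 1 = k) (Q : ModuleCat.{u} R)
    (hQ : Module.Projective R Q) (f : P.X j ⟶ Q) (hf : P.d i j ≫ f = 0) :
    ∃ g : P.X k ⟶ Q, P.d j k ≫ g = f := by
  obtain rfl : i = j - 1 := by omega
  subst hk
  exact hP.hom_exact Q hQ j f hf

theorem IsTotallyAcyclic.toCyclesSucc_surjective {P : CochainComplex (ModuleCat.{u} R) ℤ}
    (hP : IsTotallyAcyclic P) (n : ℤ) : Function.Surjective (toCyclesSucc P n) := by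
  rintro ⟨x, hx⟩
  obtain ⟨y, rfl⟩ := (hP.exact' (i := n) rfl rfl x).1 hx
  exact ⟨y, rfl⟩

/-- For the extension property, pull `f : Zⁿ → Q` back along `Pⁿ⁻¹ → Zⁿ`. The pullback kills the
image of `Pⁿ⁻²`, so exactness of `Hom(P, Q)` writes it as `g ∘ d` with `g` defined on `Pⁿ`.
Cancelling the surjection onto `Zⁿ` shows that `g` extends `f`. -/
theorem IsTotallyAcyclic.lspecial {P : CochainComplex (ModuleCat.{u} R) ℤ}
    (hP : IsTotallyAcyclic P) (n : ℤ) :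
    LSpecial (LinearMap.ker (P.d n (n + 1)).hom).subtype (toCyclesSucc P n) where
  inj := Subtype.val_injective
  exact x := by
    constructor
    · intro h
      exact ⟨⟨x, congrArg Subtype.val h⟩, rfl⟩
    · rintro ⟨y, rfl⟩
      exact Subtype.ext y.2
  surj := hP.toCyclesSucc_surjective n
  projective := hP.projective n
  extend Q _ _ hQ f := by
    obtain ⟨k, rfl⟩ : ∃ k : ℤ, n = k + 1 := ⟨n - 1, by omega⟩
    obtain ⟨l, rfl⟩ : ∃ l : ℤ, k = l + 1 := ⟨k - 1, by omega⟩
    obtain ⟨g, hg⟩ := hP.hom_exact' (i := l) (j := l + 1) (k := l + 1 + 1) rfl rfl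
      (ModuleCat.of R Q) hQ (ModuleCat.ofHom (f ∘ₗ toCyclesSucc P (l + 1))) (by
        ext x
        have : toCyclesSucc P (l + 1) ((P.d l (l + 1)).hom x) = 0 := Subtype.ext (by
          have := P.d_comp_d l (l + 1) (l + 1 + 1)
          exact congrArg (fun k => k.hom x) this)
        change f (toCyclesSucc P (l + 1) ((P.d l (l + 1)).hom x)) = 0
        rw [this, map_zero])
    refine ⟨g.hom, fun x => ?_⟩
    obtain ⟨y, rfl⟩ := hP.toCyclesSucc_surjective (l + 1) x
    exact congrArg (fun k => k.hom y) hg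

theorem IsGorensteinProjective.isGP {G : ModuleCat.{u} R} (h : IsGorensteinProjective G) :
    IsGP G := by
  obtain ⟨P, hP, ⟨e⟩⟩ := h
  -- The cycles of a totally acyclic complex, in all degrees, form a class closed under both
  -- operations.
  refine IsGP.of_iso e ⟨fun Y => ∃ n, cycles P n = Y, ⟨0, rfl⟩, ?_⟩
  rintro _ ⟨n, rfl⟩
  refine ⟨⟨_, cycles P (n + 1), _, _, (hP.lspecial n).special (X := cycles P n), ⟨_, rfl⟩⟩, ?_⟩
  obtain ⟨k, rfl⟩ : ∃ k : ℤ, n = k + 1 := ⟨n - 1, by omega⟩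
  exact ⟨_, cycles P k, _, _, (hP.lspecial k).special (X := cycles P k), ⟨_, rfl⟩⟩

/-! ### Splicing special sequences into a totally acyclic complex -/

section Splice

variable {G P : ℤ → ModuleCat.{u} R} (i : ∀ n, G n ⟶ P n) (p : ∀ n, P n ⟶ G (n + 1))
  (h : ∀ n, Special (i n) (p n))

include h in
theorem splice_comp (n : ℤ) : (p n ≫ i (n + 1)) ≫ (p (n + 1) ≫ i (n + 1 + 1)) = 0 := by
  rw [Category.assoc, reassoc_of% (h (n + 1)).w]
  simp

-- The differential `Pₙ → Gₙ₊₁ → Pₙ₊₁` is an epimorphism followed by a monomorphism, so its kernel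
-- is `Gₙ`. A map on `Pₙ₊₁` that kills the differential kills `Gₙ₊₁`, hence descends to `Gₙ₊₂`, and
-- then extends to `Pₙ₊₂` because the next sequence is special.
include h in
theorem splice_isGorensteinProjective : IsGorensteinProjective (G 0) := by
  set K := CochainComplex.of P (fun n => p n ≫ i (n + 1)) (splice_comp i p h) with hK
  have hd : ∀ n, K.d n (n + 1) = p n ≫ i (n + 1) := fun n =>
    CochainComplex.of_d P (fun n => p n ≫ i (n + 1)) n
  have hex : ∀ n, Function.Exact (K.d n (n + 1)).hom (K.d (n + 1) (n + 1 + 1)).hom := fun n x => by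
    rw [hd, hd]
    have h1 := (h n).lspecial
    have h2 := (h (n + 1)).lspecial
    have h3 := (h (n + 1 + 1)).lspecial
    constructor
    · intro hx
      have hx' : (p (n + 1)).hom x = 0 := h3.inj (hx.trans (map_zero _).symm)
      obtain ⟨y, rfl⟩ := (h2.exact x).1 hx'
      obtain ⟨z, rfl⟩ := h1.surj y
      exact ⟨z, rfl⟩
    · rintro ⟨y, rfl⟩
      exact (congrArg (i (n + 1 + 1)).hom (h2.exact.apply_apply_eq_zero _)).trans (map_zero _)
  have hhom : ∀ (Q : ModuleCat.{u} R), Module.Projective R Q → ∀ (n : ℤ) (f : K.X (n + 1) ⟶ Q),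
      K.d n (n + 1) ≫ f = 0 → ∃ g : K.X (n + 1 + 1) ⟶ Q, K.d (n + 1) (n + 1 + 1) ≫ g = f := by
    intro Q hQ n f hf
    rw [hd] at hf
    have : Epi (p n) := (h n).shortExact.epi_g
    have hf' : i (n + 1) ≫ f = 0 := by
      rw [← cancel_epi (p n), ← Category.assoc, hf, Limits.comp_zero]
    have hs := h (n + 1)
    obtain ⟨f', hf'⟩ : ∃ f' : G (n + 1 + 1) ⟶ Q, p (n + 1) ≫ f' = f := by
      have := hs.shortExact.epi_g
      exact ⟨hs.shortExact.exact.desc f hf', hs.shortExact.exact.g_desc f hf'⟩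
    obtain ⟨g, hg⟩ := (h (n + 1 + 1)).extend Q ((IsProjective.iff_projective Q).1 hQ) f'
    refine ⟨g, ?_⟩
    rw [hd]
    exact (Category.assoc _ _ _).trans ((congrArg (p (n + 1) ≫ ·) hg).trans hf')
  refine ⟨K, ⟨fun n => (h n).lspecial.projective, fun n => ?_, fun Q hQ n f hf => ?_⟩, ⟨?_⟩⟩
  · obtain ⟨k, rfl⟩ : ∃ k : ℤ, n = k + 1 := ⟨n - 1, by omega⟩
    rw [add_sub_cancel_right]
    exact hex k
  · obtain ⟨k, rfl⟩ : ∃ k : ℤ, n = k + 1 := ⟨n - 1, by omega⟩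
    rw [add_sub_cancel_right] at hf
    exact hhom Q hQ k f hf
  · refine LinearEquiv.toModuleIso (LinearEquiv.ofBijective
      ((i 0).hom.codRestrict (LinearMap.ker (K.d 0 1).hom) fun x => ?_) ⟨?_, ?_⟩).symm
    · have := hd 0
      rw [LinearMap.mem_ker]
      erw [this]
      exact (congrArg (i (0 + 1)).hom ((h 0).lspecial.exact.apply_apply_eq_zero x)).trans (map_zero _)
    · intro x y hxy
      exact (h 0).lspecial.inj (congrArg Subtype.val hxy)
    · rintro ⟨x, hx⟩
      have hx' : (p 0).hom x = 0 := by
        have := hd 0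
        rw [LinearMap.mem_ker] at hx
        erw [this] at hx
        exact (h (0 + 1)).lspecial.inj (hx.trans (map_zero _).symm)
      obtain ⟨y, rfl⟩ := ((h 0).lspecial.exact x).1 hx'
      exact ⟨y, rfl⟩

end Splice

/-- The objects of a two-sided splicing of special sequences. -/
noncomputable def spliceObj (G : ModuleCat.{u} R) (hG : IsGP G) :
    ℤ → {G : ModuleCat.{u} R // IsGP G}
  | Int.ofNat n => Nat.rec ⟨G, hG⟩
      (fun _ X => ⟨X.2.embedsIn.choose_spec.choose,
        X.2.embedsIn.choose_spec.choose_spec.choose_spec.choose_spec.2⟩) n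
  | Int.negSucc n => Nat.rec (motive := fun _ => {G : ModuleCat.{u} R // IsGP G})
      ⟨hG.coveredBy.choose_spec.choose,
        hG.coveredBy.choose_spec.choose_spec.choose_spec.choose_spec.2⟩
      (fun _ X => ⟨X.2.coveredBy.choose_spec.choose,
        X.2.coveredBy.choose_spec.choose_spec.choose_spec.choose_spec.2⟩) n

/-- For negative indices the object at `n` was chosen as the left end of a special cover of the
object at `n + 1`, so the same sequence read from its left end serves here. -/
theorem exists_special_spliceObj (G : ModuleCat.{u} R) (hG : IsGP G) (n : ℤ) :
    ∃ (P : ModuleCat.{u} R) (i : (spliceObj G hG n).1 ⟶ P) (p : P ⟶ (spliceObj G hG (n + 1)).1),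
      Special i p := by
  match n with
  | Int.ofNat n =>
    exact ⟨_, _, _, (spliceObj G hG (Int.ofNat n)).2.embedsIn
      |>.choose_spec.choose_spec.choose_spec.choose_spec.1⟩
  | Int.negSucc 0 =>
    exact ⟨_, _, _, hG.coveredBy.choose_spec.choose_spec.choose_spec.choose_spec.1⟩
  | Int.negSucc (n + 1) =>
    exact ⟨_, _, _, (spliceObj G hG (Int.negSucc n)).2.coveredBy
      |>.choose_spec.choose_spec.choose_spec.choose_spec.1⟩

theorem IsGP.isGorensteinProjective {G : ModuleCat.{u} R} (hG : IsGP G) :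
    IsGorensteinProjective G := by
  choose P i p h using exists_special_spliceObj G hG
  exact splice_isGorensteinProjective (G := fun n => (spliceObj G hG n).1) i p h

end Modules

end ModFact

namespace ModFact

/-! ### Gorenstein projective modules and projective resolutions -/

/-! ### Factoring linear and semilinear maps -/

section Factor

variable {R S : Type*} [Ring R] [Ring S] {τ : R →+* S}

/-- A map landing in the image of an injective map factors through it. -/
theorem exists_lift_of_mem_range {M X P : Type*} [AddCommGroup M] [Module R M] [AddCommGroup X]
    [Module S X] [AddCommGroup P] [Module S P] {i : X →ₗ[S] P} (hi : Function.Injective i)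
    (f : M →ₛₗ[τ] P) (hf : ∀ m, ∃ x, i x = f m) : ∃ g : M →ₛₗ[τ] X, ∀ m, i (g m) = f m := by
  choose g hg using hf
  exact ⟨{ toFun := g
           map_add' := fun x y => hi (by simp [hg])
           map_smul' := fun r x => hi (by simp [hg, map_smulₛₗ]) }, hg⟩

/-- A map into the middle of a left exact sequence that dies on the right lifts to the left. -/
theorem exists_lift_of_exact {M X P Y : Type*} [AddCommGroup M] [Module R M] [AddCommGroup X]
    [Module R X] [AddCommGroup P] [Module R P] [AddCommGroup Y] [Module R Y]
    {i : X →ₗ[R] P} {p : P →ₗ[R] Y} (hi : Function.Injective i) (he : Function.Exact i p)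
    (f : M →ₗ[R] P) (hf : ∀ m, p (f m) = 0) : ∃ g : M →ₗ[R] X, ∀ m, i (g m) = f m :=
  exists_lift_of_mem_range hi f fun m => (he (f m)).1 (hf m)

/-- Factorization of a semilinear map through a surjective one. -/
theorem exists_desc_of_surjective {M N N' : Type*} [AddCommGroup M] [Module R M] [AddCommGroup N]
    [Module S N] [AddCommGroup N'] [Module S N'] (hτ : Function.Surjective τ) {p : M →ₛₗ[τ] N}
    (hp : Function.Surjective p) (f : M →ₛₗ[τ] N') (hf : ∀ m, p m = 0 → f m = 0) :
    ∃ g : N →ₗ[S] N', ∀ m, g (p m) = f m := by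
  have key : ∀ x y, p x = p y → f x = f y := fun x y h => by
    rw [← sub_eq_zero, ← map_sub]
    exact hf _ (by rw [map_sub, h, sub_self])
  choose s hs using hp
  refine ⟨{ toFun := fun n => f (s n)
            map_add' := fun x y => by
              rw [← map_add]
              exact key _ _ (by simp [hs])
            map_smul' := fun r x => ?_ }, fun m => key _ _ (hs _)⟩
  obtain ⟨r, rfl⟩ := hτ r
  rw [RingHom.id_apply, ← map_smulₛₗ]
  exact key _ _ (by simp [hs])

end Factor

/-! ### Closure properties of Gorenstein projective modules -/

section ModuleGP

variable {R : Type u} [Ring R]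

variable (R) in
/-- Gorenstein projectivity of a module. -/
abbrev IsGPMod (M : Type u) [AddCommGroup M] [Module R M] : Prop := IsGP (ModuleCat.of R M)

theorem IsGPMod.of_equiv {M N : Type u} [AddCommGroup M] [Module R M] [AddCommGroup N] [Module R N]
    (e : M ≃ₗ[R] N) (h : IsGPMod R M) : IsGPMod R N :=
  IsGP.of_iso e.toModuleIso h

theorem IsGPMod.exists_embedding {M : Type u} [AddCommGroup M] [Module R M] (h : IsGPMod R M) :
    ∃ (P Y : ModuleCat.{u} R) (i : M →ₗ[R] P) (p : P →ₗ[R] Y), LSpecial i p ∧ IsGPMod R Y := by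
  obtain ⟨P, Y, i, p, hs, hY⟩ := h.embedsIn
  exact ⟨P, Y, i.hom, p.hom, hs.lspecial, hY⟩

theorem IsGPMod.exists_cover {M : Type u} [AddCommGroup M] [Module R M] (h : IsGPMod R M) :
    ∃ (P Y : ModuleCat.{u} R) (i : Y →ₗ[R] P) (p : P →ₗ[R] M), LSpecial i p ∧ IsGPMod R Y := by
  obtain ⟨P, Y, i, p, hs, hY⟩ := h.coveredBy
  exact ⟨P, Y, i.hom, p.hom, hs.lspecial, hY⟩

theorem isGPMod_of_projective {M : Type u} [AddCommGroup M] [Module R M]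
    (h : Module.Projective R M) : IsGPMod R M :=
  isGP_of_projective ((IsProjective.iff_projective M).1 h)

theorem isGPMod_of_coinduct (S : ModuleCat.{u} R → Prop)
    (hS : ∀ M, S M →
      (∃ (P Y : ModuleCat.{u} R) (i : M →ₗ[R] P) (p : P →ₗ[R] Y),
        LSpecial i p ∧ (S Y ∨ IsGPMod R Y)) ∧
      ∃ (P Y : ModuleCat.{u} R) (i : Y →ₗ[R] P) (p : P →ₗ[R] M),
        LSpecial i p ∧ (S Y ∨ IsGPMod R Y))
    {M : Type u} [AddCommGroup M] [Module R M] (hM : S (ModuleCat.of R M)) : IsGPMod R M := by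
  refine isGP_of_coinduct S (fun M hM => ?_) hM
  obtain ⟨⟨P, Y, i, p, h, hY⟩, ⟨P', Y', i', p', h', hY'⟩⟩ := hS M hM
  exact ⟨⟨P, Y, _, _, h.special, hY⟩, ⟨P', Y', _, _, h'.special, hY'⟩⟩

theorem LSpecial.prod_right {X P Y Q : Type u} [AddCommGroup X] [Module R X] [AddCommGroup P]
    [Module R P] [AddCommGroup Y] [Module R Y] [AddCommGroup Q] [Module R Q]
    {i : X →ₗ[R] P} {p : P →ₗ[R] Y} (h : LSpecial i p) (hQ : Module.Projective R Q) :
    LSpecial (i.prodMap (LinearMap.id : Q →ₗ[R] Q)) (p ∘ₗ LinearMap.fst R P Q) where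
  inj := h.inj.prodMap Function.injective_id
  exact := by
    rintro ⟨x, q⟩
    constructor
    · intro hx
      obtain ⟨y, rfl⟩ := (h.exact x).1 hx
      exact ⟨(y, q), rfl⟩
    · rintro ⟨⟨y, q'⟩, hy⟩
      rw [← hy]
      exact h.exact.apply_apply_eq_zero y
  surj := h.surj.comp Prod.fst_surjective
  projective := by
    have := h.projective
    infer_instance
  extend Q' _ _ hQ' f := by
    obtain ⟨g, hg⟩ := h.extend Q' hQ' (f ∘ₗ LinearMap.inl R X Q)
    refine ⟨g.coprod (f ∘ₗ LinearMap.inr R X Q), fun x => ?_⟩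
    simp [hg, ← map_add]

theorem LSpecial.prod_left {X P Y Q : Type u} [AddCommGroup X] [Module R X] [AddCommGroup P]
    [Module R P] [AddCommGroup Y] [Module R Y] [AddCommGroup Q] [Module R Q]
    {i : X →ₗ[R] P} {p : P →ₗ[R] Y} (h : LSpecial i p) (hQ : Module.Projective R Q) :
    LSpecial (LinearMap.inl R P Q ∘ₗ i) (p.prodMap (LinearMap.id : Q →ₗ[R] Q)) where
  inj := LinearMap.inl_injective.comp h.inj
  exact := by
    rintro ⟨x, q⟩
    constructor
    · intro hx
      obtain ⟨h1, rfl⟩ := Prod.mk.inj hx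
      obtain ⟨y, rfl⟩ := (h.exact x).1 h1
      exact ⟨y, rfl⟩
    · rintro ⟨y, hy⟩
      rw [← hy]
      exact Prod.ext (h.exact.apply_apply_eq_zero y) rfl
  surj := h.surj.prodMap Function.surjective_id
  projective := by
    have := h.projective
    infer_instance
  extend Q' _ _ hQ' f := by
    obtain ⟨g, hg⟩ := h.extend Q' hQ' f
    exact ⟨g ∘ₗ LinearMap.fst R P Q, fun x => by simp [hg]⟩

theorem IsGPMod.prod {M Q : Type u} [AddCommGroup M] [Module R M] [AddCommGroup Q] [Module R Q]
    (h : IsGPMod R M) (hQ : Module.Projective R Q) : IsGPMod R (M × Q) := by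
  refine isGPMod_of_coinduct (fun N => ∃ X : ModuleCat.{u} R, IsGPMod R X ∧
    N = ModuleCat.of R (X × Q)) ?_ ⟨ModuleCat.of R M, h, rfl⟩
  rintro _ ⟨X, hX, rfl⟩
  obtain ⟨P, Y, i, p, hs, hY⟩ := hX.exists_embedding
  obtain ⟨P', Y', i', p', hs', hY'⟩ := hX.exists_cover
  exact ⟨⟨ModuleCat.of R (P × Q), Y, _, _, hs.prod_right hQ, Or.inr hY⟩,
    ⟨ModuleCat.of R (P' × Q), Y', _, _, hs'.prod_left hQ, Or.inr hY'⟩⟩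

/-- A projective summand of the left end moves to the right end: the projection onto `Q` extends to
`r : P → Q` by speciality, and `r` records the part of `P` that is no longer divided out. -/
theorem LSpecial.of_prod_left {X Q P Y : Type u} [AddCommGroup X] [Module R X] [AddCommGroup P]
    [Module R P] [AddCommGroup Y] [Module R Y] [AddCommGroup Q] [Module R Q]
    {i : X × Q →ₗ[R] P} {p : P →ₗ[R] Y} (h : LSpecial i p) (hQ : Module.Projective R Q) :
    ∃ r : P →ₗ[R] Q, LSpecial (i ∘ₗ LinearMap.inl R X Q) (p.prod r) := by
  obtain ⟨r, hr⟩ := h.extend Q hQ (LinearMap.snd R X Q)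
  refine ⟨r, h.inj.comp LinearMap.inl_injective, fun x => ?_, ?_, h.projective, ?_⟩
  · constructor
    · intro hx
      obtain ⟨h1, h2⟩ := Prod.mk.inj hx
      obtain ⟨⟨y, q⟩, rfl⟩ := (h.exact x).1 h1
      obtain rfl : q = 0 := (hr (y, q)).symm.trans h2
      exact ⟨y, rfl⟩
    · rintro ⟨y, rfl⟩
      exact Prod.ext (h.exact.apply_apply_eq_zero (y, 0)) (hr (y, 0))
  · rintro ⟨y, q⟩
    obtain ⟨x, rfl⟩ := h.surj y
    refine ⟨x + i (0, q - r x), Prod.ext ?_ ?_⟩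
    · simp [h.exact.apply_apply_eq_zero]
    · simp [hr]
  · intro Q' _ _ hQ' f
    obtain ⟨g, hg⟩ := h.extend Q' hQ' (f ∘ₗ LinearMap.fst R X Q)
    exact ⟨g, fun x => hg (x, 0)⟩

/-- Dually, `Q` lifts to `P` by projectivity and joins the kernel when only `X` is covered. -/
theorem LSpecial.of_prod_right {X Q P Y : Type u} [AddCommGroup X] [Module R X] [AddCommGroup P]
    [Module R P] [AddCommGroup Y] [Module R Y] [AddCommGroup Q] [Module R Q]
    {i : Y →ₗ[R] P} {p : P →ₗ[R] X × Q} (h : LSpecial i p) (hQ : Module.Projective R Q) :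
    ∃ s : Q →ₗ[R] P, LSpecial (i.coprod s) (LinearMap.fst R X Q ∘ₗ p) := by
  obtain ⟨s, hs⟩ := Module.projective_lifting_property p (LinearMap.inr R X Q) h.surj
  replace hs : ∀ q, p (s q) = (0, q) := fun q => LinearMap.congr_fun hs q
  have hpi := h.exact.apply_apply_eq_zero
  refine ⟨s, ?_, fun x => ?_, Prod.fst_surjective.comp h.surj, h.projective, ?_⟩
  · rw [injective_iff_map_eq_zero]
    rintro ⟨y, q⟩ hy
    have h1 : p (i y + s q) = 0 := by
      rw [show i y + s q = 0 from hy, map_zero]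
    rw [map_add, hpi, hs, zero_add] at h1
    obtain rfl : q = 0 := congrArg Prod.snd h1
    have h2 : i y = 0 := by simpa using hy
    rw [h.inj (h2.trans (map_zero i).symm)]
    rfl
  · constructor
    · intro hx
      have h1 : p (x - s (p x).2) = 0 := by
        rw [map_sub, hs]
        exact Prod.ext (by simpa using hx) (by simp)
      obtain ⟨y, hy⟩ := (h.exact _).1 h1
      exact ⟨(y, (p x).2), by simp [hy]⟩
    · rintro ⟨⟨y, q⟩, rfl⟩
      simp [hpi, hs]
  · intro Q' _ _ hQ' f
    obtain ⟨g, hg⟩ := h.extend Q' hQ' (f ∘ₗ LinearMap.inl R Y Q)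
    -- The coordinate `Q` of `p` vanishes on `Y` and is the identity on the lifted copy of `Q`, so
    -- this correction changes `g` on that copy only, replacing its values there by those of `f`.
    refine ⟨g + (f ∘ₗ LinearMap.inr R Y Q - g ∘ₗ s) ∘ₗ LinearMap.snd R X Q ∘ₗ p, ?_⟩
    rintro ⟨y, q⟩
    have : f (y, q) = f (y, 0) + f (0, q) := by rw [← map_add]; simp
    simp [hpi, hs, hg, this]

/-- Coinduction on the class of modules that become Gorenstein projective after adding `Q`. The
neighbouring syzygies of `M` are those of `M × Q` enlarged by `Q`. -/
theorem IsGPMod.of_prod {M Q : Type u} [AddCommGroup M] [Module R M] [AddCommGroup Q] [Module R Q]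
    (h : IsGPMod R (M × Q)) (hQ : Module.Projective R Q) : IsGPMod R M := by
  refine isGPMod_of_coinduct (fun N => IsGPMod R (N × Q)) ?_ h
  intro X hX
  obtain ⟨P, Y, i, p, hs, hY⟩ := hX.exists_embedding
  obtain ⟨P', Y', i', p', hs', hY'⟩ := hX.exists_cover
  obtain ⟨r, hr⟩ := hs.of_prod_left hQ
  obtain ⟨s, hs⟩ := hs'.of_prod_right hQ
  exact ⟨⟨P, ModuleCat.of R (Y × Q), _, _, hr, Or.inr (hY.prod hQ)⟩,
    ⟨P', ModuleCat.of R (Y' × Q), _, _, hs, Or.inr (hY'.prod hQ)⟩⟩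

/-- The kernel of a surjection from a Gorenstein projective onto a projective module is Gorenstein
projective. -/
theorem IsGPMod.of_exact_projective {X H Q : Type u} [AddCommGroup X] [Module R X]
    [AddCommGroup H] [Module R H] [AddCommGroup Q] [Module R Q] {i : X →ₗ[R] H} {p : H →ₗ[R] Q}
    (h : IsGPMod R H) (hQ : Module.Projective R Q) (hi : Function.Injective i)
    (he : Function.Exact i p) (hp : Function.Surjective p) : IsGPMod R X := by
  obtain ⟨s, hs⟩ := Module.projective_lifting_property p LinearMap.id hp
  replace hs : ∀ q, p (s q) = q := fun q => LinearMap.congr_fun hs q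
  have hpi := he.apply_apply_eq_zero
  -- The section `s` splits the sequence, so `H ≅ X × Q`.
  refine IsGPMod.of_prod (Q := Q) (h.of_equiv
    (LinearEquiv.ofBijective (i.coprod s) ⟨?_, fun x => ?_⟩).symm) hQ
  · rw [injective_iff_map_eq_zero]
    rintro ⟨x, q⟩ hx
    have h1 : p (i x + s q) = 0 := by rw [show i x + s q = 0 from hx, map_zero]
    rw [map_add, hpi, hs, zero_add] at h1
    subst h1
    have h2 : i x = 0 := by simpa using hx
    rw [hi (h2.trans (map_zero i).symm)]
    rfl
  · obtain ⟨y, hy⟩ := (he (x - s (p x))).1 (by simp [hs])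
    exact ⟨(y, p x), by simp [hy]⟩

/-- Any projective presentation of a Gorenstein projective module is special. -/
theorem IsGPMod.lspecial_of_exact {K P X : Type u} [AddCommGroup K] [Module R K] [AddCommGroup P]
    [Module R P] [AddCommGroup X] [Module R X] {k : K →ₗ[R] P} {π : P →ₗ[R] X}
    (h : IsGPMod R X) (hP : Module.Projective R P) (hk : Function.Injective k)
    (he : Function.Exact k π) (hπ : Function.Surjective π) : LSpecial k π ∧ IsGPMod R K := by
  obtain ⟨P', X', i, p, hs, hX'⟩ := h.exists_cover
  have hP' := hs.projective
  obtain ⟨a, ha⟩ := Module.projective_lifting_property p π hs.surj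
  obtain ⟨b, hb⟩ := Module.projective_lifting_property π p hπ
  replace ha : ∀ x, p (a x) = π x := fun x => LinearMap.congr_fun ha x
  replace hb : ∀ x, π (b x) = p x := fun x => LinearMap.congr_fun hb x
  have hπk := he.apply_apply_eq_zero
  have hpi := hs.exact.apply_apply_eq_zero
  constructor
  -- Compare the presentation with a special one through `a` and `b`. With `b'` and `d` the induced
  -- maps between kernels and `c` the homotopy from `b a` to the identity, the identity of `K` is
  -- `b' d + c k`. Hence extending `f b'` to `P'` suffices.
  · refine ⟨hk, he, hπ, hP, fun Q _ _ hQ f => ?_⟩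
    obtain ⟨b', hb'⟩ := exists_lift_of_exact hk he (b ∘ₗ i) fun x => by simp [hb, hpi]
    obtain ⟨c, hc⟩ := exists_lift_of_exact hk he (LinearMap.id - b ∘ₗ a) fun x => by simp [hb, ha]
    obtain ⟨d, hd⟩ := exists_lift_of_exact hs.inj hs.exact (a ∘ₗ k) fun x => by simp [ha, hπk]
    obtain ⟨g, hg⟩ := hs.extend Q hQ (f ∘ₗ b')
    refine ⟨g ∘ₗ a + f ∘ₗ c, fun x => ?_⟩
    have h1 : b' (d x) + c (k x) = x := hk (by
      rw [map_add, hb', hc]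
      simp [hd])
    have h2 : a (k x) = i (d x) := (hd x).symm
    rw [LinearMap.add_apply, LinearMap.comp_apply, LinearMap.comp_apply, h2, hg,
      LinearMap.comp_apply, ← map_add, h1]
  · obtain ⟨d, hd⟩ := exists_lift_of_exact hs.inj hs.exact (a ∘ₗ k) fun x => by simp [ha, hπk]
    -- Schanuel: the sequence `0 → K → X' × P → P' → 0` is exact, with Gorenstein projective middle
    -- term and projective right term.
    refine IsGPMod.of_exact_projective (i := (-d).prod k) (p := i.coprod a)
      (IsGPMod.prod hX' hP) hP' (fun x y hxy => hk (congrArg Prod.snd hxy)) ?_ fun z => ?_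
    · rintro ⟨x, y⟩
      constructor
      · intro hxy
        have hxy' : i x + a y = 0 := hxy
        have h1 : π y = 0 := by
          rw [← ha, eq_neg_of_add_eq_zero_right hxy', map_neg, hpi, neg_zero]
        obtain ⟨z, rfl⟩ := (he y).1 h1
        refine ⟨z, Prod.ext (hs.inj ?_) rfl⟩
        change i (-d z) = i x
        rw [map_neg, hd]
        exact (eq_neg_of_add_eq_zero_left hxy').symm
      · rintro ⟨z, hz⟩
        rw [← hz]
        change i (-d z) + a (k z) = 0
        rw [map_neg, hd]
        exact neg_add_cancel _
    · obtain ⟨y, hy⟩ := hπ (p z)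
      obtain ⟨x, hx⟩ := (hs.exact (z - a y)).1 (by simp [ha, hy])
      exact ⟨(x, y), by simp [hx]⟩

/-- The right end of a special sequence with Gorenstein projective left end is Gorenstein
projective. -/
theorem LSpecial.isGPMod_right {G P X : Type u} [AddCommGroup G] [Module R G] [AddCommGroup P]
    [Module R P] [AddCommGroup X] [Module R X] {j : G →ₗ[R] P} {q : P →ₗ[R] X}
    (h : LSpecial j q) (hG : IsGPMod R G) : IsGPMod R X := by
  obtain ⟨P', G', i, p, hs, hG'⟩ := hG.exists_embedding
  -- Dual of Schanuel: both special sequences start at `G`, so the two embeddings extend along each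
  -- other. This yields an exact sequence `0 → X → G' × P → P' → 0` with maps `c` and `(y, z) ↦ α y
  -- - a z`.
  obtain ⟨a, ha⟩ := h.extend P' hs.projective i
  obtain ⟨b, hb⟩ := hs.extend P h.projective j
  have hpi := hs.exact.apply_apply_eq_zero
  have hqj := h.exact.apply_apply_eq_zero
  obtain ⟨c, hc⟩ := exists_desc_of_surjective (τ := RingHom.id R) Function.surjective_id h.surj
    ((p ∘ₗ a).prod (LinearMap.id - b ∘ₗ a)) fun x hx => by
      obtain ⟨g, rfl⟩ := (h.exact x).1 hx
      simp [ha, hb, hpi]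
  obtain ⟨α, hα⟩ := exists_desc_of_surjective (τ := RingHom.id R) Function.surjective_id hs.surj
    (LinearMap.id - a ∘ₗ b) fun x hx => by
      obtain ⟨g, rfl⟩ := (hs.exact x).1 hx
      simp [ha, hb]
  replace hc : ∀ x, c (q x) = (p (a x), x - b (a x)) := hc
  replace hα : ∀ x, α (p x) = x - a (b x) := hα
  refine IsGPMod.of_exact_projective (i := c) (p := α.coprod (-a))
    (IsGPMod.prod hG' h.projective) hs.projective ?_ ?_ fun w => ?_
  · rw [injective_iff_map_eq_zero]
    intro x hx
    obtain ⟨x, rfl⟩ := h.surj x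
    rw [hc] at hx
    obtain ⟨h1, h2⟩ := Prod.mk.inj hx
    obtain ⟨g, hg⟩ := (hs.exact _).1 h1
    rw [sub_eq_zero.1 h2, ← hg, hb, hqj]
  · rintro ⟨y, z⟩
    constructor
    · intro hyz
      obtain ⟨y, rfl⟩ := hs.surj y
      have h1 : y = a (z + b y) := by
        have : α (p y) + -a z = 0 := hyz
        rw [hα, add_neg_eq_zero, sub_eq_iff_eq_add] at this
        rw [map_add, ← this]
      refine ⟨q (z + b y), ?_⟩
      rw [hc, ← h1]
      simp
    · rintro ⟨x, hx⟩
      obtain ⟨x, rfl⟩ := h.surj x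
      rw [← hx, hc]
      simp [hα]
  · exact ⟨(p w, -b w), by simp [hα]⟩

end ModuleGP

end ModFact

namespace ModFact

/-! ### Semilinear covers -/

section Semilinear

variable {R S : Type u} [Ring R] [Ring S] {τ : R →+* S}

/-- Lifting of a semilinear map from a projective module along a semilinear surjection. -/
theorem exists_lift_semilinear {P Q N : Type u} [AddCommGroup P] [Module R P] [AddCommGroup Q]
    [Module R Q] [AddCommGroup N] [Module S N] (hP : Module.Projective R P) (φ : P →ₛₗ[τ] N)
    {π : Q →ₛₗ[τ] N} (hπ : Function.Surjective π) : ∃ g : P →ₗ[R] Q, ∀ x, π (g x) = φ x := by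
  let := Module.compHom N τ
  let φ' : P →ₗ[R] N := { toFun := φ, map_add' := map_add φ, map_smul' := fun r x => map_smulₛₗ φ r x }
  let π' : Q →ₗ[R] N := { toFun := π, map_add' := map_add π, map_smul' := fun r x => map_smulₛₗ π r x }
  obtain ⟨g, hg⟩ := Module.projective_lifting_property π' φ' hπ
  exact ⟨g, fun x => LinearMap.congr_fun hg x⟩

/-- Lifting of a semilinear map from a projective module along a linear surjection. -/
theorem exists_semilinear_lift {P M N : Type u} [AddCommGroup P] [Module R P] [AddCommGroup M]
    [Module S M] [AddCommGroup N] [Module S N] (hP : Module.Projective R P) (φ : P →ₛₗ[τ] N)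
    {f : M →ₗ[S] N} (hf : Function.Surjective f) : ∃ g : P →ₛₗ[τ] M, ∀ x, f (g x) = φ x := by
  let := Module.compHom N τ
  let := Module.compHom M τ
  let φ' : P →ₗ[R] N := { toFun := φ, map_add' := map_add φ, map_smul' := fun r x => map_smulₛₗ φ r x }
  let f' : M →ₗ[R] N := { toFun := f, map_add' := map_add f, map_smul' := fun r x => map_smul f (τ r) x }
  obtain ⟨g, hg⟩ := Module.projective_lifting_property f' φ' hf
  exact ⟨{ toFun := g, map_add' := map_add g, map_smul' := fun r x => map_smul g r x },
    fun x => LinearMap.congr_fun hg x⟩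

variable (τ) in
theorem exists_semilinear_cover (N : Type u) [AddCommGroup N] [Module S N] :
    ∃ (P : ModuleCat.{u} R) (π : P →ₛₗ[τ] N), Module.Projective R P ∧ Function.Surjective π := by
  let := Module.compHom N τ
  let f : (N →₀ R) →ₗ[R] N := Finsupp.linearCombination R id
  refine ⟨ModuleCat.of R (N →₀ R),
    { toFun := f, map_add' := map_add f, map_smul' := fun r x => map_smul f r x },
    inferInstanceAs (Module.Projective R (N →₀ R)), fun n => ⟨Finsupp.single n 1, ?_⟩⟩
  exact (Finsupp.linearCombination_single R 1 n).trans (one_smul R n)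

variable {N F N' : Type u} [AddCommGroup N] [Module S N] [AddCommGroup F] [Module S F]
  [AddCommGroup N'] [Module S N'] {i : N →ₗ[S] F} {p : F →ₗ[S] N'}
  {P P' : Type u} [AddCommGroup P] [Module R P] [AddCommGroup P'] [Module R P']
  {π : P →ₛₗ[τ] N} {π' : P' →ₛₗ[τ] N'}

/-- Covers of the ends of a short exact sequence combine to a cover of the middle term. -/
theorem exists_horseshoe (hi : Function.Exact i p) (hp : Function.Surjective p)
    (hP' : Module.Projective R P') (hπ : Function.Surjective π) (hπ' : Function.Surjective π') :
    ∃ ρ : P × P' →ₛₗ[τ] F, Function.Surjective ρ ∧ (∀ x, ρ (x, 0) = i (π x)) ∧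
      ∀ z, p (ρ z) = π' z.2 := by
  obtain ⟨t, ht⟩ := exists_semilinear_lift hP' π' hp
  refine ⟨(i.comp π).comp (LinearMap.fst R P P') + t.comp (LinearMap.snd R P P'), fun f => ?_,
    fun x => by simp, fun z => by simp [hi.apply_apply_eq_zero, ht]⟩
  obtain ⟨y, hy⟩ := hπ' (p f)
  obtain ⟨n, hn⟩ := (hi (f - t y)).1 (by simp [ht, hy])
  obtain ⟨x, rfl⟩ := hπ n
  exact ⟨(x, y), by simp [hn]⟩

/-- The sequence of kernels of a horseshoe diagram. -/
theorem horseshoe_ker {ρ : P × P' →ₛₗ[τ] F} (hi : Function.Injective i) (he : Function.Exact i p)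
    (hπ : Function.Surjective π) (h1 : ∀ x, ρ (x, 0) = i (π x)) (h2 : ∀ z, p (ρ z) = π' z.2) :
    ∃ (a : LinearMap.ker π →ₗ[R] LinearMap.ker ρ) (b : LinearMap.ker ρ →ₗ[R] LinearMap.ker π'),
      (∀ x, (a x : P × P') = ((x : P), (0 : P'))) ∧ Function.Injective a ∧ Function.Exact a b ∧
        Function.Surjective b := by
  refine ⟨(LinearMap.inl R P P').restrict fun x hx => ?_,
    (LinearMap.snd R P P').restrict fun x hx => ?_, fun x => rfl, ?_, ?_, ?_⟩
  · rw [LinearMap.mem_ker] at hx ⊢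
    exact (h1 x).trans (by rw [hx, map_zero])
  · rw [LinearMap.mem_ker] at hx ⊢
    exact (h2 x).symm.trans (by rw [hx, map_zero])
  · intro x y hxy
    exact Subtype.ext (congrArg (fun z : LinearMap.ker ρ => (z : P × P').1) hxy)
  · rintro ⟨⟨x, y⟩, hxy⟩
    constructor
    · intro h
      obtain rfl : y = 0 := congrArg Subtype.val h
      have : π x = 0 := hi (by rw [← h1, map_zero]; exact hxy)
      exact ⟨⟨x, this⟩, rfl⟩
    · rintro ⟨z, hz⟩
      rw [← hz]
      rfl
  · rintro ⟨y, hy⟩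
    obtain ⟨n, hn⟩ := (he (ρ (0, -y))).1 (by
      rw [h2]
      exact (map_neg π' y).trans (by rw [LinearMap.mem_ker.1 hy, neg_zero]))
    obtain ⟨x, rfl⟩ := hπ n
    refine ⟨⟨(x, y), ?_⟩, rfl⟩
    -- The sign is chosen so that `(x, y)` is the difference of two elements with the same image
    -- under `ρ`.
    have : ((x, y) : P × P') = (x, 0) - (0, -y) := by simp
    rw [LinearMap.mem_ker, this, map_sub, h1, hn, sub_self]

end Semilinear

/-! ### Multiplication by `ω` -/

section Omega

variable {A : Type u} [Ring A] (ω : A) [RegularNormal ω]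

/-- The projection `A → Ā`. -/
abbrev toAbar : A →+* Abar ω := Ideal.Quotient.mk _

theorem toAbar_surjective : Function.Surjective (toAbar ω) := Ideal.Quotient.mk_surjective

theorem toAbar_self : toAbar ω ω = 0 :=
  Ideal.Quotient.eq_zero_iff_mem.2 (Ideal.mem_span_singleton_self ω)

theorem sigma_self : sigma ω ω = ω := right_cancel ω (sigma_spec ω ω).symm

variable {ω} in
theorem map_omega_smul {P N : Type*} [AddCommGroup P] [Module A P] [AddCommGroup N]
    [Module (Abar ω) N] (π : P →ₛₗ[toAbar ω] N) (x : P) : π (ω • x) = 0 := by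
  rw [map_smulₛₗ, toAbar_self, zero_smul]

/-- Multiplication by `ω`, a `σ`-semilinear map. -/
def omegaSMul (M : Type*) [AddCommGroup M] [Module A M] : M →ₛₗ[(sigma ω : A →+* A)] M where
  toFun x := ω • x
  map_add' := smul_add ω
  map_smul' a x := by
    rw [← mul_smul, sigma_spec, mul_smul]
    rfl

instance : RingHomInvPair (sigma ω : A →+* A) ((sigma ω).symm : A →+* A) :=
  RingHomInvPair.of_ringEquiv (sigma ω)

instance : RingHomInvPair ((sigma ω).symm : A →+* A) (sigma ω : A →+* A) :=
  RingHomInvPair.of_ringEquiv (sigma ω).symm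

/-- The submodule `ω M`. -/
def omegaSub (M : Type*) [AddCommGroup M] [Module A M] : Submodule A M where
  carrier := Set.range fun x => ω • x
  zero_mem' := ⟨0, smul_zero ω⟩
  add_mem' := by
    rintro _ _ ⟨x, rfl⟩ ⟨y, rfl⟩
    exact ⟨x + y, smul_add ω x y⟩
  smul_mem' := by
    rintro a _ ⟨x, rfl⟩
    refine ⟨(sigma ω).symm a • x, ?_⟩
    change ω • (sigma ω).symm a • x = a • ω • x
    rw [← mul_smul, ← mul_smul, sigma_spec, RingEquiv.apply_symm_apply]

variable {M : Type u} [AddCommGroup M] [Module A M]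

/-- A projective module embeds in a free one, where `ω` acts on each coefficient by left
multiplication, so regularity of `ω` applies. -/
theorem omega_smul_injective_of_projective (h : Module.Projective A M) :
    Function.Injective fun x : M => ω • x := by
  obtain ⟨s, hs⟩ := h
  intro x y hxy
  apply hs.injective
  have hxy' : ω • s x = ω • s y := by rw [← map_smul, ← map_smul]; exact congrArg s hxy
  ext m
  exact left_cancel ω (DFunLike.congr_fun hxy' m)

theorem IsGPMod.omega_smul_injective (h : IsGPMod A M) :
    Function.Injective fun x : M => ω • x := by
  obtain ⟨P, Y, i, p, hs, -⟩ := h.exists_embedding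
  intro x y hxy
  apply hs.inj
  apply omega_smul_injective_of_projective ω hs.projective
  change ω • i x = ω • i y
  rw [← map_smul, ← map_smul]
  exact congrArg i hxy

/-- Multiplication by `ω` is a `σ`-semilinear bijection `M → ωM`, and `σ` is an automorphism. -/
theorem projective_omegaSub (h : Module.Projective A M) : Module.Projective A (omegaSub ω M) :=
  Module.Projective.of_equiv (σ := (sigma ω : A →+* A)) (σ' := ((sigma ω).symm : A →+* A))
    (LinearEquiv.ofBijective ((omegaSMul ω M).codRestrict (omegaSub ω M) fun x => ⟨x, rfl⟩)
      ⟨fun _ _ hxy => omega_smul_injective_of_projective ω h (congrArg Subtype.val hxy),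
        fun ⟨_, x, hx⟩ => ⟨x, Subtype.ext hx⟩⟩)

/-- The twisted module `^σ(M)`. -/
def Twist (_ : A) (M : Type u) : Type u := M

instance : AddCommGroup (Twist ω M) := inferInstanceAs (AddCommGroup M)

noncomputable instance : Module A (Twist ω M) := Module.compHom M (sigma ω : A →+* A)

variable (M) in
/-- The identity `M → ^σ(M)`, semilinear with respect to the inverse of `σ`. -/
noncomputable def toTwist : M ≃ₛₗ[((sigma ω).symm : A →+* A)] Twist ω M where
  toFun x := x
  invFun x := x
  left_inv _ := rfl
  right_inv _ := rfl
  map_add' _ _ := rfl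
  map_smul' a x := by
    change a • x = (sigma ω ((sigma ω).symm a)) • x
    rw [RingEquiv.apply_symm_apply]

/-- Every projective module is isomorphic to `ω L` for some projective module `L`. -/
theorem exists_iso_omegaSub (h : Module.Projective A M) :
    ∃ (L : ModuleCat.{u} A) (j : M →ₗ[A] L), Module.Projective A L ∧ Function.Injective j ∧
      (∀ x, ∃ y, ω • y = j x) ∧ ∀ y, ∃ x, j x = ω • y := by
  have hω : ∀ y : M, ω • (toTwist ω M y) = toTwist ω M (ω • y) := fun y => by
    change sigma ω ω • y = ω • y
    rw [sigma_self]
  refine ⟨ModuleCat.of A (Twist ω M),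
    { toFun := fun x => toTwist ω M (ω • x)
      map_add' := fun x y => by simp
      map_smul' := fun a x => by
        change ω • a • x = sigma ω a • ω • x
        rw [← mul_smul, sigma_spec, mul_smul] }, ?_, ?_, ?_, ?_⟩
  · exact Module.Projective.of_equiv (toTwist ω M)
  · exact omega_smul_injective_of_projective ω h
  · exact fun x => ⟨toTwist ω M x, hω x⟩
  · exact fun y => ⟨y, (hω y).symm⟩

/-- Division by `ω`. -/
theorem exists_omega_div {P L : Type u} [AddCommGroup P] [Module A P] [AddCommGroup L] [Module A L]
    (hL : Function.Injective fun x : L => ω • x) (F : P →ₛₗ[(sigma ω : A →+* A)] L)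
    (hF : ∀ x, ∃ y, ω • y = F x) : ∃ g : P →ₗ[A] L, ∀ x, ω • g x = F x := by
  choose g hg using hF
  -- The quotient by `ω` is unique, and the twists by `σ` of `F` and of multiplication by `ω`
  -- cancel, so `g` is linear.
  refine ⟨{ toFun := g, map_add' := fun x y => hL ?_, map_smul' := fun a x => hL ?_ }, hg⟩
  · change ω • g (x + y) = ω • (g x + g y)
    rw [hg, map_add, smul_add, hg, hg]
  · change ω • g (a • x) = ω • a • g x
    rw [hg, map_smulₛₗ, ← mul_smul, sigma_spec, mul_smul, hg]
    rfl

/-- Quotients annihilated by `ω`, as modules over `Ā`. -/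
theorem exists_quotient (W : Submodule A M) (hW : ∀ x : M, ω • x ∈ W) :
    ∃ (B : ModuleCat.{u} (Abar ω)) (β : M →ₛₗ[toAbar ω] B), Function.Surjective β ∧
      ∀ x, β x = 0 ↔ x ∈ W := by
  have ht : Module.IsTorsionBySet A (M ⧸ W) (Ideal.span {ω} : Ideal A) := by
    rintro x ⟨a, ha⟩
    obtain ⟨b, rfl⟩ := Ideal.mem_span_singleton'.1 ha
    obtain ⟨x, rfl⟩ := Submodule.mkQ_surjective _ x
    change (b * ω) • Submodule.mkQ W x = 0
    rw [mul_smul, ← map_smul, Submodule.mkQ_apply, (Submodule.Quotient.mk_eq_zero _).2 (hW x),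
      smul_zero]
  let := ht.module
  exact ⟨ModuleCat.of (Abar ω) (M ⧸ W),
    { toFun := W.mkQ, map_add' := map_add _, map_smul' := fun a x => rfl },
    Submodule.mkQ_surjective W, fun x => Submodule.Quotient.mk_eq_zero W⟩

variable {ω}

/-- `P / ω P` is projective over `Ā` if `P` is projective over `A`. -/
theorem projective_of_ker_eq_omegaSub {P B : Type u} [AddCommGroup P] [Module A P]
    [AddCommGroup B] [Module (Abar ω) B] (hP : Module.Projective A P) {β : P →ₛₗ[toAbar ω] B}
    (hβ : Function.Surjective β) (hker : ∀ x, β x = 0 → ∃ y, ω • y = x) :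
    Module.Projective (Abar ω) B := by
  refine Module.Projective.of_lifting_property fun f g hf => ?_
  -- The lift is made over `A`; it descends to `B` because `ω` acts as zero on its target.
  obtain ⟨l, hl⟩ := exists_semilinear_lift hP (g.comp β) hf
  obtain ⟨k, hk⟩ := exists_desc_of_surjective (toAbar_surjective ω) hβ l fun x hx => by
    obtain ⟨y, rfl⟩ := hker x hx
    exact map_omega_smul l y
  refine ⟨k, LinearMap.ext fun b => ?_⟩
  obtain ⟨x, rfl⟩ := hβ b
  exact (congrArg f (hk x)).trans (hl x)

/-- The kernel of a surjection from a projective `A`-module to a projective `Ā`-module. -/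
theorem projective_ker {P F : Type u} [AddCommGroup P] [Module A P] [AddCommGroup F]
    [Module (Abar ω) F] (hP : Module.Projective A P) (hF : Module.Projective (Abar ω) F)
    {π : P →ₛₗ[toAbar ω] F} (hπ : Function.Surjective π) :
    Module.Projective A (LinearMap.ker π) := by
  obtain ⟨B, β, hβ, hβ0⟩ := exists_quotient ω (omegaSub ω P) fun x => ⟨x, rfl⟩
  obtain ⟨q, hq⟩ := exists_desc_of_surjective (toAbar_surjective ω) hβ π fun x hx => by
    obtain ⟨y, rfl⟩ := (hβ0 x).1 hx
    exact map_omega_smul π y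
  obtain ⟨s, hs⟩ := Module.projective_lifting_property q LinearMap.id fun f => by
    obtain ⟨x, rfl⟩ := hπ f
    exact ⟨β x, hq x⟩
  -- `T` lifts to `P` the idempotent of `P/ωP` that splits off `F`. It preserves `π` and maps the
  -- kernel of `π` into `ωP`.
  obtain ⟨T, hT⟩ := exists_lift_semilinear hP (s.comp π) hβ
  have hπT : ∀ x, π (T x) = π x := fun x => by
    rw [← hq (T x), hT]
    exact LinearMap.congr_fun hs (π x)
  have := projective_omegaSub ω hP
  -- The kernel is a retract of `P × ωP`, through `x ↦ (x, T x)` and `(x, y) ↦ x - T x + y`.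
  let a : LinearMap.ker π →ₗ[A] P × omegaSub ω P :=
    (LinearMap.ker π).subtype.prod ((T ∘ₗ (LinearMap.ker π).subtype).codRestrict _ fun x => by
      rw [← hβ0]
      refine (hT x).trans ?_
      change s (π x) = 0
      rw [LinearMap.mem_ker.1 x.2, map_zero])
  let b : P × omegaSub ω P →ₗ[A] LinearMap.ker π :=
    ((LinearMap.id - T).coprod (omegaSub ω P).subtype).codRestrict _ fun x => by
      obtain ⟨y, hy⟩ := x.2.2
      have hy' : π (x.2 : P) = 0 := by rw [← hy]; exact map_omega_smul π y
      simp [hπT, hy']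
  exact Module.Projective.of_split a b (LinearMap.ext fun x => Subtype.ext (by simp [a, b]))

/-! ### Extension properties over `A` and over `Ā` -/

section Transfer

variable {N F : Type u} [AddCommGroup N] [Module (Abar ω) N] [AddCommGroup F] [Module (Abar ω) F]
  {i : N →ₗ[Abar ω] F} {P P' : Type u} [AddCommGroup P] [Module A P] [AddCommGroup P'] [Module A P']
  {π : P →ₛₗ[toAbar ω] N} {π' : P' →ₛₗ[toAbar ω] F} {t : P →ₗ[A] P'}
  {t' : LinearMap.ker π →ₗ[A] LinearMap.ker π'}

/-- Extension of maps from `N` to projective `Ā`-modules yields extension of maps from the kernel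
of a cover of `N` to projective `A`-modules. -/
theorem extend_ker (hP' : Module.Projective A P') (hπ : Function.Surjective π)
    (ht : ∀ x, π' (t x) = i (π x)) (ht' : ∀ x, (t' x : P') = t x)
    (hext : ∀ (Q : Type u) [AddCommGroup Q] [Module A Q], Module.Projective A Q →
      ∀ f : P →ₗ[A] Q, ∃ g : P' →ₗ[A] Q, ∀ x, g (t x) = f x)
    (hi : ∀ (Q : Type u) [AddCommGroup Q] [Module (Abar ω) Q], Module.Projective (Abar ω) Q →
      ∀ f : N →ₗ[Abar ω] Q, ∃ g : F →ₗ[Abar ω] Q, ∀ x, g (i x) = f x)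
    (Q : Type u) [AddCommGroup Q] [Module A Q] (hQ : Module.Projective A Q)
    (f : LinearMap.ker π →ₗ[A] Q) : ∃ g : LinearMap.ker π' →ₗ[A] Q, ∀ x, g (t' x) = f x := by
  -- Writing `Q` as `ωL` makes the projective `Ā`-module `B = L/ωL` available as a target for maps
  -- from `N`.
  obtain ⟨L, j, hL, hj, hj1, hj2⟩ := exists_iso_omegaSub ω hQ
  have hLω := omega_smul_injective_of_projective ω hL
  obtain ⟨B, β, hβ, hβ0⟩ := exists_quotient ω (omegaSub ω L) fun x => ⟨x, rfl⟩
  have hβj : ∀ l, β l = 0 ↔ ∃ q, j q = l := fun l => by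
    rw [hβ0]
    constructor
    · rintro ⟨y, rfl⟩
      exact hj2 y
    · rintro ⟨q, rfl⟩
      exact hj1 q
  have hB : Module.Projective (Abar ω) B :=
    projective_of_ker_eq_omegaSub hL hβ fun x hx => (hβ0 x).1 hx
  -- `g` extends `j f` from the kernel of `π` to all of `P`, by `ω g(x) = j f(ω x)`.
  obtain ⟨g, hg⟩ := exists_omega_div ω hLω
    ((j ∘ₗ f).comp ((omegaSMul ω P).codRestrict (LinearMap.ker π) fun x => map_omega_smul π x))
    fun x => hj1 _
  have hgf : ∀ x : LinearMap.ker π, g x = j (f x) := fun x => hLω (by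
    refine (hg x).trans ?_
    change j (f (ω • x)) = ω • j (f x)
    rw [map_smul, map_smul])
  -- The induced map `N → L/ωL` extends to `F` by `hi`, and this extension lifts to `G : P' → L`.
  obtain ⟨gbar, hgbar⟩ := exists_desc_of_surjective (toAbar_surjective ω) hπ (β.comp g)
    fun x hx => (hβj _).2 ⟨_, (hgf ⟨x, hx⟩).symm⟩
  obtain ⟨e, he⟩ := hi B hB gbar
  obtain ⟨G, hG⟩ := exists_lift_semilinear hP' (e.comp π') hβ
  -- `G` restricts to `g` only modulo `ωL`; the error `d` has values in `Q`, so `hext` extends it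
  -- and corrects `G`.
  obtain ⟨d, hd⟩ := exists_lift_of_mem_range hj (g - G ∘ₗ t) fun x => (hβj _).1 (by
    have h1 : β (G (t x)) = β (g x) := by
      rw [hG, LinearMap.comp_apply, ht, he, hgbar]
      rfl
    simp [h1])
  obtain ⟨D, hD⟩ := hext Q hQ d
  have hGt : ∀ x, (G + j ∘ₗ D) (t x) = g x := fun x => by simp [hD, hd]
  obtain ⟨h, hh⟩ := exists_lift_of_mem_range hj ((G + j ∘ₗ D) ∘ₗ (LinearMap.ker π').subtype)
    fun x => (hβj _).1 (by
      have h1 : β (j (D x)) = 0 := (hβj _).2 ⟨_, rfl⟩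
      have h2 : β (G x) = 0 := by
        rw [hG, LinearMap.comp_apply, LinearMap.mem_ker.1 x.2, map_zero]
      simp [h1, h2])
  refine ⟨h, fun x => hj ?_⟩
  rw [hh, ← hgf, ← hGt, ← ht']
  rfl

/-- Extension of maps from the kernel of a cover of `N` to projective `A`-modules yields extension
of maps from `N` to projective `Ā`-modules. -/
theorem extend_of_extend_ker (hP : Module.Projective A P) (hπ : Function.Surjective π)
    (hπ' : Function.Surjective π') (ht : ∀ x, π' (t x) = i (π x)) (ht' : ∀ x, (t' x : P') = t x)
    (hext : ∀ (Q : Type u) [AddCommGroup Q] [Module A Q], Module.Projective A Q →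
      ∀ f : LinearMap.ker π →ₗ[A] Q, ∃ g : LinearMap.ker π' →ₗ[A] Q, ∀ x, g (t' x) = f x)
    (Q : Type u) [AddCommGroup Q] [Module (Abar ω) Q] (hQ : Module.Projective (Abar ω) Q)
    (f : N →ₗ[Abar ω] Q) : ∃ g : F →ₗ[Abar ω] Q, ∀ x, g (i x) = f x := by
  obtain ⟨L, l, hL, hl⟩ := exists_semilinear_cover (toAbar ω) Q
  -- Below, `Q` becomes a retract of `L/ωL`, and the composite of `f` with the section `s` is lifted
  -- to `φ : P → L`, which sends the kernel of `π` into `ωL`. That restriction extends to the kernel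
  -- of `π'` by `hext`, then to `ψ : P' → L` after division by `ω`, and finally descends to `F`.
  have hLω := omega_smul_injective_of_projective ω hL
  obtain ⟨B, β, hβ, hβ0⟩ := exists_quotient ω (omegaSub ω L) fun x => ⟨x, rfl⟩
  obtain ⟨r, hr⟩ := exists_desc_of_surjective (toAbar_surjective ω) hβ l fun x hx => by
    obtain ⟨y, rfl⟩ := (hβ0 x).1 hx
    exact map_omega_smul l y
  obtain ⟨s, hs⟩ := Module.projective_lifting_property r LinearMap.id fun q => by
    obtain ⟨x, rfl⟩ := hl q
    exact ⟨β x, hr x⟩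
  obtain ⟨φ, hφ⟩ := exists_lift_semilinear hP ((s ∘ₗ f).comp π) hβ
  obtain ⟨h, hh⟩ := hext (omegaSub ω L) (projective_omegaSub ω hL)
    ((φ ∘ₗ (LinearMap.ker π).subtype).codRestrict _ fun x => by
      rw [← hβ0]
      refine (hφ x).trans ?_
      change s (f (π x)) = 0
      rw [LinearMap.mem_ker.1 x.2, map_zero, map_zero])
  obtain ⟨ψ, hψ⟩ := exists_omega_div ω hLω
    (((omegaSub ω L).subtype ∘ₗ h).comp
      ((omegaSMul ω P').codRestrict (LinearMap.ker π') fun x => map_omega_smul π' x))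
    fun x => (h _).2
  have hψh : ∀ x : LinearMap.ker π', ψ x = h x := fun x => hLω (by
    refine (hψ x).trans ?_
    change (h (ω • x) : L) = ω • (h x : L)
    rw [map_smul]
    rfl)
  have hψt : ∀ x, ψ (t x) = φ x := fun x => hLω (by
    refine (hψ _).trans ?_
    have h1 : (omegaSMul ω P').codRestrict (LinearMap.ker π') (fun x => map_omega_smul π' x) (t x) =
        t' ⟨ω • x, map_omega_smul π x⟩ := Subtype.ext (by
      rw [ht', map_smul]
      rfl)
    rw [LinearMap.comp_apply, h1, LinearMap.comp_apply, hh]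
    exact map_smul φ ω x)
  obtain ⟨g, hg⟩ := exists_desc_of_surjective (toAbar_surjective ω) hπ' (β.comp ψ)
    fun x hx => (hβ0 _).2 (by
      rw [hψh ⟨x, hx⟩]
      exact (h _).2)
  refine ⟨r ∘ₗ g, fun x => ?_⟩
  obtain ⟨x, rfl⟩ := hπ x
  rw [LinearMap.comp_apply, ← ht, hg, LinearMap.comp_apply, hψt, hφ]
  exact LinearMap.congr_fun hs _

end Transfer

/-- The kernel of a cover of a Gorenstein projective `Ā`-module is Gorenstein projective. -/
theorem IsGPMod.ker_cover {N P : Type u} [AddCommGroup N] [Module (Abar ω) N] [AddCommGroup P]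
    [Module A P] (hN : IsGPMod (Abar ω) N) (hP : Module.Projective A P) {π : P →ₛₗ[toAbar ω] N}
    (hπ : Function.Surjective π) : IsGPMod A (LinearMap.ker π) := by
  refine isGPMod_of_coinduct (fun K => ∃ (N : ModuleCat.{u} (Abar ω)) (P : ModuleCat.{u} A)
    (π : P →ₛₗ[toAbar ω] N), IsGPMod (Abar ω) N ∧ Module.Projective A P ∧ Function.Surjective π ∧
      K = ModuleCat.of A (LinearMap.ker π)) ?_
    ⟨ModuleCat.of _ N, ModuleCat.of A P, π, hN, hP, hπ, rfl⟩
  -- The horseshoe turns a special sequence over `Ā` into one of kernels over `A`, with projective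
  -- middle term by `projective_ker`. The inclusion of the factor `P` splits, so `extend_ker` needs
  -- only the extension property over `Ā`.
  have key : ∀ (N F N' : ModuleCat.{u} (Abar ω)) (P P' : ModuleCat.{u} A) (i : N →ₗ[Abar ω] F)
      (p : F →ₗ[Abar ω] N') (π : P →ₛₗ[toAbar ω] N) (π' : P' →ₛₗ[toAbar ω] N'), LSpecial i p →
      Module.Projective A P → Module.Projective A P' → Function.Surjective π →
      Function.Surjective π' → ∃ (K : ModuleCat.{u} A) (a : LinearMap.ker π →ₗ[A] K)
        (b : K →ₗ[A] LinearMap.ker π'), LSpecial a b := by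
    intro N F N' P P' i p π π' hs hP hP' hπ hπ'
    obtain ⟨ρ, hρ, h1, h2⟩ := exists_horseshoe hs.exact hs.surj hP' hπ hπ'
    obtain ⟨a, b, ha, hai, hab, hb⟩ := horseshoe_ker hs.inj hs.exact hπ h1 h2
    have hPP : Module.Projective A (P × P') := inferInstance
    refine ⟨ModuleCat.of A (LinearMap.ker ρ), a, b, hai, hab, hb,
      projective_ker hPP hs.projective hρ, ?_⟩
    exact extend_ker (t := LinearMap.inl A P P') hPP hπ h1 ha
      (fun Q _ _ _ f => ⟨f ∘ₗ LinearMap.fst A P P', fun x => rfl⟩) hs.extend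
  rintro _ ⟨N, P, π, hN, hP, hπ, rfl⟩
  obtain ⟨F, N', i, p, hs, hN'⟩ := hN.exists_embedding
  obtain ⟨F', N'', i', p', hs', hN''⟩ := hN.exists_cover
  obtain ⟨P', π', hP', hπ'⟩ := exists_semilinear_cover (toAbar ω) N'
  obtain ⟨P'', π'', hP'', hπ''⟩ := exists_semilinear_cover (toAbar ω) N''
  obtain ⟨K, a, b, hab⟩ := key N F N' P P' i p π π' hs hP hP' hπ hπ'
  obtain ⟨K', a', b', hab'⟩ := key N'' F' N P'' P i' p' π'' π hs' hP'' hP hπ'' hπ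
  exact ⟨⟨K, ModuleCat.of A (LinearMap.ker π'), a, b, hab, Or.inl ⟨N', P', π', hN', hP', hπ', rfl⟩⟩,
    ⟨K', ModuleCat.of A (LinearMap.ker π''), a', b', hab',
      Or.inl ⟨N'', P'', π'', hN'', hP'', hπ'', rfl⟩⟩⟩

variable (ω) in
/-- An `Ā`-module with a cover by a projective `A`-module whose kernel is Gorenstein projective. -/
def HasGPCover (N : Type u) [AddCommGroup N] [Module (Abar ω) N] : Prop :=
  ∃ (P : ModuleCat.{u} A) (π : P →ₛₗ[toAbar ω] N), Module.Projective A P ∧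
    Function.Surjective π ∧ IsGPMod A (LinearMap.ker π)

/-- Embed the kernel `K` of the cover in a projective `P₁`, written as `ωL`. Division by `ω` extends
the embedding to `g : P → L`, which induces an embedding of `N` in `L/ωL`. Its cokernel is covered
by `L` with kernel `gP + jP₁`, the pushout of `P` and `P₁` over `K`. -/
theorem HasGPCover.exists_embedding {N : Type u} [AddCommGroup N] [Module (Abar ω) N]
    (h : HasGPCover ω N) : ∃ (F N' : ModuleCat.{u} (Abar ω)) (i : N →ₗ[Abar ω] F)
      (p : F →ₗ[Abar ω] N'), LSpecial i p ∧ HasGPCover ω N' := by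
  obtain ⟨P, π, hP, hπ, hK⟩ := h
  obtain ⟨P₁, K₁, i, p, hs, hK₁⟩ := hK.exists_embedding
  obtain ⟨L, j, hL, hj, hj1, hj2⟩ := exists_iso_omegaSub ω hs.projective
  have hLω := omega_smul_injective_of_projective ω hL
  have hPω := omega_smul_injective_of_projective ω hP
  have hK₁ω := hK₁.omega_smul_injective ω
  obtain ⟨B, β, hβ, hβ0⟩ := exists_quotient ω (omegaSub ω L) fun x => ⟨x, rfl⟩
  have hβj : ∀ l, β l = 0 ↔ ∃ q, j q = l := fun l => by
    rw [hβ0]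
    constructor
    · rintro ⟨y, rfl⟩
      exact hj2 y
    · rintro ⟨q, rfl⟩
      exact hj1 q
  have hB : Module.Projective (Abar ω) B :=
    projective_of_ker_eq_omegaSub hL hβ fun x hx => (hβ0 x).1 hx
  obtain ⟨g, hg⟩ := exists_omega_div ω hLω
    ((j ∘ₗ i).comp ((omegaSMul ω P).codRestrict (LinearMap.ker π) fun x => map_omega_smul π x))
    fun x => hj1 _
  replace hg : ∀ x, ω • g x = j (i ⟨ω • x, map_omega_smul π x⟩) := hg
  have hgi : ∀ x : LinearMap.ker π, g x = j (i x) := fun x => hLω (by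
    refine (hg x).trans ?_
    change j (i (ω • x)) = ω • j (i x)
    rw [map_smul, map_smul])
  -- If `g x = j y`, then `ω y = i(ω x)` vanishes in `K₁`. Since `ω` is injective there, `y = i k`,
  -- and then `ω x = ω k` forces `x = k`.
  have hker : ∀ x, β (g x) = 0 → π x = 0 := fun x hx => by
    obtain ⟨y, hy⟩ := (hβj _).1 hx
    have h1 : i ⟨ω • x, map_omega_smul π x⟩ = ω • y := hj (by rw [← hg, ← hy, map_smul])
    have h2 : p y = 0 := hK₁ω (by
      change ω • p y = ω • (0 : K₁)
      rw [smul_zero, ← map_smul, ← h1, hs.exact.apply_apply_eq_zero])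
    obtain ⟨k, rfl⟩ := (hs.exact y).1 h2
    rw [← map_smul] at h1
    have h3 : ω • x = ω • (k : P) := congrArg Subtype.val (hs.inj h1)
    rw [hPω h3]
    exact k.2
  obtain ⟨C, γ, hγ, hγ0⟩ := exists_quotient ω (LinearMap.range (g.coprod j)) fun x => by
    obtain ⟨y, hy⟩ := hj2 x
    exact ⟨(0, y), by simp [hy]⟩
  obtain ⟨ν, hν⟩ := exists_desc_of_surjective (toAbar_surjective ω) hπ (β.comp g)
    fun x hx => (hβj _).2 ⟨_, (hgi ⟨x, hx⟩).symm⟩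
  obtain ⟨δ, hδ⟩ := exists_desc_of_surjective (toAbar_surjective ω) hβ γ fun x hx => (hγ0 x).2 (by
    obtain ⟨y, rfl⟩ := (hβj x).1 hx
    exact ⟨(0, y), by simp⟩)
  replace hν : ∀ x, ν (π x) = β (g x) := hν
  let t' : LinearMap.ker π →ₗ[A] LinearMap.ker β := g.restrict fun x hx => by
    rw [LinearMap.mem_ker, hβj]
    exact ⟨_, (hgi ⟨x, hx⟩).symm⟩
  refine ⟨B, C, ν, δ, ⟨?_, ?_, ?_, hB, ?_⟩, L, γ, hL, hγ, ?_⟩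
  · rw [injective_iff_map_eq_zero]
    intro x hx
    obtain ⟨x, rfl⟩ := hπ x
    exact hker x ((hν x).symm.trans hx)
  · intro l
    obtain ⟨l, rfl⟩ := hβ l
    rw [hδ, hγ0]
    constructor
    · rintro ⟨⟨x, y⟩, rfl⟩
      refine ⟨π x, ?_⟩
      have : β (j y) = 0 := (hβj _).2 ⟨y, rfl⟩
      simp [hν, this]
    · rintro ⟨x, hx⟩
      obtain ⟨x, rfl⟩ := hπ x
      rw [hν, ← sub_eq_zero, ← map_sub, hβj] at hx
      obtain ⟨y, hy⟩ := hx
      exact ⟨(x, -y), by simp [hy]⟩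
  · intro c
    obtain ⟨l, rfl⟩ := hγ c
    exact ⟨β l, hδ l⟩
  -- Through `ι`, the kernel of `β` is identified with `P₁` and `t'` with `i`, so speciality of `i`
  -- gives the extension over `A`.
  · obtain ⟨ι, hι⟩ := exists_lift_of_mem_range hj (LinearMap.ker β).subtype
      fun x => (hβj x).1 x.2
    refine extend_of_extend_ker (t := g) (t' := t') hP hπ hβ (fun x => (hν x).symm)
      (fun x => rfl) fun Q _ _ hQ f => ?_
    obtain ⟨h, hh⟩ := hs.extend Q hQ f
    refine ⟨h ∘ₗ ι, fun x => ?_⟩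
    rw [LinearMap.comp_apply, ← hh]
    exact congrArg h (hj ((hι _).trans (hgi x)))
  -- The pushout sequence `K → P × P₁ → gP + jP₁` is special because its second coordinate is `-i`.
  · refine LSpecial.isGPMod_right (j := (LinearMap.ker π).subtype.prod (-i))
      (q := (g.coprod j).codRestrict (LinearMap.ker γ) fun x => (hγ0 _).2 ⟨x, rfl⟩)
      ⟨?_, ?_, ?_, ?_, ?_⟩ hK
    · intro x y hxy
      exact Subtype.ext (congrArg Prod.fst hxy)
    · rintro ⟨x, y⟩
      constructor
      · intro hxy
        have hxy' : g x + j y = 0 := congrArg Subtype.val hxy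
        have h1 : β (g x) = 0 := (hβj _).2 ⟨-y, by rw [map_neg, eq_neg_of_add_eq_zero_left hxy']⟩
        refine ⟨⟨x, hker x h1⟩, Prod.ext rfl (hj ?_)⟩
        change j (-i _) = j y
        rw [map_neg, ← hgi, eq_neg_of_add_eq_zero_right hxy']
      · rintro ⟨k, hk⟩
        rw [← hk]
        refine Subtype.ext ?_
        change g k + j (-i k) = 0
        rw [hgi, map_neg, add_neg_cancel]
    · rintro ⟨l, hl⟩
      obtain ⟨x, rfl⟩ := (hγ0 l).1 hl
      exact ⟨x, rfl⟩
    · have := hs.projective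
      infer_instance
    · intro Q _ _ hQ f
      obtain ⟨h, hh⟩ := hs.extend Q hQ f
      refine ⟨-(h ∘ₗ LinearMap.snd A P P₁), fun x => ?_⟩
      change -(h (-i x)) = f x
      rw [map_neg, neg_neg, hh]

/-- Cover `N` by `P/ωP`. The horseshoe presents the Gorenstein projective kernel over `A` by a
projective module, so the presentation is special by `lspecial_of_exact`; both its extension
property and its left end pass down to `Ā`. -/
theorem HasGPCover.exists_cover {N : Type u} [AddCommGroup N] [Module (Abar ω) N]
    (h : HasGPCover ω N) : ∃ (F N' : ModuleCat.{u} (Abar ω)) (i : N' →ₗ[Abar ω] F)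
      (p : F →ₗ[Abar ω] N), LSpecial i p ∧ HasGPCover ω N' := by
  obtain ⟨P, π, hP, hπ, hK⟩ := h
  obtain ⟨B, β, hβ, hβ0⟩ := exists_quotient ω (omegaSub ω P) fun x => ⟨x, rfl⟩
  have hB : Module.Projective (Abar ω) B :=
    projective_of_ker_eq_omegaSub hP hβ fun x hx => (hβ0 x).1 hx
  obtain ⟨p, hp⟩ := exists_desc_of_surjective (toAbar_surjective ω) hβ π fun x hx => by
    obtain ⟨y, rfl⟩ := (hβ0 x).1 hx
    exact map_omega_smul π y
  have hps : Function.Surjective p := fun n => by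
    obtain ⟨x, rfl⟩ := hπ n
    exact ⟨β x, hp x⟩
  obtain ⟨P', π', hP', hπ'⟩ := exists_semilinear_cover (toAbar ω) (LinearMap.ker p)
  have hi : Function.Injective (LinearMap.ker p).subtype := Subtype.val_injective
  have he : Function.Exact (LinearMap.ker p).subtype p := p.exact_subtype_ker_map
  obtain ⟨ρ, hρ, h1, h2⟩ := exists_horseshoe he hps hP hπ' hπ
  obtain ⟨a, b, ha, hai, hab, hb⟩ := horseshoe_ker hi he hπ' h1 h2
  have hPP : Module.Projective A (P' × P) := inferInstance
  obtain ⟨hs, hK'⟩ := hK.lspecial_of_exact (projective_ker hPP hB hρ) hai hab hb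
  exact ⟨B, ModuleCat.of _ (LinearMap.ker p), (LinearMap.ker p).subtype, p, ⟨hi, he, hps, hB,
    extend_of_extend_ker (t := LinearMap.inl A P' P) hP' hπ' hρ h1 ha hs.extend⟩,
    P', π', hP', hπ', hK'⟩

theorem HasGPCover.isGPMod {N : Type u} [AddCommGroup N] [Module (Abar ω) N]
    (h : HasGPCover ω N) : IsGPMod (Abar ω) N := by
  refine isGPMod_of_coinduct (fun N : ModuleCat.{u} (Abar ω) => HasGPCover ω N) (fun N hN => ?_) h
  obtain ⟨F, N', i, p, hs, hN'⟩ := hN.exists_embedding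
  obtain ⟨F', N'', i', p', hs', hN''⟩ := hN.exists_cover
  exact ⟨⟨F, N', i, p, hs, Or.inl hN'⟩, ⟨F', N'', i', p', hs', Or.inl hN''⟩⟩

end Omega

end ModFact

noncomputable section


namespace ModFact

/-! ### Sequences of modules and modules over triangular matrix rings -/

section ColumnEquivalence

variable {R : Type u} [Ring R] {m : ℕ}

/-- The upper triangular matrix with `r` in position `(a, b)`, for `a ≤ b`. -/
def triUnit (a b : Fin m) (r : R) : upperTriangular R m :=
  if h : a ≤ b then ⟨Matrix.single a b r, Matrix.blockTriangular_single h r⟩ else 0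

theorem triUnit_val {a b : Fin m} (h : a ≤ b) (r : R) :
    (triUnit a b r).1 = Matrix.single a b r := by
  rw [triUnit, dif_pos h]

theorem triUnit_of_not_le {a b : Fin m} (h : ¬ a ≤ b) (r : R) : triUnit a b r = 0 := by
  rw [triUnit, dif_neg h]

theorem triUnit_mul {a b c : Fin m} (h : a ≤ b) (h' : b ≤ c) (r s : R) :
    triUnit a b r * triUnit b c s = triUnit a c (r * s) := Subtype.ext (by
  change (triUnit a b r).1 * (triUnit b c s).1 = _
  rw [triUnit_val h, triUnit_val h', triUnit_val (h.trans h'), Matrix.single_mul_single_same])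

theorem triUnit_mul_of_ne {a b : Fin m} (h : a ≠ b) (r s : R) :
    triUnit a a r * triUnit b b s = 0 := Subtype.ext (by
  change (triUnit a a r).1 * (triUnit b b s).1 = 0
  rw [triUnit_val le_rfl, triUnit_val le_rfl, Matrix.single_mul_single_of_ne _ _ _ _ h])

theorem sum_triUnit : ∑ a : Fin m, triUnit a a (1 : R) = 1 := Subtype.ext (by
  rw [AddSubmonoidClass.coe_finsetSum]
  simp only [triUnit_val le_rfl]
  exact Matrix.sum_single_one)

theorem mul_triUnit (l : upperTriangular R m) (b : Fin m) :
    l * triUnit b b 1 = ∑ a, triUnit a b (l.1 a b) := Subtype.ext (by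
  rw [AddSubmonoidClass.coe_finsetSum]
  change l.1 * (triUnit b b 1).1 = _
  have : ∀ a, (triUnit a b (l.1 a b)).1 = Matrix.single a b (l.1 a b) := fun a => by
    by_cases h : a ≤ b
    · exact triUnit_val h _
    · rw [triUnit_of_not_le h, l.2 (lt_of_not_ge h), Matrix.single_zero]
      rfl
  simp only [this]
  rw [triUnit_val le_rfl]
  ext i j
  rw [Matrix.sum_apply]
  by_cases hj : b = j
  · subst hj
    simp [Matrix.single_apply]
  · simp [hj, Matrix.mul_apply])

variable (R m) in
/-- Scalar matrices. -/
def diagHom : R →+* upperTriangular R m :=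
  (Matrix.scalar (Fin m)).codRestrict _ fun _ => Matrix.blockTriangular_diagonal _

theorem diagHom_mul_triUnit (a b : Fin m) (r s : R) :
    diagHom R m r * triUnit a b s = triUnit a b (r * s) := by
  by_cases h : a ≤ b
  · refine Subtype.ext ?_
    change Matrix.scalar (Fin m) r * (triUnit a b s).1 = _
    rw [triUnit_val h, triUnit_val h]
    ext i j
    simp [Matrix.single_apply]
  · rw [triUnit_of_not_le h, triUnit_of_not_le h, mul_zero]

theorem triUnit_mul_diagHom (a b : Fin m) (r s : R) :
    triUnit a b s * diagHom R m r = triUnit a b (s * r) := by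
  by_cases h : a ≤ b
  · refine Subtype.ext ?_
    change (triUnit a b s).1 * Matrix.scalar (Fin m) r = _
    rw [triUnit_val h, triUnit_val h]
    ext i j
    simp [Matrix.single_apply]
  · rw [triUnit_of_not_le h, triUnit_of_not_le h, zero_mul]

/-! ### Linear maps between columns -/

namespace Column

variable {M N : Fin m ⥤ ModuleCat.{u} R}

/-- The column with a single entry. -/
def single (M : Fin m ⥤ ModuleCat.{u} R) (a : Fin m) (x : M.obj a.rev) : Column M :=
  Pi.single (M := fun a : Fin m => M.obj a.rev) a x

theorem single_self (a : Fin m) (x : M.obj a.rev) : single M a x a = x :=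
  Pi.single_eq_same (M := fun a : Fin m => M.obj a.rev) a x

theorem single_of_ne {a b : Fin m} (h : b ≠ a) (x : M.obj a.rev) : single M a x b = 0 :=
  Pi.single_eq_of_ne (M := fun a : Fin m => M.obj a.rev) h x

theorem single_add (a : Fin m) (x y : M.obj a.rev) :
    single M a (x + y) = single M a x + single M a y :=
  Pi.single_add (f := fun a : Fin m => M.obj a.rev) a x y

theorem sum_single (x : Column M) : ∑ a, single M a (x a) = x :=
  Finset.univ_sum_single (M := fun a : Fin m => M.obj a.rev) x

theorem sum_apply {ι : Type*} (s : Finset ι) (f : ι → Column M) (a : Fin m) :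
    (∑ i ∈ s, f i) a = ∑ i ∈ s, f i a :=
  Finset.sum_apply (M := fun a : Fin m => M.obj a.rev) a s f

theorem triUnit_smul {a b : Fin m} (h : a ≤ b) (r : R) (x : Column M) :
    triUnit a b r • x = single M a (r • trans M h (x b)) := by
  funext c
  rw [smul_apply, triUnit_val h]
  by_cases hc : c = a
  · subst hc
    rw [single_self, Finset.sum_eq_single b, Matrix.single_apply_same, entry_of_le M h]
    · intro d _ hd
      rw [Matrix.single_apply_of_col_ne _ _ hd.symm]
      simp
    · simp
  · rw [single_of_ne hc]
    refine Finset.sum_eq_zero fun d _ => ?_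
    rw [Matrix.single_apply_of_row_ne (Ne.symm hc)]
    simp

/-- The components of a linear map between columns. -/
def component (φ : Column M →ₗ[upperTriangular R m] Column N) (a : Fin m) :
    M.obj a.rev →ₗ[R] N.obj a.rev where
  toFun x := φ (single M a x) a
  map_add' x y := by rw [single_add, map_add]; rfl
  map_smul' r x := by
    have h := triUnit_smul (le_refl a) r (single M a x)
    rw [single_self, trans_self] at h
    rw [← h, map_smul, triUnit_smul le_rfl, single_self, trans_self]
    rfl

variable (φ : Column M →ₗ[upperTriangular R m] Column N)

/-- A linear map commutes with the diagonal idempotents, so it acts entry by entry; commuting with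
the other matrix units is compatibility with the transition maps. -/
theorem map_single (a : Fin m) (x : M.obj a.rev) :
    φ (single M a x) = single N a (component φ a x) := by
  have h := triUnit_smul (le_refl a) 1 (single M a x)
  rw [single_self, trans_self, one_smul] at h
  rw [← h, map_smul, triUnit_smul le_rfl, trans_self, one_smul]
  rfl

theorem apply_eq_component (x : Column M) (a : Fin m) : φ x a = component φ a (x a) := by
  conv_lhs => rw [← sum_single x, map_sum]
  simp only [map_single]
  rw [sum_single (M := N) fun a => component φ a (x a)]

theorem component_trans {a b : Fin m} (h : a ≤ b) (x : M.obj b.rev) :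
    component φ a (trans M h x) = trans N h (component φ b x) := by
  have h1 := triUnit_smul h 1 (single M b x)
  rw [single_self, one_smul] at h1
  have h2 : φ (single M a (trans M h x)) a = trans N h (component φ b x) := by
    rw [← h1, map_smul, triUnit_smul h, single_self, one_smul]
    rfl
  exact h2

theorem map_map_apply {i j k : Fin m} (f : i ⟶ j) (g : j ⟶ k) (h : i ⟶ k) (x : M.obj i) :
    (M.map g).hom ((M.map f).hom x) = (M.map h).hom x := by
  rw [Subsingleton.elim h (f ≫ g), M.map_comp]
  rfl

theorem map_self_apply {i : Fin m} (f : i ⟶ i) (x : M.obj i) : (M.map f).hom x = x := by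
  rw [Subsingleton.elim f (𝟙 i), M.map_id]
  rfl

/-- The morphism of sequences attached to a linear map between columns. -/
def toNatTrans : M ⟶ N where
  -- Entries are indexed through `Fin.rev`, whose double application is the identity only
  -- propositionally; hence the transports.
  app i := M.map (eqToHom i.rev_rev.symm) ≫ ModuleCat.ofHom (component φ i.rev) ≫
    N.map (eqToHom i.rev_rev)
  naturality i j f := by
    ext x
    change (N.map (eqToHom j.rev_rev)).hom (component φ j.rev
        ((M.map (eqToHom j.rev_rev.symm)).hom ((M.map f).hom x))) =
      (N.map f).hom ((N.map (eqToHom i.rev_rev)).hom (component φ i.rev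
        ((M.map (eqToHom i.rev_rev.symm)).hom x)))
    have h : j.rev ≤ i.rev := Fin.rev_le_rev.2 (leOfHom f)
    have h1 := component_trans φ h ((M.map (eqToHom i.rev_rev.symm)).hom x)
    rw [trans, trans, map_map_apply _ _ (f ≫ eqToHom j.rev_rev.symm)] at h1
    rw [map_map_apply _ _ (f ≫ eqToHom j.rev_rev.symm), h1,
      map_map_apply _ _ (eqToHom i.rev_rev ≫ f), map_map_apply _ _ (eqToHom i.rev_rev ≫ f)]

theorem map_toNatTrans : Column.map (toNatTrans φ) = φ := by
  refine LinearMap.ext fun x => funext fun a => ?_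
  rw [apply_eq_component φ]
  change (N.map (eqToHom a.rev.rev_rev)).hom (component φ a.rev.rev
    ((M.map (eqToHom a.rev.rev_rev.symm)).hom (x a))) = _
  have h1 := component_trans φ (le_of_eq a.rev_rev) (x a)
  rw [trans, trans] at h1
  rw [Subsingleton.elim (eqToHom a.rev.rev_rev.symm) (homOfLE (Fin.rev_le_rev.2 (le_of_eq a.rev_rev))),
    h1, map_map_apply _ _ (𝟙 _), map_self_apply]

end Column

instance : (columnFunctor R m).Full where
  map_surjective φ :=
    ⟨Column.toNatTrans φ.hom, ModuleCat.hom_ext (Column.map_toNatTrans φ.hom)⟩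

instance : (columnFunctor R m).Faithful where
  map_injective {M N f g} h := by
    ext i x
    obtain ⟨a, rfl⟩ : ∃ a : Fin m, a.rev = i := ⟨i.rev, i.rev_rev⟩
    have h1 : Column.map f (Column.single M a x) a = Column.map g (Column.single M a x) a :=
      congrFun (congrArg (fun k => k.hom (Column.single M a x)) h) a
    change (f.app a.rev).hom (Column.single M a x a) = (g.app a.rev).hom (Column.single M a x a)
      at h1
    rwa [Column.single_self] at h1

/-! ### Peirce decomposition over the triangular matrix ring -/

namespace Peirce

variable (N : ModuleCat.{u} (upperTriangular R m))

instance : Module R N := Module.compHom N (diagHom R m)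

/-- The action of a matrix unit, as an `R`-linear map. -/
def act (a b : Fin m) : N →ₗ[R] N where
  toFun n := triUnit a b (1 : R) • n
  map_add' := smul_add _
  map_smul' r n := by
    change triUnit a b (1 : R) • diagHom R m r • n = diagHom R m r • triUnit a b (1 : R) • n
    rw [← mul_smul, ← mul_smul, diagHom_mul_triUnit, triUnit_mul_diagHom, mul_one, one_mul]

/-- The Peirce component of index `a`. -/
def piece (a : Fin m) : Submodule R N := LinearMap.ker (act N a a - LinearMap.id)

variable {N}

theorem mem_piece {a : Fin m} {n : N} : n ∈ piece N a ↔ triUnit a a (1 : R) • n = n := by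
  rw [piece, LinearMap.mem_ker, LinearMap.sub_apply, sub_eq_zero]
  rfl

theorem act_mem {a b : Fin m} (n : N) : act N a b n ∈ piece N a := by
  rw [mem_piece]
  change triUnit a a (1 : R) • triUnit a b (1 : R) • n = triUnit a b (1 : R) • n
  by_cases h : a ≤ b
  · rw [← mul_smul, triUnit_mul le_rfl h, one_mul]
  · rw [triUnit_of_not_le h, zero_smul, smul_zero]

variable (N) in
/-- The sequence of Peirce components of a module over the triangular matrix ring. -/
def seq : Fin m ⥤ ModuleCat.{u} R where
  obj i := ModuleCat.of R (piece N i.rev)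
  map {i j} _ := ModuleCat.ofHom ((act N j.rev i.rev).restrict fun n _ => act_mem n)
  map_id i := by
    refine ModuleCat.hom_ext (LinearMap.ext fun x => Subtype.ext ?_)
    exact mem_piece.1 x.2
  map_comp {i j k} f g := by
    refine ModuleCat.hom_ext (LinearMap.ext fun x => Subtype.ext ?_)
    change triUnit k.rev i.rev (1 : R) • (x : N) =
      triUnit k.rev j.rev (1 : R) • triUnit j.rev i.rev (1 : R) • (x : N)
    rw [← mul_smul, triUnit_mul (Fin.rev_le_rev.2 (leOfHom g)) (Fin.rev_le_rev.2 (leOfHom f)),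
      one_mul]

variable (N) in
/-- The inclusion of an entry of the column of Peirce components. -/
def incl (a : Fin m) : (seq N).obj a.rev →ₗ[R] N := (piece N a.rev.rev).subtype

theorem incl_spec (a : Fin m) (x : (seq N).obj a.rev) :
    triUnit a a (1 : R) • incl N a x = incl N a x := by
  have h : triUnit a.rev.rev a.rev.rev (1 : R) • incl N a x = incl N a x := mem_piece.1 x.2
  rwa [a.rev_rev] at h

theorem incl_entry (a b : Fin m) (r : R) (x : (seq N).obj b.rev) :
    incl N a (Column.entry (seq N) a b r x) = triUnit a b r • incl N b x := by
  by_cases h : a ≤ b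
  · rw [Column.entry_of_le _ h, map_smul]
    change diagHom R m r • triUnit a.rev.rev b.rev.rev (1 : R) • incl N b x = _
    rw [a.rev_rev, b.rev_rev, ← mul_smul, diagHom_mul_triUnit, mul_one]
  · rw [Column.entry_of_not_le _ h, triUnit_of_not_le h, map_zero, zero_smul]

variable (N) in
/-- A module is the column of its Peirce components. -/
def fromColumn : Column (seq N) →ₗ[upperTriangular R m] N where
  toFun x := ∑ a, incl N a (x a)
  map_add' x y := by simp only [Column.add_apply, map_add, Finset.sum_add_distrib]
  map_smul' l x := by
    simp only [Column.smul_apply, map_sum, incl_entry, RingHom.id_apply, Finset.smul_sum]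
    rw [Finset.sum_comm]
    refine Finset.sum_congr rfl fun b _ => ?_
    rw [← Finset.sum_smul, ← mul_triUnit, mul_smul, incl_spec]

theorem triUnit_smul_fromColumn (x : Column (seq N)) (a : Fin m) :
    triUnit a a (1 : R) • fromColumn N x = incl N a (x a) := by
  change triUnit a a (1 : R) • ∑ b, incl N b (x b) = _
  rw [Finset.smul_sum, Finset.sum_eq_single a, incl_spec]
  · intro b _ hb
    rw [← incl_spec, ← mul_smul, triUnit_mul_of_ne hb.symm, zero_smul]
  · simp

/-- The diagonal idempotent of index `a` recovers the entry of index `a`, and these idempotents sum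
to one. -/
theorem fromColumn_bijective : Function.Bijective (fromColumn N) := by
  constructor
  · rw [injective_iff_map_eq_zero]
    intro x hx
    funext a
    have h := triUnit_smul_fromColumn x a
    rw [hx, smul_zero] at h
    exact Subtype.ext h.symm
  · intro n
    refine ⟨fun a => ⟨triUnit a a (1 : R) • n, ?_⟩, ?_⟩
    · rw [mem_piece, a.rev_rev, ← mul_smul, triUnit_mul le_rfl le_rfl, one_mul]
    · change ∑ a, triUnit a a (1 : R) • n = n
      rw [← Finset.sum_smul, sum_triUnit, one_smul]

end Peirce

instance : (columnFunctor R m).EssSurj where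
  mem_essImage N :=
    ⟨Peirce.seq N, ⟨(LinearEquiv.ofBijective _ Peirce.fromColumn_bijective).toModuleIso⟩⟩

instance : (columnFunctor R m).IsEquivalence where

end ColumnEquivalence

end ModFact

end

noncomputable section

namespace ModFact

/-! ### Gorenstein projective sequences of modules -/

namespace Chain

open Limits

variable {R : Type u} [Ring R] {k : ℕ}

instance : HasFiniteBiproducts (Fin (k + 1) ⥤ ModuleCat.{u} R) := Abelian.hasFiniteBiproducts

variable (M N : Fin (k + 1) ⥤ ModuleCat.{u} R)

/-- The last module of a sequence. -/
abbrev top : Type u := M.obj (Fin.last k)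

/-- The map from an entry of a sequence to the last one. -/
def toTop (l : Fin (k + 1)) : M.obj l →ₗ[R] top M := (M.map (homOfLE (Fin.le_last l))).hom

/-- The sequences whose maps are injective. -/
def Monic : Prop := ∀ l, Function.Injective (toTop M l)

/-- The submodule of the last module given by the images of the entries of index less than `j`. -/
def imgSub (j : ℕ) : Submodule R (top M) where
  -- The images increase with the index, so a union is enough. The clause `x = 0` is needed for `j =
  -- 0`; for `j = l + 1` the submodule is the image of the entry `l`.
  carrier := {x | x = 0 ∨ ∃ l : Fin (k + 1), l.val < j ∧ ∃ y, toTop M l y = x}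
  zero_mem' := Or.inl rfl
  add_mem' := by
    rintro x x' (rfl | ⟨l, hl, y, rfl⟩) (rfl | ⟨l', hl', y', rfl⟩)
    · exact Or.inl (add_zero 0)
    · exact Or.inr ⟨l', hl', y', (zero_add _).symm⟩
    · exact Or.inr ⟨l, hl, y, (add_zero _).symm⟩
    · refine Or.inr ⟨max l l', by simp [hl, hl'], (M.map (homOfLE (le_max_left l l'))).hom y +
        (M.map (homOfLE (le_max_right l l'))).hom y', ?_⟩
      rw [map_add, toTop, Column.map_map_apply _ _ (homOfLE (Fin.le_last l)),
        Column.map_map_apply _ _ (homOfLE (Fin.le_last l'))]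
      rfl
  smul_mem' := by
    rintro r x (rfl | ⟨l, hl, y, rfl⟩)
    · exact Or.inl (smul_zero r)
    · exact Or.inr ⟨l, hl, r • y, map_smul _ _ _⟩

/-- The quotient of the last module by the images of the entries of index less than `j`. -/
abbrev Quot (j : ℕ) : Type u := top M ⧸ imgSub M j

variable {M N}

theorem toTop_map {l l' : Fin (k + 1)} (f : l ⟶ l') (x : M.obj l) :
    toTop M l' ((M.map f).hom x) = toTop M l x :=
  Column.map_map_apply _ _ _ _

theorem toTop_last (x : top M) : toTop M (Fin.last k) x = x := Column.map_self_apply _ _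

theorem toTop_mem {l : Fin (k + 1)} {j : ℕ} (h : l.val < j) (x : M.obj l) :
    toTop M l x ∈ imgSub M j := Or.inr ⟨l, h, x, rfl⟩

theorem imgSub_zero {x : top M} (h : x ∈ imgSub M 0) : x = 0 := by
  rcases h with h | ⟨l, hl, -⟩
  · exact h
  · exact absurd hl (Nat.not_lt_zero _)

theorem mem_imgSub_succ {l : Fin (k + 1)} {x : top M} (h : x ∈ imgSub M (l.val + 1)) :
    ∃ y, toTop M l y = x := by
  rcases h with rfl | ⟨l', hl, y, rfl⟩
  · exact ⟨0, map_zero _⟩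
  · exact ⟨(M.map (homOfLE (Fin.le_def.2 (Nat.lt_succ_iff.1 hl)))).hom y, toTop_map _ y⟩

theorem app_toTop (f : M ⟶ N) (l : Fin (k + 1)) (x : M.obj l) :
    (f.app (Fin.last k)).hom (toTop M l x) = toTop N l ((f.app l).hom x) :=
  NatTrans.naturality_apply f (homOfLE (Fin.le_last l)) x

theorem app_mem_imgSub (f : M ⟶ N) {j : ℕ} {x : top M} (h : x ∈ imgSub M j) :
    (f.app (Fin.last k)).hom x ∈ imgSub N j := by
  rcases h with rfl | ⟨l, hl, y, rfl⟩
  · rw [map_zero]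
    exact zero_mem _
  · rw [app_toTop]
    exact toTop_mem hl _

/-- The map on quotients induced by a morphism of sequences. -/
def quotMap (f : M ⟶ N) (j : ℕ) : Quot M j →ₗ[R] Quot N j :=
  Submodule.mapQ _ _ (f.app (Fin.last k)).hom fun _ hx => app_mem_imgSub f hx

/-- Exactness of a short sequence of sequences, entry by entry. -/
structure PointwiseExact {M P M' : Fin (k + 1) ⥤ ModuleCat.{u} R} (i : M ⟶ P) (p : P ⟶ M') :
    Prop where
  inj : ∀ l, Function.Injective (i.app l).hom
  exact : ∀ l, Function.Exact (i.app l).hom (p.app l).hom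
  surj : ∀ l, Function.Surjective (p.app l).hom

variable {P M' : Fin (k + 1) ⥤ ModuleCat.{u} R} {i : M ⟶ P} {p : P ⟶ M'}

theorem pointwiseExact_of_shortExact {w : i ≫ p = 0} (h : (ShortComplex.mk i p w).ShortExact) :
    PointwiseExact i p := by
  have key := fun l => h.map_of_exact ((evaluation (Fin (k + 1)) (ModuleCat.{u} R)).obj l)
  exact ⟨fun l => (ModuleCat.mono_iff_injective _).1 (key l).mono_f,
    fun l => (ShortComplex.ShortExact.moduleCat_exact_iff_function_exact _).1 (key l).exact,
    fun l => (ModuleCat.epi_iff_surjective _).1 (key l).epi_g⟩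

theorem Monic.of_injective (hN : Monic N) (f : M ⟶ N)
    (hf : ∀ l, Function.Injective (f.app l).hom) : Monic M := fun l x y hxy => by
  apply hf l
  apply hN l
  rw [← app_toTop, ← app_toTop, hxy]

theorem Monic.of_mono (hN : Monic N) (f : M ⟶ N) [Mono f] : Monic M :=
  hN.of_injective f fun l =>
    (ModuleCat.mono_iff_injective _).1 ((NatTrans.mono_iff_mono_app f).1 inferInstance l)

theorem quotMap_exact (h : PointwiseExact i p) (j : ℕ) :
    Function.Exact (quotMap i j) (quotMap p j) := by
  intro y
  obtain ⟨y, rfl⟩ := Submodule.mkQ_surjective _ y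
  constructor
  · intro hy
    have hy' : (p.app (Fin.last k)).hom y ∈ imgSub M' j := (Submodule.Quotient.mk_eq_zero _).1 hy
    have key : ∃ z ∈ imgSub P j, (p.app (Fin.last k)).hom z = (p.app (Fin.last k)).hom y := by
      rcases hy' with h0 | ⟨l, hl, y', hy'⟩
      · exact ⟨0, zero_mem _, by rw [h0, map_zero]⟩
      · obtain ⟨z, rfl⟩ := h.surj l y'
        exact ⟨toTop P l z, toTop_mem hl z, by rw [app_toTop, hy']⟩
    obtain ⟨z, hz, hzy⟩ := key
    obtain ⟨x, hx⟩ := (h.exact _ (y - z)).1 (by rw [map_sub, hzy, sub_self])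
    refine ⟨Submodule.Quotient.mk x, (Submodule.Quotient.eq _).2 ?_⟩
    have : (i.app (Fin.last k)).hom x - y = -z := by rw [hx]; abel
    rw [this]
    exact neg_mem hz
  · rintro ⟨x, hx⟩
    obtain ⟨x, rfl⟩ := Submodule.mkQ_surjective _ x
    rw [← hx]
    have h0 : (p.app (Fin.last k)).hom ((i.app (Fin.last k)).hom x) = 0 :=
      (h.exact _).apply_apply_eq_zero x
    exact (Submodule.Quotient.mk_eq_zero _).2 (by rw [h0]; exact zero_mem _)

theorem quotMap_surjective (h : PointwiseExact i p) (j : ℕ) :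
    Function.Surjective (quotMap p j) := by
  intro y
  obtain ⟨y, rfl⟩ := Submodule.mkQ_surjective _ y
  obtain ⟨x, rfl⟩ := h.surj _ y
  exact ⟨Submodule.Quotient.mk x, rfl⟩

/-- If `x` becomes the image of some `z` in `P_l`, then `z` dies in `M'_l`, because it does so in
the last term and `M'` is monic. So `z`, and hence `x`, comes from `M_l`. -/
theorem quotMap_injective (h : PointwiseExact i p) (hM' : Monic M') (j : ℕ) :
    Function.Injective (quotMap i j) := by
  rw [injective_iff_map_eq_zero]
  intro x hx
  obtain ⟨x, rfl⟩ := Submodule.mkQ_surjective _ x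
  have hx' : (i.app (Fin.last k)).hom x ∈ imgSub P j := (Submodule.Quotient.mk_eq_zero _).1 hx
  refine (Submodule.Quotient.mk_eq_zero _).2 ?_
  rcases hx' with h0 | ⟨l, hl, z, hz⟩
  · rw [h.inj _ (h0.trans (map_zero _).symm)]
    exact zero_mem _
  · have h1 : (p.app l).hom z = 0 := hM' l (by
      rw [← app_toTop, hz, map_zero]
      exact (h.exact _).apply_apply_eq_zero x)
    obtain ⟨y, rfl⟩ := (h.exact l z).1 h1
    rw [← app_toTop] at hz
    rw [← h.inj _ hz]
    exact toTop_mem hl y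

/-- For an index `l` before the last, an element of `M'_l` that dies in the last term comes from an
element of the kernel of the quotient map at `l + 1`. At the last index there is nothing to prove.
-/
theorem monic_right (h : PointwiseExact i p) (hP : Monic P)
    (hi : ∀ j : Fin (k + 1), Function.Injective (quotMap i j)) : Monic M' := by
  intro l
  rw [injective_iff_map_eq_zero]
  intro x hx
  rcases eq_or_ne l (Fin.last k) with rfl | hl
  · rwa [toTop_last] at hx
  obtain ⟨z, rfl⟩ := h.surj l x
  rw [← app_toTop] at hx
  obtain ⟨y, hy⟩ := (h.exact _ _).1 hx
  have hlt : l.val < k := Fin.val_lt_last hl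
  have h1 : quotMap i (l.val + 1) (Submodule.Quotient.mk y) = 0 :=
    (Submodule.Quotient.mk_eq_zero _).2 (by rw [hy]; exact toTop_mem (Nat.lt_succ_self _) z)
  have h2 := hi ⟨l.val + 1, Nat.succ_lt_succ hlt⟩ (h1.trans (map_zero _).symm)
  obtain ⟨y', rfl⟩ := mem_imgSub_succ ((Submodule.Quotient.mk_eq_zero _).1 h2)
  rw [app_toTop] at hy
  rw [← hP l hy]
  exact (h.exact l).apply_apply_eq_zero y'

/-! #### Constant sequences starting at some index -/

/-- The entries of the sequence that is `Q` from index `j` on, and `0` before. -/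
def stepSub (j : ℕ) (Q : Type u) [AddCommGroup Q] [Module R Q] (l : Fin (k + 1)) :
    Submodule R Q where
  -- A submodule of `Q`, rather than a case distinction between `Q` and zero, makes all transition
  -- maps inclusions.
  carrier := {x | j ≤ l.val ∨ x = 0}
  zero_mem' := Or.inr rfl
  add_mem' := by
    rintro x y (h | rfl) (h' | rfl)
    · exact Or.inl h
    · exact Or.inl h
    · exact Or.inl h'
    · exact Or.inr (add_zero 0)
  smul_mem' := by
    rintro r x (h | rfl)
    · exact Or.inl h
    · exact Or.inr (smul_zero r)

theorem stepSub_mono (j : ℕ) (Q : Type u) [AddCommGroup Q] [Module R Q] {l l' : Fin (k + 1)}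
    (h : l ≤ l') : stepSub (R := R) j Q l ≤ stepSub j Q l' := by
  rintro x (hx | hx)
  · exact Or.inl (hx.trans h)
  · exact Or.inr hx

variable (k) in
/-- The sequence that is `Q` from index `j` on, and `0` before. -/
def step (j : ℕ) (Q : ModuleCat.{u} R) : Fin (k + 1) ⥤ ModuleCat.{u} R where
  obj l := ModuleCat.of R (stepSub (R := R) j Q l)
  map f := ModuleCat.ofHom (Submodule.inclusion (stepSub_mono j Q (leOfHom f)))
  map_id _ := rfl
  map_comp _ _ := rfl

variable {Q Q' : ModuleCat.{u} R} {j : ℕ}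

theorem step_monic : Monic (step k j Q) := fun _ _ _ h =>
  Subtype.ext (congrArg (fun x : stepSub (R := R) j Q (Fin.last k) => (x : Q)) h)

/-- The underlying element of an element of `step k j Q`. -/
def stepVal {l : Fin (k + 1)} : (step k j Q).obj l →ₗ[R] Q := (stepSub j Q l).subtype

theorem stepVal_injective {l : Fin (k + 1)} :
    Function.Injective (stepVal : (step k j Q).obj l →ₗ[R] Q) := Subtype.val_injective

theorem stepVal_toTop {l : Fin (k + 1)} (x : (step k j Q).obj l) :
    stepVal (toTop (step k j Q) l x) = stepVal x := rfl

theorem step_eq_zero {l : Fin (k + 1)} (h : ¬ j ≤ l.val) (x : (step k j Q).obj l) : x = 0 :=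
  Subtype.ext (x.2.resolve_left h)

/-- Functoriality of `step`. -/
def stepMap (f : Q →ₗ[R] Q') : step k j Q ⟶ step k j Q' where
  app l := ModuleCat.ofHom (f.restrict (q := stepSub j Q' l) (by
    rintro x (h | rfl)
    · exact Or.inl h
    · exact Or.inr (map_zero f)))
  naturality _ _ _ := rfl

theorem epi_stepMap {f : Q →ₗ[R] Q'} (hf : Function.Surjective f) :
    Epi (stepMap f : step k j Q ⟶ step k j Q') := by
  rw [NatTrans.epi_iff_epi_app]
  intro l
  rw [ModuleCat.epi_iff_surjective]
  rintro ⟨x, hx⟩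
  rcases hx with h | rfl
  · obtain ⟨y, rfl⟩ := hf x
    exact ⟨⟨y, Or.inl h⟩, rfl⟩
  · exact ⟨0, map_zero _⟩

/-- Morphisms out of `step k j Q`. -/
def fromStep {j : Fin (k + 1)} (f : Q →ₗ[R] M.obj j) : step k j Q ⟶ M where
  app l := ModuleCat.ofHom (if h : j ≤ l then (M.map (homOfLE h)).hom ∘ₗ f ∘ₗ stepVal else 0)
  naturality l l' g := by
    ext x
    change (if h : j ≤ l' then (M.map (homOfLE h)).hom ∘ₗ f ∘ₗ stepVal else 0)
        (((step k j Q).map g).hom x) =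
      (M.map g).hom ((if h : j ≤ l then (M.map (homOfLE h)).hom ∘ₗ f ∘ₗ stepVal else 0) x)
    by_cases h : j ≤ l
    · rw [dif_pos h, dif_pos (h.trans (leOfHom g))]
      exact (Column.map_map_apply _ _ _ _).symm
    · rw [step_eq_zero h x, map_zero, map_zero, map_zero, map_zero]

theorem fromStep_app {j l : Fin (k + 1)} (h : j ≤ l) (f : Q →ₗ[R] M.obj j)
    (x : (step k j Q).obj l) :
    ((fromStep f).app l).hom x = (M.map (homOfLE h)).hom (f (stepVal x)) := by
  change (if h : j ≤ l then (M.map (homOfLE h)).hom ∘ₗ f ∘ₗ stepVal else 0) x = _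
  rw [dif_pos h]
  rfl

/-- Maps out of `step k j Q` are maps from `Q` to the entry of index `j`, and evaluation preserves
epimorphisms. -/
theorem projective_step (j : Fin (k + 1)) (hQ : Module.Projective R Q) :
    Projective (step k j Q) where
  factors {M N} g e he := by
    have hs : ∀ l, Function.Surjective (e.app l).hom := fun l =>
      (ModuleCat.epi_iff_surjective _).1 ((NatTrans.epi_iff_epi_app e).1 he l)
    let c : Q →ₗ[R] (step k j Q).obj j := LinearMap.codRestrict _ LinearMap.id fun x => Or.inl le_rfl
    obtain ⟨f, hf⟩ := Module.projective_lifting_property (e.app j).hom ((g.app j).hom ∘ₗ c) (hs j)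
    refine ⟨fromStep f, ?_⟩
    ext l x
    change (e.app l).hom (((fromStep f).app l).hom x) = (g.app l).hom x
    by_cases h : j ≤ l
    · rw [fromStep_app h]
      have h1 : (e.app j).hom (f (stepVal x)) = (g.app j).hom (c (stepVal x)) :=
        LinearMap.congr_fun hf (stepVal x)
      have h2 := NatTrans.naturality_apply e (homOfLE h) (f (stepVal x))
      have h3 := NatTrans.naturality_apply g (homOfLE h) (c (stepVal x))
      exact h2.trans ((congrArg (N.map (homOfLE h)).hom h1).trans h3.symm)
    · rw [step_eq_zero h x, map_zero, map_zero, map_zero]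

/-- Morphisms into `step k j Q`. -/
def intoStep (φ : top M →ₗ[R] Q) (h : ∀ x ∈ imgSub M j, φ x = 0) : M ⟶ step k j Q where
  app l := ModuleCat.ofHom ((φ ∘ₗ toTop M l).codRestrict (stepSub j Q l) fun x => by
    by_cases hl : j ≤ l.val
    · exact Or.inl hl
    · exact Or.inr (h _ (toTop_mem (not_le.1 hl) x)))
  naturality l l' f := by
    ext x
    exact Subtype.ext (congrArg φ (toTop_map f x))

theorem stepVal_app (ψ : M ⟶ step k j Q) (l : Fin (k + 1)) (x : M.obj l) :
    stepVal ((ψ.app l).hom x) = stepVal ((ψ.app (Fin.last k)).hom (toTop M l x)) := by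
  rw [app_toTop, stepVal_toTop]

theorem stepVal_app_eq_zero (ψ : M ⟶ step k j Q) {x : top M} (h : x ∈ imgSub M j) :
    stepVal ((ψ.app (Fin.last k)).hom x) = 0 := by
  rcases h with rfl | ⟨l, hl, y, rfl⟩
  · rw [map_zero, map_zero]
  · rw [← stepVal_app, step_eq_zero (not_le.2 hl) ((ψ.app l).hom y), map_zero]

theorem hom_step_ext {ψ ψ' : M ⟶ step k j Q}
    (h : ∀ x, stepVal ((ψ.app (Fin.last k)).hom x) = stepVal ((ψ'.app (Fin.last k)).hom x)) :
    ψ = ψ' := by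
  ext l x
  apply stepVal_injective
  rw [stepVal_app, h, ← stepVal_app]

/-- The map on the quotient given by a morphism into `step k j Q`. -/
def quotDesc (ψ : M ⟶ step k j Q) : Quot M j →ₗ[R] Q :=
  (imgSub M j).liftQ (stepVal ∘ₗ (ψ.app (Fin.last k)).hom) fun _ hx => stepVal_app_eq_zero ψ hx

theorem quotDesc_comp (f : M ⟶ N) (ψ : N ⟶ step k j Q) (x : Quot M j) :
    quotDesc (f ≫ ψ) x = quotDesc ψ (quotMap f j x) := by
  obtain ⟨x, rfl⟩ := Submodule.mkQ_surjective _ x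
  rfl

/-- The morphism into `step k j Q` given by a map on the quotient. -/
def ofQuot (φ : Quot M j →ₗ[R] Q) : M ⟶ step k j Q :=
  intoStep (φ ∘ₗ (imgSub M j).mkQ) fun x hx => by
    change φ (Submodule.Quotient.mk x) = 0
    rw [(Submodule.Quotient.mk_eq_zero _).2 hx, map_zero]

theorem stepVal_ofQuot (φ : Quot M j →ₗ[R] Q) (l : Fin (k + 1)) (x : M.obj l) :
    stepVal (((ofQuot φ).app l).hom x) = φ (Submodule.Quotient.mk (toTop M l x)) := rfl

theorem quotDesc_ofQuot (φ : Quot M j →ₗ[R] Q) (x : Quot M j) : quotDesc (ofQuot φ) x = φ x := by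
  obtain ⟨x, rfl⟩ := Submodule.mkQ_surjective _ x
  change φ (Submodule.Quotient.mk (toTop M (Fin.last k) x)) = _
  rw [toTop_last]
  rfl

theorem hom_step_ext_quot {ψ ψ' : M ⟶ step k j Q} (h : ∀ x, quotDesc ψ x = quotDesc ψ' x) :
    ψ = ψ' :=
  hom_step_ext fun x => h (Submodule.Quotient.mk x)

/-- The functor `Quot` at `j` is left adjoint to `step k j` (via `quotDesc` and `ofQuot`), and the
latter preserves epimorphisms. -/
theorem projective_quot (hP : Projective P) (j : ℕ) : Module.Projective R (Quot P j) := by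
  refine Module.Projective.of_lifting_property fun {A B} _ _ _ _ f g hf => ?_
  let f' : ModuleCat.of R A →ₗ[R] ModuleCat.of R B := f
  let g' : Quot P j →ₗ[R] ModuleCat.of R B := g
  have := epi_stepMap (k := k) (j := j) (f := f') hf
  let h := Projective.factorThru (ofQuot g') (stepMap f' : step k j _ ⟶ step k j _)
  refine ⟨quotDesc h, LinearMap.ext fun x => ?_⟩
  have h1 := congrArg (fun ψ => quotDesc ψ x)
    (Projective.factorThru_comp (ofQuot g') (stepMap f' : step k j _ ⟶ step k j _))
  refine Eq.trans ?_ (h1.trans (quotDesc_ofQuot g' x))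
  obtain ⟨x, rfl⟩ := Submodule.mkQ_surjective _ x
  rfl

/-! #### Projective sequences -/

/-- At index `j` the summand built from the free module on the entry `L_j` is already surjective.
Hence every projective sequence is a retract of a sum of projective steps. -/
theorem exists_step_cover (L : Fin (k + 1) ⥤ ModuleCat.{u} R) :
    ∃ (Q : Fin (k + 1) → ModuleCat.{u} R) (e : (⨁ fun j : Fin (k + 1) => step k j (Q j)) ⟶ L),
      (∀ j, Module.Projective R (Q j)) ∧ Epi e := by
  let f : ∀ j, (L.obj j →₀ R) →ₗ[R] L.obj j := fun j => Finsupp.linearCombination R id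
  have hf : ∀ j, Function.Surjective (f j) := fun j x =>
    ⟨Finsupp.single x 1, by simp [f]⟩
  refine ⟨fun j => ModuleCat.of R (L.obj j →₀ R), biproduct.desc fun j => fromStep (f j),
    fun j => inferInstanceAs (Module.Projective R (L.obj j →₀ R)), ?_⟩
  rw [NatTrans.epi_iff_epi_app]
  intro j
  rw [ModuleCat.epi_iff_surjective]
  intro x
  obtain ⟨y, rfl⟩ := hf j x
  refine ⟨((biproduct.ι (fun j : Fin (k + 1) => step k j (ModuleCat.of R (L.obj j →₀ R))) j).app
    j).hom ⟨y, Or.inl le_rfl⟩, ?_⟩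
  have h1 := congrArg (fun ψ => (ψ.app j).hom ⟨y, Or.inl le_rfl⟩)
    (biproduct.ι_desc (fun j : Fin (k + 1) => fromStep (Q := ModuleCat.of R (L.obj j →₀ R)) (f j)) j)
  refine h1.trans ?_
  refine (fromStep_app le_rfl _ _).trans ?_
  exact Column.map_self_apply _ _

theorem biproduct_step_monic (Q : Fin (k + 1) → ModuleCat.{u} R) :
    Monic (⨁ fun j : Fin (k + 1) => step k j (Q j)) := by
  intro l
  rw [injective_iff_map_eq_zero]
  intro x hx
  have h0 : ∀ j, ((biproduct.π (fun j : Fin (k + 1) => step k j (Q j)) j).app l).hom x = 0 :=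
    fun j => step_monic l (by rw [← app_toTop, hx, map_zero, map_zero])
  have h1 := congrArg (fun ψ => (ψ.app l).hom x)
    (biproduct.total (f := fun j : Fin (k + 1) => step k j (Q j)))
  simp only [NatTrans.app_sum, ModuleCat.hom_sum, LinearMap.sum_apply] at h1
  refine h1.symm.trans (Finset.sum_eq_zero fun j _ => ?_)
  exact (congrArg ((biproduct.ι (fun j : Fin (k + 1) => step k j (Q j)) j).app l).hom (h0 j)).trans
    (map_zero _)

theorem projective_biproduct_step {Q : Fin (k + 1) → ModuleCat.{u} R}
    (hQ : ∀ j, Module.Projective R (Q j)) :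
    Projective (⨁ fun j : Fin (k + 1) => step k j (Q j)) where
  factors {M N} g e he := by
    have := fun j => projective_step j (hQ j)
    refine ⟨biproduct.desc fun j => Projective.factorThru
      (biproduct.ι (fun j : Fin (k + 1) => step k j (Q j)) j ≫ g) e,
      biproduct.hom_ext' _ _ fun j => ?_⟩
    rw [biproduct.ι_desc_assoc, Projective.factorThru_comp]

theorem monic_of_projective {L : Fin (k + 1) ⥤ ModuleCat.{u} R} (hL : Projective L) :
    Monic L := by
  obtain ⟨Q, e, -, he⟩ := exists_step_cover L
  have hs := Projective.factorThru_comp (𝟙 L) e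
  have : Mono (Projective.factorThru (𝟙 L) e) := mono_of_mono_fac hs
  exact (biproduct_step_monic Q).of_mono (Projective.factorThru (𝟙 L) e)

/-- Extension of morphisms to projective sequences can be tested on quotients. -/
theorem extend_of_quot
    (h : ∀ (j : Fin (k + 1)) (Q : Type u) [AddCommGroup Q] [Module R Q], Module.Projective R Q →
      ∀ f : Quot M j →ₗ[R] Q, ∃ g : Quot P j →ₗ[R] Q, ∀ x, g (quotMap i j x) = f x)
    (L : Fin (k + 1) ⥤ ModuleCat.{u} R) (hL : Projective L) (f : M ⟶ L) :
    ∃ g : P ⟶ L, i ≫ g = f := by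
  obtain ⟨Q, e, hQ, he⟩ := exists_step_cover L
  have hs := Projective.factorThru_comp (𝟙 L) e
  -- `L` is a retract of a sum of steps, so it suffices to extend each component into a step, which
  -- is an extension problem for `Quot`.
  have key : ∀ j : Fin (k + 1), ∃ g : P ⟶ step k j (Q j), i ≫ g =
      f ≫ Projective.factorThru (𝟙 L) e ≫ biproduct.π (fun j : Fin (k + 1) => step k j (Q j)) j := by
    intro j
    obtain ⟨g, hg⟩ := h j (Q j) (hQ j) (quotDesc (f ≫ Projective.factorThru (𝟙 L) e ≫
      biproduct.π (fun j : Fin (k + 1) => step k j (Q j)) j))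
    refine ⟨ofQuot g, hom_step_ext_quot fun x => ?_⟩
    rw [quotDesc_comp, quotDesc_ofQuot, hg]
  choose g hg using key
  refine ⟨biproduct.lift g ≫ e, ?_⟩
  have h1 : i ≫ biproduct.lift g = f ≫ Projective.factorThru (𝟙 L) e := by
    refine biproduct.hom_ext _ _ fun j => ?_
    rw [Category.assoc, biproduct.lift_π, hg, Category.assoc]
  rw [reassoc_of% h1, hs, Category.comp_id]

/-! #### Gorenstein projective sequences -/

theorem special_of_quot {w : i ≫ p = 0} (h : (ShortComplex.mk i p w).ShortExact)
    (hP : Projective P) (hs : ∀ j : Fin (k + 1), LSpecial (quotMap i j) (quotMap p j)) :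
    Special i p :=
  ⟨w, h, hP, extend_of_quot fun j => (hs j).extend⟩

/-- Extending maps from `Quot M j` to `Q` is extending morphisms from `M` to the projective sequence
`step k j Q`. Monicity of the right end is what keeps the quotient sequence exact on the left. -/
theorem quot_of_special (h : Special i p) (hM' : Monic M') (j : Fin (k + 1)) :
    LSpecial (quotMap i j) (quotMap p j) := by
  have he := pointwiseExact_of_shortExact h.shortExact
  refine ⟨quotMap_injective he hM' j, quotMap_exact he j, quotMap_surjective he j,
    projective_quot h.projective j, fun Q _ _ hQ f => ?_⟩
  obtain ⟨g, hg⟩ := h.extend _ (projective_step (Q := ModuleCat.of R Q) j hQ) (ofQuot f)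
  refine ⟨quotDesc g, fun x => ?_⟩
  rw [← quotDesc_comp, hg, quotDesc_ofQuot]

/-- The monic sequences all of whose quotients are Gorenstein projective. -/
def IsGPFiltered (M : Fin (k + 1) ⥤ ModuleCat.{u} R) : Prop :=
  Monic M ∧ ∀ j : Fin (k + 1), IsGPMod R (Quot M j)

/-- Special embeddings of all quotients of `M`, transposed, assemble into a morphism to a sum of
steps. Its component at `0` already gives injectivity, since the quotient at `0` is the last term
and `M` is monic. -/
theorem IsGPFiltered.embedsIn (hM : IsGPFiltered M) : EmbedsIn IsGPFiltered M := by
  choose Q Q' e q hs hQ' using fun j => (hM.2 j).exists_embedding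
  let i : M ⟶ ⨁ fun j : Fin (k + 1) => step k j (Q j) := biproduct.lift fun j => ofQuot (e j)
  have hi : Mono i := by
    have : Mono (ofQuot (e 0)) := by
      rw [NatTrans.mono_iff_mono_app]
      intro l
      rw [ModuleCat.mono_iff_injective]
      change Function.Injective ((ofQuot (e 0)).app l).hom
      rw [injective_iff_map_eq_zero]
      intro x hx
      have h1 := stepVal_ofQuot (e 0) l x
      rw [hx, map_zero] at h1
      have h2 := (hs 0).inj (h1.symm.trans (map_zero _).symm)
      exact hM.1 l ((imgSub_zero ((Submodule.Quotient.mk_eq_zero _).1 h2)).trans (map_zero _).symm)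
    exact mono_of_mono_fac (biproduct.lift_π (fun j => ofQuot (e j)) 0)
  have hP := projective_biproduct_step fun j => (hs j).projective
  have hse : (ShortComplex.mk i (cokernel.π i) (cokernel.condition i)).ShortExact :=
    { exact := ShortComplex.exact_cokernel i, mono_f := hi, epi_g := inferInstance }
  have he := pointwiseExact_of_shortExact hse
  have hc : ∀ j x, quotDesc (biproduct.π (fun j : Fin (k + 1) => step k j (Q j)) j)
      (quotMap i j x) = e j x := fun j x => by
    rw [← quotDesc_comp]
    exact (congrArg (fun ψ => quotDesc ψ x) (biproduct.lift_π _ j)).trans (quotDesc_ofQuot _ x)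
  have hl : ∀ j : Fin (k + 1), LSpecial (quotMap i j) (quotMap (cokernel.π i) j) := fun j => by
    refine ⟨fun x y hxy => (hs j).inj ?_, quotMap_exact he j, quotMap_surjective he j,
      projective_quot hP j, fun Q₁ _ _ hQ₁ f => ?_⟩
    · rw [← hc, ← hc, hxy]
    · obtain ⟨g, hg⟩ := (hs j).extend Q₁ hQ₁ f
      exact ⟨g ∘ₗ quotDesc (biproduct.π (fun j : Fin (k + 1) => step k j (Q j)) j),
        fun x => by rw [LinearMap.comp_apply, hc, hg]⟩
  -- The cokernel is monic because `i` stays injective on every quotient, and its quotients are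
  -- right ends of special sequences starting at those of `M`.
  exact ⟨_, _, i, cokernel.π i, special_of_quot hse hP hl,
    monic_right he (monic_of_projective hP) fun j => (hl j).inj,
    fun j => (hl j).isGPMod_right (hM.2 j)⟩

/-- Any cover by projective steps works: monicity of `M` makes the quotient sequences exact, and
projective presentations of Gorenstein projective modules are automatically special. -/
theorem IsGPFiltered.coveredBy (hM : IsGPFiltered M) : CoveredBy IsGPFiltered M := by
  obtain ⟨Q, e, hQ, he⟩ := exists_step_cover M
  have hP := projective_biproduct_step hQ
  have hse : (ShortComplex.mk (kernel.ι e) e (kernel.condition e)).ShortExact :=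
    { exact := ShortComplex.exact_kernel e, mono_f := inferInstance, epi_g := he }
  have hpe := pointwiseExact_of_shortExact hse
  have hl := fun j : Fin (k + 1) => (hM.2 j).lspecial_of_exact (projective_quot hP j)
    (quotMap_injective hpe hM.1 j) (quotMap_exact hpe j) (quotMap_surjective hpe j)
  exact ⟨_, _, kernel.ι e, e, special_of_quot hse hP fun j => (hl j).1,
    (monic_of_projective hP).of_injective _ hpe.inj, fun j => (hl j).2⟩

/-- A sequence is Gorenstein projective if and only if it is monic with Gorenstein projective
quotients. -/
theorem isGP_iff : IsGP M ↔ IsGPFiltered M := by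
  constructor
  · intro h
    have hmonic : ∀ {M : Fin (k + 1) ⥤ ModuleCat.{u} R}, IsGP M → Monic M := fun h => by
      obtain ⟨P, Y, i, p, hs, -⟩ := h.embedsIn
      exact (monic_of_projective hs.projective).of_injective i
        (pointwiseExact_of_shortExact hs.shortExact).inj
    refine ⟨hmonic h, fun j => ?_⟩
    refine isGPMod_of_coinduct (fun X => ∃ M : Fin (k + 1) ⥤ ModuleCat.{u} R, IsGP M ∧
      X = ModuleCat.of R (Quot M j)) ?_ ⟨M, h, rfl⟩
    rintro _ ⟨M, hM, rfl⟩
    obtain ⟨P, Y, i, p, hs, hY⟩ := hM.embedsIn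
    obtain ⟨P', Y', i', p', hs', hY'⟩ := hM.coveredBy
    exact ⟨⟨ModuleCat.of R (Quot P j), ModuleCat.of R (Quot Y j), _, _,
        quot_of_special hs (hmonic hY) j, Or.inl ⟨Y, hY, rfl⟩⟩,
      ⟨ModuleCat.of R (Quot P' j), ModuleCat.of R (Quot Y' j), _, _,
        quot_of_special hs' (hmonic hM) j, Or.inl ⟨Y', hY', rfl⟩⟩⟩
  · exact fun h => ⟨IsGPFiltered, h, fun M hM => ⟨hM.embedsIn, hM.coveredBy⟩⟩

end Chain

end ModFact

end

noncomputable section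

namespace ModFact

namespace ModuleFactorization

/-! ### Module factorizations with projective last component -/

variable {A : Type u} [Ring A] {ω : A} [RegularNormal ω] {m : ℕ}

/-- The map `X^i ⟶ X^m`. -/
def toLast (X : ModuleFactorization ω m) (i : Fin (m + 1)) :
    X.seq.obj i →ₗ[A] X.seq.obj (Fin.last m) :=
  (X.seq.map (homOfLE (Fin.le_last i))).hom

/-- The map `X⁰ ⟶ X^i`. -/
def ofZero (X : ModuleFactorization ω m) (i : Fin (m + 1)) : X.seq.obj 0 →ₗ[A] X.seq.obj i :=
  (X.seq.map (homOfLE (Fin.zero_le i))).hom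

section Maps

variable (X : ModuleFactorization ω m)

theorem toLast_map {i j : Fin (m + 1)} (f : i ⟶ j) (x : X.seq.obj i) :
    toLast X j ((X.seq.map f).hom x) = toLast X i x := by
  rw [toLast, toLast, Subsingleton.elim (homOfLE (Fin.le_last i)) (f ≫ homOfLE (Fin.le_last j)),
    Functor.map_comp]
  rfl

theorem toLast_last (x : X.seq.obj (Fin.last m)) : toLast X (Fin.last m) x = x := by
  rw [toLast, Subsingleton.elim (homOfLE _) (𝟙 (Fin.last m)), X.seq.map_id]
  rfl

theorem ofZero_zero (x : X.seq.obj 0) : ofZero X 0 x = x := by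
  rw [ofZero, Subsingleton.elim (homOfLE _) (𝟙 (0 : Fin (m + 1))), X.seq.map_id]
  rfl

theorem map_ofZero {i j : Fin (m + 1)} (f : i ⟶ j) (x : X.seq.obj 0) :
    (X.seq.map f).hom (ofZero X i x) = ofZero X j x := by
  rw [ofZero, ofZero, Subsingleton.elim (homOfLE (Fin.zero_le j)) (homOfLE (Fin.zero_le i) ≫ f),
    Functor.map_comp]
  rfl

theorem toLast_ofZero (i : Fin (m + 1)) (x : X.seq.obj 0) :
    toLast X i (ofZero X i x) = toLast X 0 x := toLast_map X _ x

theorem toLast_zero_last (x : X.seq.obj (Fin.last m)) : toLast X 0 (X.last x) = ω • x := by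
  have h := X.comp_eq (Fin.last m) x
  have h1 : (X.seq.map (homOfLE (Fin.le_last (Fin.last m)))).hom x = x := toLast_last X x
  rwa [h1] at h

theorem component_toLast {X Y : ModuleFactorization ω m} (f : X ⟶ Y) (i : Fin (m + 1))
    (x : X.seq.obj i) :
    component f (Fin.last m) (toLast X i x) = toLast Y i (component f i x) :=
  NatTrans.naturality_apply (natTrans f) (homOfLE (Fin.le_last i)) x

-- Followed by the maps `X^m → X⁰ → X^i`, the map becomes multiplication by `ω`, which is injective
-- on a Gorenstein projective module.
variable {X} in
theorem toLast_injective (hX : isG0F ω m X) (i : Fin (m + 1)) :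
    Function.Injective (toLast X i) := by
  intro x y hxy
  apply IsGPMod.omega_smul_injective ω (IsGorensteinProjective.isGP (hX.1 i))
  change ω • x = ω • y
  rw [← X.comp_eq i x, ← X.comp_eq i y]
  exact congrArg (fun z => ofZero X i (X.last z)) hxy

end Maps

/-- The projection to the cokernel, as a semilinear map. -/
def toCokBar (X : ModuleFactorization ω m) (i : Fin m) :
    X.seq.obj i.succ →ₛₗ[toAbar ω] Cok X i where
  toFun := toCok X i
  map_add' := map_add _
  map_smul' _ _ := rfl

theorem toCok_eq_zero_iff (X : ModuleFactorization ω m) {i : Fin m} {x : X.seq.obj i.succ} :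
    toCok X i x = 0 ↔ ∃ y, fromZero X i y = x :=
  Submodule.Quotient.mk_eq_zero _

theorem toCok_eq_iff (X : ModuleFactorization ω m) {i : Fin m} {x y : X.seq.obj i.succ} :
    toCok X i x = toCok X i y ↔ ∃ z, fromZero X i z = x - y :=
  Submodule.Quotient.eq _

/-! #### Morphisms killed by the cokernel functor -/

/-- If the last component lands in `Y⁰`, the resulting `l : X^m → Y⁰` gives `f` as `X → θ⁰(X^m) →
Y`. All identities are checked in `Y^m`, where the terms of `Y` embed. -/
theorem inIdeal_of_factor {X Y : ModuleFactorization ω m} (hX : isG0F ω m X) (hY : isG0F ω m Y)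
    (f : X ⟶ Y) (h : ∀ x, ∃ y, toLast Y 0 y = component f (Fin.last m) x) : InIdeal f := by
  obtain ⟨l, hl⟩ := exists_lift_of_mem_range (toLast_injective hY 0) (component f (Fin.last m)) h
  let g : X ⟶ (theta0 ω m).obj (X.seq.obj (Fin.last m)) :=
    ⟨{ app := fun i => ModuleCat.ofHom (toLast X i)
       naturality := fun i j e => by
        ext x
        exact toLast_map X e x }, fun x =>
        (toLast_zero_last X x).trans (congrArg (fun y => ω • y) (toLast_last X x).symm)⟩
  let k : (theta0 ω m).obj (X.seq.obj (Fin.last m)) ⟶ Y :=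
    ⟨{ app := fun i => ModuleCat.ofHom (ofZero Y i ∘ₗ l)
       naturality := fun i j e => by
        ext x
        exact (map_ofZero Y e (l x)).symm }, fun (x : X.seq.obj (Fin.last m)) => by
      change ofZero Y 0 (l (ω • x)) = Y.last (ofZero Y (Fin.last m) (l x))
      apply toLast_injective hY 0
      have h1 : ofZero Y (Fin.last m) (l x) = toLast Y 0 (l x) := rfl
      rw [ofZero_zero, toLast_zero_last, map_smul, map_smul, h1]⟩
  refine ⟨_, hX.2, g, k, Subtype.ext (NatTrans.ext (funext fun i => ?_))⟩
  ext x
  change ofZero Y i (l (toLast X i x)) = component f i x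
  apply toLast_injective hY i
  rw [toLast_ofZero, hl, component_toLast]

theorem inIdeal_of_cokSeq_map_eq_zero {X Y : ModuleFactorization ω m} (hX : isG0F ω m X)
    (hY : isG0F ω m Y) (f : X ⟶ Y) (h : (cokSeq ω m).map f = 0) : InIdeal f := by
  refine inIdeal_of_factor hX hY f ?_
  -- Index `0` is treated separately because `Y⁰` has no cokernel; for `m = 0` it is also the last
  -- index.
  have key : ∀ (l : Fin (m + 1)) x, ∃ y, ofZero Y l y = component f l x := by
    intro l
    refine Fin.cases (fun x => ⟨_, ofZero_zero Y _⟩) (fun i x => ?_) l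
    have h1 : toCok Y i (component f i.succ x) = 0 :=
      congrArg (fun φ => (φ.app i).hom (toCok X i x)) h
    exact (toCok_eq_zero_iff Y).1 h1
  exact key (Fin.last m)

/-! #### Lifting morphisms between cokernels -/

/-- Because the terms of `Y` embed in `Y^m`, a morphism to `Y` is just a map between last terms that
preserves the chains. Compatibility with the closing map reduces to linearity with respect to `ω`.
-/
theorem exists_hom_of_last {X Y : ModuleFactorization ω m} (hY : isG0F ω m Y)
    (F : X.seq.obj (Fin.last m) →ₗ[A] Y.seq.obj (Fin.last m))
    (h : ∀ i x, ∃ y, toLast Y i y = F (toLast X i x)) :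
    ∃ f : X ⟶ Y, ∀ i x, toLast Y i (component f i x) = F (toLast X i x) := by
  choose f hf using fun i => exists_lift_of_mem_range (toLast_injective hY i) (F ∘ₗ toLast X i) (h i)
  replace hf : ∀ i x, toLast Y i (f i x) = F (toLast X i x) := hf
  refine ⟨⟨{ app := fun i => ModuleCat.ofHom (f i)
             naturality := fun i j e => ?_ }, fun x => ?_⟩, hf⟩
  · ext x
    change f j ((X.seq.map e).hom x) = (Y.seq.map e).hom (f i x)
    apply toLast_injective hY j
    rw [hf, toLast_map, toLast_map, hf]
  · change f 0 (X.last x) = Y.last (f (Fin.last m) x)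
    apply toLast_injective hY 0
    have h1 := hf (Fin.last m) x
    rw [toLast_last, toLast_last] at h1
    rw [hf, toLast_zero_last, toLast_zero_last, h1, map_smul]

theorem exists_cokSeq_map_eq {X Y : ModuleFactorization ω m} (hX : isG0F ω m X)
    (hY : isG0F ω m Y) (φ : cokSeqObj X ⟶ cokSeqObj Y) : ∃ f : X ⟶ Y, (cokSeq ω m).map f = φ := by
  cases m with
  | zero => exact ⟨0, NatTrans.ext (funext fun i => i.elim0)⟩
  | succ k =>
    obtain ⟨F, hF⟩ := exists_lift_semilinear (τ := toAbar ω) hX.2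
      ((φ.app (Fin.last k)).hom.comp (toCokBar X (Fin.last k)))
      (π := toCokBar Y (Fin.last k)) (toCok_surjective Y _)
    replace hF : ∀ x, toCok Y (Fin.last k) (F x) = (φ.app (Fin.last k)).hom (toCok X _ x) := hF
    have hs : ∀ (l : Fin (k + 1)) x, ∃ y, toLast Y l.succ y = F (toLast X l.succ x) ∧
        toCok Y l y = (φ.app l).hom (toCok X l x) := by
      intro l x
      obtain ⟨y, hy⟩ := toCok_surjective Y l ((φ.app l).hom (toCok X l x))
      have h1 : (φ.app (Fin.last k)).hom (toCok X (Fin.last k) (toLast X l.succ x)) =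
          toCok Y (Fin.last k) (toLast Y l.succ y) :=
        (NatTrans.naturality_apply φ (homOfLE (Fin.le_last l)) (toCok X l x)).trans
          (congrArg ((cokSeqObj Y).map (homOfLE (Fin.le_last l))).hom hy.symm)
      obtain ⟨z, hz⟩ := (toCok_eq_iff Y).1 ((hF _).trans h1)
      -- `F` and `φ` agree only modulo the image of `Y⁰`; adding the difference `z` makes them agree
      -- exactly and leaves the class of `y` unchanged.
      refine ⟨y + fromZero Y l z, ?_, ?_⟩
      · have h2 : toLast Y l.succ (fromZero Y l z) = fromZero Y (Fin.last k) z :=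
          toLast_map Y _ z
        rw [map_add, h2, hz]
        exact add_sub_cancel _ _
      · rw [map_add, toCok_eq_zero, add_zero, hy]
    obtain ⟨f, hf⟩ := exists_hom_of_last hY F fun i => by
      refine Fin.cases (fun x => ?_) (fun l x => ?_) i
      · have h1 : toCok Y (Fin.last k) (F (fromZero X (Fin.last k) x)) = 0 := by
          rw [hF, toCok_eq_zero]
          exact map_zero (φ.app (Fin.last k)).hom
        exact (toCok_eq_zero_iff Y).1 h1
      · obtain ⟨y, hy, -⟩ := hs l x
        exact ⟨y, hy⟩
    refine ⟨f, NatTrans.ext (funext fun l => ModuleCat.hom_ext (LinearMap.ext fun c => ?_))⟩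
    obtain ⟨x, rfl⟩ := toCok_surjective X l c
    obtain ⟨y, hy, hy'⟩ := hs l x
    have h1 : component f l.succ x = y := toLast_injective hY _ ((hf _ x).trans hy.symm)
    change toCok Y l (component f l.succ x) = _
    rw [h1, hy']
    rfl

/-! #### Cokernels are Gorenstein projective -/

/-- The quotient of the last cokernel at `j` is `X^{k+1}/X^j`, so its projective cover by `X^{k+1}`
has the Gorenstein projective kernel `X^j`, and `HasGPCover.isGPMod` applies. -/
theorem cokSeqObj_isGPFiltered {k : ℕ} {X : ModuleFactorization ω (k + 1)}
    (hX : isG0F ω (k + 1) X) : Chain.IsGPFiltered (cokSeqObj X) := by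
  have htop : ∀ (l : Fin (k + 1)) x, Chain.toTop (cokSeqObj X) l (toCok X l x) =
      toCok X (Fin.last k) (toLast X l.succ x) := fun _ _ => rfl
  have hzero : ∀ (l : Fin (k + 1)) x, fromZero X (Fin.last k) x =
      toLast X l.succ (fromZero X l x) := fun l x => (toLast_map X _ x).symm
  constructor
  · intro l
    rw [injective_iff_map_eq_zero]
    intro c hc
    obtain ⟨x, rfl⟩ := toCok_surjective X l c
    obtain ⟨z, hz⟩ := (toCok_eq_zero_iff X).1 ((htop l x).symm.trans hc)
    rw [hzero l] at hz
    rw [← toLast_injective hX _ hz]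
    exact toCok_eq_zero X l z
  · intro j
    let π : X.seq.obj (Fin.last (k + 1)) →ₛₗ[toAbar ω] Chain.Quot (cokSeqObj X) j :=
      (Chain.imgSub (cokSeqObj X) j).mkQ.comp (toCokBar X (Fin.last k))
    have hπ : Function.Surjective π :=
      (Submodule.mkQ_surjective _).comp (toCok_surjective X (Fin.last k))
    -- Entry `l` of the sequence of cokernels comes from `X^{l+1}`, so the entries with `l < j` come
    -- from terms up to `X^j`; for `j = 0` only the image of `X⁰` remains.
    have hπ0 : ∀ y, π y = 0 ↔ ∃ x, toLast X j.castSucc x = y := by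
      intro y
      have h1 : π y = 0 ↔ toCok X (Fin.last k) y ∈ Chain.imgSub (cokSeqObj X) j :=
        Submodule.Quotient.mk_eq_zero _
      rw [h1]
      constructor
      · rintro (h | ⟨l, hl, c, hc⟩)
        · obtain ⟨z, rfl⟩ := (toCok_eq_zero_iff X).1 h
          exact ⟨ofZero X _ z, toLast_ofZero X _ z⟩
        · obtain ⟨x, rfl⟩ := toCok_surjective X l c
          obtain ⟨z, hz⟩ := (toCok_eq_iff X).1 ((htop l x).symm.trans hc)
          refine ⟨(X.seq.map (homOfLE
            (show l.succ ≤ j.castSucc from Nat.succ_le_of_lt hl))).hom x - ofZero X _ z, ?_⟩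
          have hz' : toLast X 0 z = toLast X l.succ x - y := hz
          rw [map_sub, toLast_map, toLast_ofZero, hz']
          abel
      · rintro ⟨x, rfl⟩
        rcases Fin.eq_zero_or_eq_succ j.castSucc with h | ⟨l, h⟩
        · clear h1
          revert x
          rw [h]
          intro x
          exact Or.inl (toCok_eq_zero X (Fin.last k) x)
        · have hl : l.val < j.val := by
            have := congrArg Fin.val h
            simp at this
            omega
          clear h1
          revert x
          rw [h]
          intro x
          exact Or.inr ⟨l, hl, toCok X l x, htop l x⟩
    refine HasGPCover.isGPMod (ω := ω) ⟨_, π, hX.2, hπ, IsGPMod.of_equiv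
      (LinearEquiv.ofBijective ((toLast X j.castSucc).codRestrict (LinearMap.ker π)
        fun x => (hπ0 _).2 ⟨x, rfl⟩) ⟨?_, ?_⟩) (IsGorensteinProjective.isGP (hX.1 j.castSucc))⟩
    · intro x y hxy
      exact toLast_injective hX _ (congrArg Subtype.val hxy)
    · rintro ⟨y, hy⟩
      obtain ⟨x, rfl⟩ := (hπ0 y).1 hy
      exact ⟨x, rfl⟩

theorem isGP_of_lambda_zero (N : ModuleCat.{u} (Lambda ω 0)) : IsGP N := by
  have hN : Subsingleton N := ⟨fun x y => by
    have h : (1 : Lambda ω 0) = 0 := Subsingleton.elim _ _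
    rw [← one_smul (Lambda ω 0) x, ← one_smul (Lambda ω 0) y, h, zero_smul, zero_smul]⟩
  exact isGPMod_of_projective (M := N)
    (Module.Projective.of_lifting_property fun f g hf => ⟨0, LinearMap.ext fun x => by
      rw [Subsingleton.elim x 0, map_zero, map_zero]⟩)

theorem cok0_isGP {X : ModuleFactorization ω m} (hX : isG0F ω m X) : IsGP ((cok0 ω m).obj X) := by
  cases m with
  | zero => exact isGP_of_lambda_zero _
  | succ k =>
    exact IsGP.map (columnFunctor (Abar ω) (k + 1)).asEquivalence
      (Chain.isGP_iff.2 (cokSeqObj_isGPFiltered hX))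

/-! #### Essential surjectivity -/

section OfChain

variable {k : ℕ} (M : Fin (k + 1) ⥤ ModuleCat.{u} (Abar ω)) {P : ModuleCat.{u} A}
  (π : P →ₛₗ[toAbar ω] Chain.top M)

/-- The preimages in `P` of the submodules of a sequence of modules. -/
def preimage (j : ℕ) : Submodule A P := (Chain.imgSub M j).comap π

theorem preimage_mono {i j : ℕ} (h : i ≤ j) : preimage M π i ≤ preimage M π j := by
  rintro x (hx | ⟨l, hl, y, hy⟩)
  · exact Or.inl hx
  · exact Or.inr ⟨l, hl.trans_le h, y, hy⟩

theorem omega_smul_mem_preimage (x : P) (j : ℕ) : ω • x ∈ preimage M π j :=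
  Or.inl (map_omega_smul π x)

/-- The module factorization given by the preimages of a sequence in a cover of its last term. -/
def ofChain : ModuleFactorization ω (k + 1) where
  seq :=
    { obj := fun i => ModuleCat.of A (preimage M π i)
      map := fun f => ModuleCat.ofHom (Submodule.inclusion (preimage_mono M π (leOfHom f)))
      map_id := fun _ => rfl
      map_comp := fun _ _ => rfl }
  -- Multiplication by `ω` lands in the preimage of zero because the target of `π` is an `Ā`-module.
  last := ((omegaSMul ω P).comp (preimage M π (k + 1)).subtype).codRestrict (preimage M π 0)
    fun x => omega_smul_mem_preimage M π x 0
  comp_eq _ _ := rfl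

theorem preimage_last : preimage M π (k + 1) = ⊤ :=
  eq_top_iff.2 fun x _ => Or.inr ⟨Fin.last k, Nat.lt_succ_self k, π x, Chain.toTop_last _⟩

variable {M π}

/-- The preimage of index `j` is the kernel of the cover `P → Quot M j`, so `ker_cover` applies; the
last preimage is all of `P`. -/
theorem ofChain_isG0F (hM : Chain.IsGPFiltered M) (hP : Module.Projective A P)
    (hπ : Function.Surjective π) : isG0F ω (k + 1) (ofChain M π) := by
  have hlast : Module.Projective A (preimage M π (k + 1)) :=
    Module.Projective.of_equiv (LinearEquiv.ofTop _ (preimage_last M π)).symm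
  refine ⟨fun i => IsGP.isGorensteinProjective ?_, hlast⟩
  rcases Fin.eq_castSucc_or_eq_last i with ⟨j, rfl⟩ | rfl
  · let ρ : P →ₛₗ[toAbar ω] Chain.Quot M j := (Chain.imgSub M j).mkQ.comp π
    have h := (hM.2 j).ker_cover hP (π := ρ) ((Submodule.mkQ_surjective _).comp hπ)
    have h1 : LinearMap.ker ρ = preimage M π j := by
      ext x
      exact Submodule.Quotient.mk_eq_zero _
    rw [h1] at h
    exact h
  · exact isGPMod_of_projective hlast

/-- Monicity lets `π` restrict to maps from the preimages to the entries `M_l`. Each has the kernel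
of `π`, which is the term of index `0`, as its kernel. -/
theorem cokSeqObj_ofChain_iso (hM : Chain.Monic M) (hπ : Function.Surjective π) :
    Nonempty (cokSeqObj (ofChain M π) ≅ M) := by
  have hlift := fun l : Fin (k + 1) => exists_lift_of_mem_range (τ := toAbar ω) (hM l)
    (π.comp (preimage M π (l.val + 1)).subtype) fun x => Chain.mem_imgSub_succ x.2
  choose ψ hψ using hlift
  have hψ0 : ∀ (l : Fin (k + 1)) (x : preimage M π (l.val + 1)), ψ l x = 0 ↔
      toCok (ofChain M π) l x = 0 := by
    intro l x
    refine Iff.trans ?_ (toCok_eq_zero_iff (ofChain M π)).symm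
    constructor
    · intro h
      have h1 : π x = 0 := (hψ l x).symm.trans (by rw [h, map_zero])
      exact ⟨⟨x, Or.inl h1⟩, rfl⟩
    · rintro ⟨y, rfl⟩
      apply hM l
      rw [map_zero]
      exact (hψ l _).trans (Chain.imgSub_zero y.2)
  have hdesc := fun l : Fin (k + 1) => exists_desc_of_surjective (toAbar_surjective ω)
    (p := toCokBar (ofChain M π) l) (toCok_surjective _ l) (ψ l) fun x hx => (hψ0 l x).2 hx
  choose φ hφ using hdesc
  have hφtop : ∀ (l : Fin (k + 1)) (x : preimage M π (l.val + 1)),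
      Chain.toTop M l (φ l (toCok (ofChain M π) l x)) = π x := fun l x =>
    (congrArg (Chain.toTop M l) (hφ l x)).trans (hψ l x)
  have hbij : ∀ l, Function.Bijective (φ l) := by
    intro l
    constructor
    · rw [injective_iff_map_eq_zero]
      intro c hc
      obtain ⟨x, rfl⟩ := toCok_surjective (ofChain M π) l c
      exact (hψ0 l x).1 ((hφ l x).symm.trans hc)
    · intro y
      obtain ⟨x, hx⟩ := hπ (Chain.toTop M l y)
      refine ⟨toCok (ofChain M π) l ⟨x, Or.inr ⟨l, Nat.lt_succ_self _, y, hx.symm⟩⟩, hM l ?_⟩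
      rw [hφtop, hx]
  refine ⟨NatIso.ofComponents (fun l => (LinearEquiv.ofBijective (φ l) (hbij l)).toModuleIso) ?_⟩
  intro l l' f
  refine ModuleCat.hom_ext (LinearMap.ext fun c => ?_)
  obtain ⟨x, rfl⟩ := toCok_surjective (ofChain M π) l c
  change φ l' (toCok (ofChain M π) l' (succMap _ (leOfHom f) x)) =
    (M.map f).hom (φ l (toCok (ofChain M π) l x))
  apply hM l'
  rw [Chain.toTop_map]
  exact (hφtop l' _).trans (hφtop l x).symm

end OfChain

theorem exists_cok0_iso {N : ModuleCat.{u} (Lambda ω m)} (hN : IsGP N) :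
    ∃ X : ModuleFactorization ω m, isG0F ω m X ∧ Nonempty ((cok0 ω m).obj X ≅ N) := by
  let e := (columnFunctor (Abar ω) m).objObjPreimageIso N
  cases m with
  | zero =>
    -- For `n = 1` the ring `Λ₀` is zero, so any object of `G⁰F₁` serves as a preimage.
    have hP : Module.Projective A PUnit.{u + 1} := inferInstance
    refine ⟨(theta0 ω 0).obj (ModuleCat.of A PUnit),
      ⟨fun _ => IsGP.isGorensteinProjective (isGPMod_of_projective hP), hP⟩, ⟨?_ ≪≫ e⟩⟩
    exact (columnFunctor (Abar ω) 0).mapIso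
      (NatIso.ofComponents (fun i => i.elim0) fun {i} => i.elim0)
  | succ k =>
    have hM := Chain.isGP_iff.1
      ((isGP_map_iff (columnFunctor (Abar ω) (k + 1)).asEquivalence).1 (hN.of_iso e.symm))
    obtain ⟨P, π, hP, hπ⟩ := exists_semilinear_cover (toAbar ω)
      (Chain.top ((columnFunctor (Abar ω) (k + 1)).objPreimage N))
    obtain ⟨i⟩ := cokSeqObj_ofChain_iso hM.1 hπ
    exact ⟨_, ofChain_isG0F hM hP hπ, ⟨(columnFunctor (Abar ω) (k + 1)).mapIso i ≪≫ e⟩⟩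

/-! #### The equivalence -/

section Induced

variable (hG : ∀ X : G0F ω m, IsGorensteinProjective ((cok0 ω m).obj X.obj))

theorem cok0Induced_additive : (cok0Induced ω m hG).Additive where
  map_add {X Y f g} := by
    obtain ⟨f, rfl⟩ := (Quotient.functor (idealRel ω m)).map_surjective f
    obtain ⟨g, rfl⟩ := (Quotient.functor (idealRel ω m)).map_surjective g
    apply ObjectProperty.hom_ext
    change (cok0 ω m).map (f.hom + g.hom) = (cok0 ω m).map f.hom + (cok0 ω m).map g.hom
    have h := cok0_map_sub (f.hom + g.hom) g.hom
    rw [add_sub_cancel_right] at h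
    rw [h, sub_add_cancel]

theorem cok0Induced_faithful : (cok0Induced ω m hG).Faithful where
  map_injective {X Y f g} h := by
    obtain ⟨f, rfl⟩ := (Quotient.functor (idealRel ω m)).map_surjective f
    obtain ⟨g, rfl⟩ := (Quotient.functor (idealRel ω m)).map_surjective g
    apply CategoryTheory.Quotient.sound
    have h1 : (cok0 ω m).map f.hom = (cok0 ω m).map g.hom := congrArg (fun k => k.hom) h
    refine inIdeal_of_cokSeq_map_eq_zero X.as.property Y.as.property _ ?_
    apply (columnFunctor (Abar ω) m).map_injective
    change (cok0 ω m).map (f.hom - g.hom) = _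
    rw [cok0_map_sub, h1, sub_self]
    rfl

theorem cok0Induced_full : (cok0Induced ω m hG).Full where
  map_surjective {X Y} φ := by
    let φ' : (cok0 ω m).obj X.as.obj ⟶ (cok0 ω m).obj Y.as.obj := φ.hom
    obtain ⟨ψ, hψ⟩ := (columnFunctor (Abar ω) m).map_surjective φ'
    obtain ⟨f, hf⟩ := exists_cokSeq_map_eq X.as.property Y.as.property ψ
    refine ⟨(Quotient.functor (idealRel ω m)).map (ObjectProperty.homMk f), ?_⟩
    apply ObjectProperty.hom_ext
    change (columnFunctor (Abar ω) m).map ((cokSeq ω m).map f) = φ'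
    rw [hf, hψ]

theorem cok0Induced_essSurj : (cok0Induced ω m hG).EssSurj where
  mem_essImage N := by
    obtain ⟨X, hX, ⟨e⟩⟩ := exists_cok0_iso (IsGorensteinProjective.isGP N.property)
    exact ⟨⟨⟨X, hX⟩⟩, ⟨ObjectProperty.isoMk _ e⟩⟩

end Induced

end ModuleFactorization

end ModFact

end

/-- Let `A` be a left noetherian ring, `ω` a regular and normal element, and `n = m + 1 ≥ 1`.
Then `Cok⁰` sends `G⁰F_n(A; ω)` to Gorenstein projective `Λ_{n-1}`-modules, and the induced functor
`G⁰F_n(A; ω) / I ⥤ Λ_{n-1}-GProj` is an additive equivalence. -/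
theorem mainTheorem8 {A : Type u} [Ring A] [IsNoetherianRing A] (ω : A)
    [ModFact.RegularNormal ω] (m : ℕ) :
    ∃ hG : ∀ X : ModFact.ModuleFactorization.G0F ω m,
        ModFact.IsGorensteinProjective ((ModFact.ModuleFactorization.cok0 ω m).obj X.obj),
      (ModFact.ModuleFactorization.cok0Induced ω m hG).Additive ∧
        (ModFact.ModuleFactorization.cok0Induced ω m hG).IsEquivalence := by
  have hG : ∀ X : ModFact.ModuleFactorization.G0F ω m,
      ModFact.IsGorensteinProjective ((ModFact.ModuleFactorization.cok0 ω m).obj X.obj) :=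
    fun X => (ModFact.ModuleFactorization.cok0_isGP X.property).isGorensteinProjective
  exact ⟨hG, ModFact.ModuleFactorization.cok0Induced_additive hG,
    { faithful := ModFact.ModuleFactorization.cok0Induced_faithful hG
      full := ModFact.ModuleFactorization.cok0Induced_full hG
      essSurj := ModFact.ModuleFactorization.cok0Induced_essSurj hG }⟩
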